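/- Setting. Let $0<r_i<r_e$ and $0<\epsilon<r_e-r_i$. Put $$c_i=\frac{r_e^2-r_i^2-(r_e-r_i-\epsilon)^2}{2(r_e-r_i-\epsilon)},\quad c_e=c_i+r_e-r_i-\epsilon,\quad \alpha=\frac{\sqrt{\epsilon(2r_i+\epsilon)(2r_e-\epsilon)(2r_e-2r_i-\epsilon)}}{2(r_e-r_i-\epsilon)},\quad r_*=\sqrt{\frac{2r_ir_e}{r_e-r_i}},$$ $\xi_i=\ln|c_i+\alpha|-\ln r_i$, $\xi_e=\ln|c_e+\alpha|-\ln r_e$, and let $B_i\subset B_e$ be the open disks with centers $(c_i,0),(c_e,0)$ and radii $r_i,r_e$ (so that $\mathrm{dist}(\partial B_i,\partial B_e)=\epsilon$). Bipolar coordinates $(\xi,\theta)\in\mathbb R\times(-\pi,\pi]$ are defined by $e^{\xi+\mathrm i\theta}=\frac{\alpha+z}{\alpha-z}$, $z=x+\mathrm iy$ (with $e^{\xi-\mathrm i\theta}=0$ at $z=-\alpha$ and $e^{-\xi-\mathrm i\theta}=0$ at $z=\alpha$), and $\hat{\mathbf e}_\xi=\frac{\partial\mathbf x/\partial\xi}{|\partial\mathbf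 x/\partial\xi|}$. For conductivities $k_i,k_e>0$ let $\sigma=k_i\chi(B_i)+k_e\chi(B_e\setminus B_i)+\chi(\mathbb R^2\setminus B_e)$ and $$\tau_i=\frac{k_i-k_e}{k_i+k_e},\quad \tau_e=\frac{1-k_e}{1+k_e},\quad \tau=\tau_i\tau_e,\quad \beta=\frac{r_*(-\ln\tau)}{4\sqrt\epsilon}\ \ (\text{if }\tau>0).$$ For $|z|<1$ and $\beta\ge0$ let $$L(z;\beta)=-\int_0^\infty\frac{ze^{-(\beta+1)t}}{1+ze^{-t}}\,dt,\qquad P(z;\beta)=-z\,\frac{\partial L}{\partial z}(z;\beta)=\int_0^\infty\frac{ze^{-(\beta+1)t}}{(1+ze^{-t})^2}\,dt .$$ For an entire harmonic function $H$ on $\mathbb R^2$ put $(C_x,C_y)=\nabla H(\mathbf 0)$ and let $u$ be the (continuous representative of the) weak solution in $H^1_{loc}(\mathbb R^2)$ of $\nabla\cdot\sigma\nabla u=0$ in $\mathbb R^2$ with $u(\mathbf x)-H(\mathbf x)=O(|\mathbf x|^{-1})$ as $|\mathbf x|\to\infty$. Theorem. There is $\epsilon_0\in(0,r_e-r_i]$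 depending only on $r_i,r_e$ such that for every entire harmonic $H$ the following hold for all $0<\epsilon<\epsilon_0$, with constants $C$ depending only on $r_i,r_e,H$ (and on $\eta$ in (b)(ii)), hence independent of $\epsilon,k_i,k_e$ and of the point. (a) If $\tau>0$, then $$u=H+C_xr_*^2\,\Re q+C_yr_*^2\,\Im q+r\quad\text{in }\mathbb R^2,$$ where $$q=\frac12\begin{cases}-(\tau+\tau_i)L(e^{\xi-\mathrm i\theta-2\xi_i};\beta)+(\tau+\tau_e)L(e^{\xi-\mathrm i\theta-2\xi_e};\beta)&\text{in }\mathbb R^2\setminus B_e,\\-(\tau+\tau_i)L(e^{\xi-\mathrm i\theta-2\xi_i};\beta)+(\tau+\tau_e)L(e^{-\xi-\mathrm i\theta};\beta)&\text{in }B_e\setminus B_i,\\-(\tau+\tau_i)L(e^{-\xi-\mathrm i\theta};\beta)+(\tau+\tau_e)L(e^{-\xi-\mathrm i\theta};\beta)&\text{in }B_i,\end{cases}$$ and $\|\nabla r\|_{L^\infty(\mathbb R^2)}\le C$; more precisely, $r$ is continuous on $\mathbb R^2$, and differentiable with $|\nabla r|\le C$ off $\partial B_i\cup\partial B_e$. (b)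 (i) For all $k_i,k_e>0$, $|\nabla(u-H)|\le C$ in $\mathbb R^2\setminus\overline{B_e\setminus B_i}$. (ii) Blow-up occurs only when $\tau_i$ and $\tau_e$ are both close to $1$: for every $\eta>0$ there is $C$ such that $|\nabla(u-H)|\le C$ on $\mathbb R^2\setminus(\partial B_i\cup\partial B_e)$ whenever $\tau_i\le1-\eta$ or $\tau_e\le1-\eta$. Moreover, $\tau_i,\tau_e\to1$ is equivalent to $0<k_e\ll1,k_i$: for every $\eta>0$ there is $\delta>0$ such that, for all $k_i,k_e>0$, $k_e<\delta\min(1,k_i)$ implies $\tau_i,\tau_e>1-\eta$, and $\tau_i,\tau_e>1-\delta$ implies $k_e<\eta\min(1,k_i)$. (iii) If $\tau_i,\tau_e>0$ (that is, $k_e<1$ and $k_e<k_i$), then at every point of the shell $B_e\setminus\overline{B_i}$ $$\Big|\nabla(u-H)-\frac{r_*(\tau_i+\tau_e+2\tau)}{2\sqrt\epsilon}(\cosh\xi+\cos\theta)\big(C_x\,\Re P(e^{-\xi-\mathrm i\theta};\beta)+C_y\,\Im P(e^{-\xi-\mathrm i\theta};\beta)\big)\hat{\mathbf e}_\xi\Big|\le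 C .$$ -/

import Mathlib

open MeasureTheory
open scoped ContDiff

noncomputable section

namespace CoreShell

/-! ## Geometry

The plane `ℝ²` is `ℂ` with `z = x + i y`; its real inner product is the Euclidean one, and a vector
`(a, b)` is the complex number `a + i b`. The core is the disk `Bᵢ` of radius `rI`, the core together
with the shell is the disk `Bₑ` of radius `rE`, and `ε` is the distance of the two boundary circles.
The closest points of the two circles tend to the origin as `ε → 0`. -/

/-- Abscissa of the center of the core `Bᵢ`. -/
def cI (rI rE ε : ℝ) : ℝ := (rE ^ 2 - rI ^ 2 - (rE - rI - ε) ^ 2) / (2 * (rE - rI - ε))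

/-- Abscissa of the center of `Bₑ`. -/
def cE (rI rE ε : ℝ) : ℝ := cI rI rE ε + rE - rI - ε

/-- The core `Bᵢ`. -/
def coreDisk (rI rE ε : ℝ) : Set ℂ := Metric.ball (cI rI rE ε : ℂ) rI

/-- The disk `Bₑ`, that is, the core together with the shell. -/
def outerDisk (rI rE ε : ℝ) : Set ℂ := Metric.ball (cE rI rE ε : ℂ) rE

/-- The number `α`: the common fixed points of the two combined reflections are `(∓α, 0)`. -/
def alpha (rI rE ε : ℝ) : ℝ :=
  Real.sqrt (ε * (2 * rI + ε) * (2 * rE - ε) * (2 * rE - 2 * rI - ε)) / (2 * (rE - rI - ε))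

/-- The number `r_*`. -/
def rStar (rI rE : ℝ) : ℝ := Real.sqrt (2 * rI * rE / (rE - rI))

/-- `∂Bᵢ` is the level curve `{ξ = ξᵢ}`. -/
def xiI (rI rE ε : ℝ) : ℝ := Real.log |cI rI rE ε + alpha rI rE ε| - Real.log rI

/-- `∂Bₑ` is the level curve `{ξ = ξₑ}`. -/
def xiE (rI rE ε : ℝ) : ℝ := Real.log |cE rI rE ε + alpha rI rE ε| - Real.log rE

/-! ## Bipolar coordinates with poles `(∓α, 0)` (here `a` stands for `α`) -/

/-- `e^{ξ + iθ} = (α + z) / (α - z)`. Hence `e^{ξ - iθ}` is its complex conjugate and `e^{-ξ - iθ}`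
is its inverse; at `z = α`, where `ξ = +∞`, the inverse has the correct value `0`. -/
def bipolarExp (a : ℝ) (z : ℂ) : ℂ := ((a : ℂ) + z) / ((a : ℂ) - z)

/-- The coordinate `ξ` of the point `z` (off the two poles). -/
def bipolarXi (a : ℝ) (z : ℂ) : ℝ := Real.log ‖bipolarExp a z‖

/-- The coordinate `θ ∈ (-π, π]` of the point `z` (off the two poles). -/
def bipolarTheta (a : ℝ) (z : ℂ) : ℝ := Complex.arg (bipolarExp a z)

/-- The point with bipolar coordinates `(ξ, θ)`. -/
def bipolarPoint (a ξ θ : ℝ) : ℂ :=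
  (a : ℂ) * (Complex.exp (ξ + θ * Complex.I) - 1) / (Complex.exp (ξ + θ * Complex.I) + 1)

/-- The unit vector `ê_ξ = (∂x/∂ξ) / |∂x/∂ξ|` at the point `z`. -/
def eXi (a : ℝ) (z : ℂ) : ℂ :=
  let v : ℂ := deriv (fun s : ℝ => bipolarPoint a s (bipolarTheta a z)) (bipolarXi a z)
  (‖v‖⁻¹ : ℝ) • v

/-! ## Material parameters -/

/-- `τᵢ`. -/
def tauI (kI kE : ℝ) : ℝ := (kI - kE) / (kI + kE)

/-- `τₑ`. -/
def tauE (kE : ℝ) : ℝ := (1 - kE) / (1 + kE)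

/-- `τ = τᵢ τₑ`. -/
def tau (kI kE : ℝ) : ℝ := tauI kI kE * tauE kE

/-- `β`, meaningful for `0 < τ` (and then positive). -/
def beta (rI rE ε kI kE : ℝ) : ℝ :=
  rStar rI rE * (-Real.log (tau kI kE)) / (4 * Real.sqrt ε)

/-! ## The Lerch transcendent function -/

/-- `L(z; b)`, for `|z| < 1` and `b ≥ 0`. -/
def lerchL (z : ℂ) (b : ℝ) : ℂ :=
  -∫ t in Set.Ioi (0 : ℝ),
    z * (Real.exp (-(b + 1) * t) : ℂ) / (1 + z * (Real.exp (-t) : ℂ))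

/-- `P(z; b) = -z ∂L/∂z (z; b)`, written as an integral, for `|z| < 1` and `b ≥ 0`. -/
def lerchP (z : ℂ) (b : ℝ) : ℂ :=
  ∫ t in Set.Ioi (0 : ℝ),
    z * (Real.exp (-(b + 1) * t) : ℂ) / (1 + z * (Real.exp (-t) : ℂ)) ^ 2

open Classical in
/-- The singular function `q(·; β, τᵢ, τₑ)`. -/
def singularFun (rI rE ε kI kE : ℝ) (z : ℂ) : ℂ :=
  let b := beta rI rE ε kI kE
  let w := bipolarExp (alpha rI rE ε) z
  let p : ℂ := (tau kI kE + tauI kI kE : ℝ)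
  let m : ℂ := (tau kI kE + tauE kE : ℝ)
  (1 / 2) *
    (if z ∈ coreDisk rI rE ε then
      -p * lerchL w⁻¹ b + m * lerchL w⁻¹ b
    else if z ∈ outerDisk rI rE ε then
      -p * lerchL ((starRingEnd ℂ) w * (Real.exp (-2 * xiI rI rE ε) : ℂ)) b + m * lerchL w⁻¹ b
    else
      -p * lerchL ((starRingEnd ℂ) w * (Real.exp (-2 * xiI rI rE ε) : ℂ)) b
        + m * lerchL ((starRingEnd ℂ) w * (Real.exp (-2 * xiE rI rE ε) : ℂ)) b)

/-! ## The conductivity problem -/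

open Classical in
/-- The conductivity profile `σ`. -/
def conductivity (rI rE ε kI kE : ℝ) (z : ℂ) : ℝ :=
  if z ∈ coreDisk rI rE ε then kI else if z ∈ outerDisk rI rE ε then kE else 1

/-- `g` is the weak gradient of `u` on the whole plane. -/
def HasWeakGradient (u : ℂ → ℝ) (g : ℂ → ℂ) : Prop :=
  ∀ φ : ℂ → ℝ, ContDiff ℝ ∞ φ → HasCompactSupport φ →
    ∫ z, u z • gradient φ z = -∫ z, φ z • g z

/-- `u` is the solution of `∇ · σ∇u = 0` in `ℝ²`, `u - H = O(|x|⁻¹)` as `|x| → ∞`. The equation is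
understood in the weak sense, for `u ∈ H¹_loc`; `u` is the continuous representative. -/
structure IsSolution (rI rE ε kI kE : ℝ) (H u : ℂ → ℝ) : Prop where
  continuous : Continuous u
  weak_form : ∃ g : ℂ → ℂ, (∀ K : Set ℂ, IsCompact K → MemLp g 2 (volume.restrict K)) ∧
    HasWeakGradient u g ∧
    ∀ φ : ℂ → ℝ, ContDiff ℝ ∞ φ → HasCompactSupport φ →
      ∫ z, conductivity rI rE ε kI kE z * inner ℝ (g z) (gradient φ z) = 0
  decay : (fun z => u z - H z) =O[Bornology.cobounded ℂ] fun z => ‖z‖⁻¹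

/-- `f` is differentiable at every point of `S`, with gradient bounded by `C`. -/
def GradBoundedOn (f : ℂ → ℝ) (S : Set ℂ) (C : ℝ) : Prop :=
  ∀ z ∈ S, DifferentiableAt ℝ f z ∧ ‖gradient f z‖ ≤ C

/-- The complement of the two circles `∂Bᵢ` and `∂Bₑ`. -/
def offCircles (rI rE ε : ℝ) : Set ℂ :=
  (frontier (coreDisk rI rE ε) ∪ frontier (outerDisk rI rE ε))ᶜ

/-- The remainder `r = u - H - C_x r_*² Re q - C_y r_*² Im q`, with `(C_x, C_y) = ∇H(0)`. -/
def remainder (rI rE ε kI kE : ℝ) (H u : ℂ → ℝ) (z : ℂ) : ℝ :=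
  u z - (H z + (gradient H 0).re * rStar rI rE ^ 2 * (singularFun rI rE ε kI kE z).re
    + (gradient H 0).im * rStar rI rE ^ 2 * (singularFun rI rE ε kI kE z).im)

/-- The blow-up term of `∇(u - H)` in the shell, a multiple of `ê_ξ`, with `(C_x, C_y) = ∇H(0)`. -/
def blowupTerm (rI rE ε kI kE : ℝ) (H : ℂ → ℝ) (z : ℂ) : ℂ :=
  let a := alpha rI rE ε
  let ξ := bipolarXi a z
  let θ := bipolarTheta a z
  let P : ℂ := lerchP (Complex.exp (-ξ - θ * Complex.I)) (beta rI rE ε kI kE)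
  let c : ℝ := rStar rI rE * (tauI kI kE + tauE kE + 2 * tau kI kE) / (2 * Real.sqrt ε)
  ((gradient H 0).re * c * (Real.cosh ξ + Real.cos θ) * P.re
    + (gradient H 0).im * c * (Real.cosh ξ + Real.cos θ) * P.im) • eXi a z

end CoreShell

end

open CoreShell

/-! In the coordinate `w = (a + z) / (a - z)` the two circles are level sets of `|w|`, and the
reflection in the circle `ξ = ξ₀` is `w ↦ e^{2ξ₀} / w̄`. Reflecting in the outer and then in the
inner circle is therefore the dilation of `w` by `e^μ`, `μ = 2(ξᵢ - ξₑ)`, that is, a step of a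
hyperbolic flow with attracting fixed point `a`. Write `H = Re F` with `F` entire. The method of
images expresses the solution in each region through the single series `T = ∑ τⁿ F(zₙ)`, where `zₙ`
is the image of `z` after `n` steps, composed with the identity and the two reflections; the
functional equation `T = F + τ T ∘ flow` (`imageSum_eq`) makes the pieces fit together.

The candidate is a combination of Lipschitz functions on the plane, so it has a weak gradient. Its
weak equation is obtained from a harmonic conjugate: `σ∇U` is a rotated gradient of the solution
with opposite contrasts and incident field `-iF` (`NestedCircles.gradient_conjugate`). An energy
argument shows that a decaying weak solution vanishes (`eq_zero_of_weak_solution`), so `u` is the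
candidate minus its limit constant (`IsModel.solution_unique`).

All gradient estimates concern `T' = ∑ τⁿ F'(zₙ) zₙ'`. Since `|zₙ'| ≤ 1`, `(1 - |τ|) T'` is bounded.
Moreover `a` and `μ` are comparable, and then the total variation of the terms along the flow is
bounded uniformly (`sum_flowMajorant_le`). Hence for `τ ≤ 0` summation by parts bounds `T'` itself,
and for `τ > 0` the sum may be replaced by an integral and `F'` by `F'(0)`, with bounded errors.
Because `μ ≈ 4a / r_*²` and `β ≈ -log τ / μ`, that integral is `r_*² / 2` times the derivative of
the Lerch function (`norm_imageSumDeriv_sub_lerchMapDeriv_le`).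

Replacing `T'` in the exact gradient formulas leaves only bounded terms: `F'`, `(1 - τ) T'` and the
replacement error; this is (a). In the exterior the coefficient of `T'` is `O(1 - |τ|)` after use of
the functional equation, and in the core it is so when `τ > 0`, hence no blow-up there. In the shell
the coefficient `1 + τₑ` survives, but it is compensated by `1 - τ` unless both contrasts are near
`1`. For (b)(iii), a point of the shell and its reflection in the inner circle lie on one flow line
less than one step apart; up to bounded terms the two contributions to the gradient are mirror
images, so tangential parts cancel and normal parts add. -/

noncomputable section
namespace CoreShell

/-! ## The hyperbolic flow with fixed points `±a` -/

/-- Denominator of the flow. -/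
def flowDen (a s : ℝ) (z : ℂ) : ℂ := ((s : ℂ) + 1) * a + ((s : ℂ) - 1) * z

/-- In the coordinate `w = (a + z) / (a - z)` this is the dilation `w ↦ s w`. -/
def flow (a s : ℝ) (z : ℂ) : ℂ := a * (((s : ℂ) - 1) * a + ((s : ℂ) + 1) * z) / flowDen a s z

/-- The complex derivative of `flow a s`. -/
def flowDeriv (a s : ℝ) (z : ℂ) : ℂ := 4 * s * (a : ℂ) ^ 2 / flowDen a s z ^ 2

section flow
variable {a s : ℝ} {z : ℂ}

lemma flowDen_re : (flowDen a s z).re = (s + 1) * a + (s - 1) * z.re := by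
  simp [flowDen]

lemma flowDen_im : (flowDen a s z).im = (s - 1) * z.im := by
  simp [flowDen]

/-- For `0 < a` both summands of the denominator have nonnegative real part in the right half-plane,
so they cannot cancel. Every decay estimate for the flow rests on this bound and on
`mul_norm_le_norm_flowDen`. -/
lemma le_norm_flowDen (hs : 1 ≤ s) (hz : 0 ≤ z.re) :
    (s + 1) * a ≤ ‖flowDen a s z‖ := by
  refine le_trans ?_ (Complex.re_le_norm _)
  rw [flowDen_re]
  nlinarith [mul_nonneg (sub_nonneg.2 hs) hz]

lemma norm_flowDen_pos (ha : 0 < a) (hs : 1 ≤ s) (hz : 0 ≤ z.re) : 0 < ‖flowDen a s z‖ :=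
  lt_of_lt_of_le (by positivity) (le_norm_flowDen hs hz)

lemma flowDen_ne_zero (ha : 0 < a) (hs : 1 ≤ s) (hz : 0 ≤ z.re) : flowDen a s z ≠ 0 :=
  norm_pos_iff.1 (norm_flowDen_pos ha hs hz)

lemma mul_norm_le_norm_flowDen (ha : 0 < a) (hs : 1 ≤ s) (hz : 0 ≤ z.re) :
    (s - 1) * ‖z‖ ≤ ‖flowDen a s z‖ := by
  have h0 : 0 ≤ s - 1 := sub_nonneg.2 hs
  refine abs_le_of_sq_le_sq' ?_ (norm_nonneg _) |>.2
  rw [mul_pow, ← Complex.normSq_eq_norm_sq, ← Complex.normSq_eq_norm_sq, Complex.normSq_apply,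
    Complex.normSq_apply, flowDen_re, flowDen_im]
  have h1 : 0 ≤ (s - 1) * z.re := mul_nonneg h0 hz
  have h2 : 0 ≤ (s + 1) * a := by positivity
  nlinarith [mul_nonneg h1 h2]

lemma two_mul_norm_flowDen (ha : 0 < a) (hs : 1 ≤ s) (hz : 0 ≤ z.re) :
    (s + 1) * a + (s - 1) * ‖z‖ ≤ 2 * ‖flowDen a s z‖ := by
  linarith [le_norm_flowDen (a := a) hs hz, mul_norm_le_norm_flowDen ha hs hz]

lemma norm_flowDeriv_eq (hs : 1 ≤ s) :
    ‖flowDeriv a s z‖ = 4 * s * a ^ 2 / ‖flowDen a s z‖ ^ 2 := by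
  have : 0 ≤ s := by linarith
  simp [flowDeriv, abs_of_nonneg this]

lemma norm_flowDeriv_le_div (ha : 0 < a) (hs : 1 ≤ s) (hz : 0 ≤ z.re) :
    ‖flowDeriv a s z‖ ≤ 4 * s / (s + 1) ^ 2 := by
  rw [norm_flowDeriv_eq hs]
  have h1 := le_norm_flowDen (a := a) hs hz
  calc 4 * s * a ^ 2 / ‖flowDen a s z‖ ^ 2 ≤ 4 * s * a ^ 2 / ((s + 1) * a) ^ 2 := by gcongr
    _ = 4 * s / (s + 1) ^ 2 := by field_simp

lemma norm_flowDeriv_le_one (ha : 0 < a) (hs : 1 ≤ s) (hz : 0 ≤ z.re) :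
    ‖flowDeriv a s z‖ ≤ 1 := by
  refine (norm_flowDeriv_le_div ha hs hz).trans ?_
  rw [div_le_one (by positivity)]
  nlinarith [sq_nonneg (s - 1)]

lemma norm_flowDeriv_le_inv (ha : 0 < a) (hs : 1 ≤ s) (hz : 0 ≤ z.re) :
    ‖flowDeriv a s z‖ ≤ 4 * s⁻¹ := by
  refine (norm_flowDeriv_le_div ha hs hz).trans ?_
  rw [← div_eq_mul_inv, div_le_div_iff₀ (by positivity) (by positivity)]
  nlinarith

lemma norm_flow_eq (ha : 0 < a) :
    ‖flow a s z‖ = a * ‖((s : ℂ) - 1) * a + ((s : ℂ) + 1) * z‖ / ‖flowDen a s z‖ := by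
  simp [flow, abs_of_pos ha]

lemma norm_flow_num_le (ha : 0 < a) (hs : 1 ≤ s) :
    ‖((s : ℂ) - 1) * a + ((s : ℂ) + 1) * z‖ ≤ (s - 1) * a + (s + 1) * ‖z‖ := by
  have h1 : ‖(s : ℂ) - 1‖ = s - 1 := by
    rw [← Complex.ofReal_one, ← Complex.ofReal_sub, Complex.norm_real, Real.norm_of_nonneg]
    linarith
  have h2 : ‖(s : ℂ) + 1‖ = s + 1 := by
    rw [← Complex.ofReal_one, ← Complex.ofReal_add, Complex.norm_real, Real.norm_of_nonneg]
    linarith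
  refine (norm_add_le _ _).trans ?_
  rw [norm_mul, norm_mul, h1, h2, Complex.norm_real, Real.norm_of_nonneg ha.le]

/-- Keeps the whole orbit in one disk, so that a single bound on `F'` and `F''` serves all images.
-/
lemma norm_flow_le (ha : 0 < a) (hs : 1 ≤ s) (hz : 0 ≤ z.re) : ‖flow a s z‖ ≤ a + ‖z‖ := by
  rw [norm_flow_eq ha, div_le_iff₀ (norm_flowDen_pos ha hs hz)]
  have h1 := norm_flow_num_le (z := z) ha hs
  have h2 := le_norm_flowDen (a := a) hs hz
  calc a * ‖((s : ℂ) - 1) * a + ((s : ℂ) + 1) * z‖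
      ≤ a * ((s - 1) * a + (s + 1) * ‖z‖) := by gcongr
    _ ≤ (a + ‖z‖) * ((s + 1) * a) := by nlinarith [norm_nonneg z, sq_nonneg a]
    _ ≤ _ := by gcongr

lemma flow_re_pos (ha : 0 < a) (hs : 1 ≤ s) (hz : 0 < z.re) : 0 < (flow a s z).re := by
  have hD := norm_flowDen_pos ha hs hz.le
  have h : (flow a s z).re = a * (((s - 1) * a + (s + 1) * z.re) * ((s + 1) * a + (s - 1) * z.re)
      + (s + 1) * z.im * ((s - 1) * z.im)) / ‖flowDen a s z‖ ^ 2 := by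
    rw [flow, Complex.div_re, Complex.normSq_eq_norm_sq, flowDen_re, flowDen_im]
    simp
    ring
  rw [h]
  have h0 : 0 ≤ s - 1 := sub_nonneg.2 hs
  have h1 : 0 < (s + 1) * z.re := by positivity
  have h2 : 0 ≤ (s - 1) * a := by positivity
  have h3 : 0 ≤ (s - 1) * z.re := by positivity
  have h4 : 0 < (s + 1) * a := by positivity
  have h5 : 0 ≤ (s + 1) * z.im * ((s - 1) * z.im) := by
    have : (s + 1) * z.im * ((s - 1) * z.im) = (s + 1) * (s - 1) * z.im ^ 2 := by ring
    rw [this]; positivity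
  positivity

lemma flow_one (ha : 0 < a) : flow a 1 z = z := by
  have : (a : ℂ) ≠ 0 := by exact_mod_cast ha.ne'
  simp only [flow, flowDen]
  push_cast
  field_simp
  ring

/-- Dilations of `w` compose multiplicatively; the half-plane condition keeps all denominators away
from zero. -/
lemma flow_flow {s' : ℝ} (ha : 0 < a) (hs : 1 ≤ s) (hs' : 1 ≤ s') (hz : 0 < z.re) :
    flow a s (flow a s' z) = flow a (s * s') z := by
  have ha' : (a : ℂ) ≠ 0 := by exact_mod_cast ha.ne'
  have h1 := flowDen_ne_zero ha hs' hz.le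
  have h2 := flowDen_ne_zero ha hs (flow_re_pos ha hs' hz).le
  have h3 := flowDen_ne_zero ha (one_le_mul_of_one_le_of_one_le hs hs') hz.le
  have h4 : flowDen a s (flow a s' z) * flowDen a s' z = 2 * a * flowDen a (s * s') z := by
    conv_lhs => rw [flowDen, flow, add_mul, mul_assoc _ (_ / _), div_mul_cancel₀ _ h1]
    simp only [flowDen]; push_cast; ring
  have h5 : flowDen a s (flow a s' z) = 2 * a * flowDen a (s * s') z / flowDen a s' z := by
    rw [eq_div_iff h1, h4]
  have h6 : 2 * (a : ℂ) * flowDen a (s * s') z / flowDen a s' z ≠ 0 :=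
    div_ne_zero (mul_ne_zero (mul_ne_zero two_ne_zero ha') h3) h1
  rw [flow, h5, div_eq_iff h6, flow, flow]
  field_simp
  simp only [flowDen]
  push_cast
  ring

lemma hasDerivAt_flow (ha : 0 < a) (hs : 1 ≤ s) (hz : 0 < z.re) :
    HasDerivAt (flow a s) (flowDeriv a s z) z := by
  have h1 := flowDen_ne_zero ha hs hz.le
  have hn : HasDerivAt (fun z : ℂ => (a : ℂ) * (((s : ℂ) - 1) * a + ((s : ℂ) + 1) * z))
      (a * (((s : ℂ) + 1) * 1)) z :=
    (((hasDerivAt_id z).const_mul _).const_add _).const_mul _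
  have hd : HasDerivAt (fun z : ℂ => flowDen a s z) (((s : ℂ) - 1) * 1) z :=
    ((hasDerivAt_id z).const_mul _).const_add _
  refine (hn.div hd h1).congr_deriv ?_
  rw [flowDeriv]
  congr 1
  simp only [flowDen]
  ring

end flow

/-! ### Time dependence of the flow and a summable majorant -/

section time
variable {a μ : ℝ} {z : ℂ}

lemma one_le_exp_mul {μ t : ℝ} (hμ : 0 < μ) (ht : 0 ≤ t) : 1 ≤ Real.exp (μ * t) :=
  Real.one_le_exp (by positivity)

lemma hasDerivAt_flowDen_time (μ : ℝ) (z : ℂ) (t : ℝ) :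
    HasDerivAt (fun t : ℝ => flowDen a (Real.exp (μ * t)) z)
      (μ * (Real.exp (μ * t) : ℂ) * (a + z)) t := by
  have h : HasDerivAt (fun t : ℝ => ((Real.exp (μ * t) : ℝ) : ℂ))
      ((Real.exp (μ * t) * (μ * 1) : ℝ) : ℂ) t :=
    (((hasDerivAt_id t).const_mul μ).exp).ofReal_comp
  refine (((h.add_const 1).mul_const (a : ℂ)).add ((h.sub_const 1).mul_const z)).congr_deriv ?_
  push_cast
  ring

/-- The orbit solves the Riccati equation `ż = μ (a² - z²) / (2a)`, whose right side is `μ` times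
the coordinate velocity `∂x/∂ξ`. -/
lemma hasDerivAt_flow_time (ha : 0 < a) (hμ : 0 < μ) (hz : 0 ≤ z.re) {t : ℝ} (ht : 0 ≤ t) :
    HasDerivAt (fun t : ℝ => flow a (Real.exp (μ * t)) z)
      (μ / (2 * a) * (a ^ 2 - flow a (Real.exp (μ * t)) z ^ 2)) t := by
  have h : HasDerivAt (fun t : ℝ => ((Real.exp (μ * t) : ℝ) : ℂ))
      ((Real.exp (μ * t) * (μ * 1) : ℝ) : ℂ) t :=
    (((hasDerivAt_id t).const_mul μ).exp).ofReal_comp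
  have h1 := flowDen_ne_zero ha (one_le_exp_mul hμ ht) hz
  have ha' : (a : ℂ) ≠ 0 := by exact_mod_cast ha.ne'
  have hn := (((h.sub_const 1).mul_const (a : ℂ)).add ((h.add_const 1).mul_const z)).const_mul
    (a : ℂ)
  refine (hn.div (hasDerivAt_flowDen_time μ z t) h1).congr_deriv ?_
  rw [flow]
  simp only [Pi.add_apply]
  set D := flowDen a (Real.exp (μ * t)) z with hD
  field_simp
  rw [hD]
  simp only [flowDen]
  push_cast
  ring

/-- This is the Riccati equation linearized in the initial point. -/
lemma hasDerivAt_flowDeriv_time (ha : 0 < a) (hμ : 0 < μ) (hz : 0 ≤ z.re) {t : ℝ} (ht : 0 ≤ t) :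
    HasDerivAt (fun t : ℝ => flowDeriv a (Real.exp (μ * t)) z)
      (-(μ / a) * (flow a (Real.exp (μ * t)) z * flowDeriv a (Real.exp (μ * t)) z)) t := by
  have h : HasDerivAt (fun t : ℝ => ((Real.exp (μ * t) : ℝ) : ℂ))
      ((Real.exp (μ * t) * (μ * 1) : ℝ) : ℂ) t :=
    (((hasDerivAt_id t).const_mul μ).exp).ofReal_comp
  have h1 := flowDen_ne_zero ha (one_le_exp_mul hμ ht) hz
  have ha' : (a : ℂ) ≠ 0 := by exact_mod_cast ha.ne'
  have hn := (h.const_mul (4 : ℂ)).mul_const ((a : ℂ) ^ 2)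
  refine (hn.div ((hasDerivAt_flowDen_time μ z t).pow 2) (pow_ne_zero 2 h1)).congr_deriv ?_
  rw [flow, flowDeriv]
  simp only [Pi.pow_apply]
  set D := flowDen a (Real.exp (μ * t)) z with hD
  field_simp
  rw [hD]
  simp only [flowDen]
  push_cast
  ring

/-- An antitone majorant of `‖flow‖ * ‖flowDeriv‖` and of `a * ‖flowDeriv‖` along the flow. -/
def flowMajorant (a μ x t : ℝ) : ℝ :=
  a * Real.exp (-(μ * t)) + a ^ 3 * x * Real.exp (-(μ * t))
    / (a + (1 - Real.exp (-(μ * t))) * x) ^ 3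

lemma exp_neg_mul_le_one {μ t : ℝ} (hμ : 0 < μ) (ht : 0 ≤ t) : Real.exp (-(μ * t)) ≤ 1 :=
  Real.exp_le_one_iff.2 (by have := mul_nonneg hμ.le ht; linarith)

lemma flowMajorant_nonneg {x t : ℝ} (ha : 0 < a) (hμ : 0 < μ) (hx : 0 ≤ x) (ht : 0 ≤ t) :
    0 ≤ flowMajorant a μ x t := by
  have := sub_nonneg.2 (exp_neg_mul_le_one hμ ht)
  unfold flowMajorant
  positivity

lemma mul_norm_flowDeriv_le (ha : 0 < a) (hμ : 0 < μ) (hz : 0 ≤ z.re) {t : ℝ} (ht : 0 ≤ t) :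
    a * ‖flowDeriv a (Real.exp (μ * t)) z‖ ≤ 4 * flowMajorant a μ ‖z‖ t := by
  have h := norm_flowDeriv_le_inv ha (one_le_exp_mul hμ ht) hz
  rw [← Real.exp_neg] at h
  have := sub_nonneg.2 (exp_neg_mul_le_one hμ ht)
  calc a * ‖flowDeriv a (Real.exp (μ * t)) z‖ ≤ a * (4 * Real.exp (-(μ * t))) := by gcongr
    _ = 4 * (a * Real.exp (-(μ * t)) + 0) := by ring
    _ ≤ _ := by unfold flowMajorant; gcongr; positivity

/-- The numerator of the flow is split into its part along `a` and its part along `z`. The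
denominator is bounded below by `(s + 1) a` for the first and, up to a factor `2`, by `s (a + (1 -
s⁻¹) ‖z‖)` for the second, which gives the two terms of the majorant. -/
lemma norm_flow_mul_norm_flowDeriv_le (ha : 0 < a) (hμ : 0 < μ) (hz : 0 ≤ z.re) {t : ℝ}
    (ht : 0 ≤ t) :
    ‖flow a (Real.exp (μ * t)) z‖ * ‖flowDeriv a (Real.exp (μ * t)) z‖
      ≤ 64 * flowMajorant a μ ‖z‖ t := by
  have hs := one_le_exp_mul hμ ht
  unfold flowMajorant
  have hv : Real.exp (-(μ * t)) = (Real.exp (μ * t))⁻¹ := Real.exp_neg _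
  rw [hv]
  set s := Real.exp (μ * t) with hsdef
  have hD := norm_flowDen_pos ha hs hz
  have h1 := le_norm_flowDen (a := a) hs hz
  have h2 := two_mul_norm_flowDen ha hs hz
  have hn := norm_flow_num_le (z := z) ha hs
  rw [norm_flow_eq ha, norm_flowDeriv_eq hs]
  set D := ‖flowDen a s z‖
  set x := ‖z‖ with hx
  have hx0 : 0 ≤ x := norm_nonneg _
  have hs0 : 0 ≤ s - 1 := sub_nonneg.2 hs
  have hs1 : 0 < s := by linarith
  have hv1 : 0 ≤ 1 - s⁻¹ := sub_nonneg.2 (inv_le_one_of_one_le₀ hs)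
  have hY : 0 < a + (1 - s⁻¹) * x := by positivity
  have hXY : s * (a + (1 - s⁻¹) * x) ≤ 2 * D := by
    have : s * (a + (1 - s⁻¹) * x) = s * a + (s - 1) * x := by field_simp
    rw [this]; nlinarith
  calc a * ‖((s : ℂ) - 1) * a + ((s : ℂ) + 1) * z‖ / D * (4 * s * a ^ 2 / D ^ 2)
      ≤ a * ((s - 1) * a + (s + 1) * x) / D * (4 * s * a ^ 2 / D ^ 2) := by gcongr
    -- Writing `D³` as `(2D)³ / 8` turns `4` into `32`; then `s + 1 ≤ 2s` makes it `64`.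
    _ = 4 * s * (s - 1) * a ^ 4 / D ^ 3 + 32 * s * (s + 1) * a ^ 3 * x / (2 * D) ^ 3 := by
        field_simp; ring
    _ ≤ 4 * s * (s - 1) * a ^ 4 / ((s + 1) * a) ^ 3
        + 32 * s * (s + s) * a ^ 3 * x / (s * (a + (1 - s⁻¹) * x)) ^ 3 := by gcongr
    _ ≤ 4 * (a * s⁻¹) + 64 * (a ^ 3 * x * s⁻¹ / (a + (1 - s⁻¹) * x) ^ 3) := by
        refine add_le_add ?_ (le_of_eq ?_)
        · rw [div_le_iff₀ (by positivity)]
          have : 4 * (a * s⁻¹) * ((s + 1) * a) ^ 3 = 4 * a ^ 4 * (s + 1) ^ 3 * s⁻¹ := by ring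
          rw [this, ← div_eq_mul_inv, le_div_iff₀ hs1]
          have h3 : s * (s - 1) * s ≤ (s + 1) ^ 3 := by nlinarith [sq_nonneg s]
          have ha4 : 0 < 4 * a ^ 4 := by positivity
          nlinarith [mul_le_mul_of_nonneg_left h3 ha4.le]
        · field_simp; ring
    _ ≤ _ := by
        have : 0 ≤ a * s⁻¹ := by positivity
        linarith

lemma flowMajorant_antitone {x : ℝ} (ha : 0 < a) (hμ : 0 < μ) (hx : 0 ≤ x) :
    AntitoneOn (flowMajorant a μ x) (Set.Ici 0) := by
  intro t ht t' ht' htt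
  have h1 : Real.exp (-(μ * t')) ≤ Real.exp (-(μ * t)) :=
    Real.exp_le_exp.2 (neg_le_neg (mul_le_mul_of_nonneg_left htt hμ.le))
  have h2 := sub_nonneg.2 (exp_neg_mul_le_one hμ ht)
  unfold flowMajorant
  gcongr

/-- A primitive of `flowMajorant`. -/
def flowMajorantPrim (a μ x t : ℝ) : ℝ :=
  -(a / μ * Real.exp (-(μ * t)))
    - a ^ 3 / (2 * μ) * ((a + (1 - Real.exp (-(μ * t))) * x) ^ 2)⁻¹

lemma hasDerivAt_flowMajorantPrim {x t : ℝ} (ha : 0 < a) (hμ : 0 < μ) (hx : 0 ≤ x) (ht : 0 ≤ t) :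
    HasDerivAt (flowMajorantPrim a μ x) (flowMajorant a μ x t) t := by
  have he : HasDerivAt (fun t => Real.exp (-(μ * t))) (Real.exp (-(μ * t)) * (-(μ * 1))) t :=
    (((hasDerivAt_id t).const_mul μ).neg).exp
  have h2 := sub_nonneg.2 (exp_neg_mul_le_one hμ ht)
  have hY : (a + (1 - Real.exp (-(μ * t))) * x) ≠ 0 := by positivity
  have hY' : HasDerivAt (fun t => a + (1 - Real.exp (-(μ * t))) * x)
      (-(Real.exp (-(μ * t)) * (-(μ * 1))) * x) t := ((he.const_sub 1).mul_const x).const_add a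
  refine (((he.const_mul (a / μ)).neg).sub (((hY'.pow 2).inv (pow_ne_zero 2 hY)).const_mul
    (a ^ 3 / (2 * μ)))).congr_deriv ?_
  unfold flowMajorant
  simp only [Pi.pow_apply]
  field_simp
  ring

/-- The sum of an antitone function is at most its value at `0` plus its integral. The value is `a +
x`, and the primitive grows by at most `a / μ + a / (2μ)`. What matters is that only the quotient `a
/ μ` enters, so the bound survives `a → 0`. -/
lemma sum_flowMajorant_le {x : ℝ} (ha : 0 < a) (hμ : 0 < μ) (hx : 0 ≤ x) (N : ℕ) :
    ∑ n ∈ Finset.range N, flowMajorant a μ x n ≤ a + x + 2 * (a / μ) := by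
  have hstep : ∀ n : ℕ, flowMajorant a μ x (n + 1 : ℕ) ≤
      flowMajorantPrim a μ x (n + 1 : ℕ) - flowMajorantPrim a μ x n := by
    intro n
    have hlt : (n : ℝ) < (n + 1 : ℕ) := by push_cast; linarith
    have hn : (0 : ℝ) ≤ n := Nat.cast_nonneg n
    obtain ⟨c, hc, hc'⟩ := exists_hasDerivAt_eq_slope (flowMajorantPrim a μ x)
      (flowMajorant a μ x) hlt
      (fun y hy => (hasDerivAt_flowMajorantPrim ha hμ hx
        (hn.trans hy.1)).continuousAt.continuousWithinAt)
      (fun y hy => hasDerivAt_flowMajorantPrim ha hμ hx (hn.trans hy.1.le))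
    have h1 : ((n + 1 : ℕ) : ℝ) - n = 1 := by push_cast; ring
    rw [h1, div_one] at hc'
    rw [← hc']
    exact flowMajorant_antitone ha hμ hx (hn.trans hc.1.le) (hn.trans hlt.le) hc.2.le
  have h0 : flowMajorant a μ x 0 = a + x := by
    simp [flowMajorant]; field_simp
  have hE0 : flowMajorantPrim a μ x 0 = -(a / μ) - a / (2 * μ) := by
    simp [flowMajorantPrim]; field_simp
  have hE : ∀ n : ℕ, flowMajorantPrim a μ x n ≤ 0 := by
    intro n
    have h2 := sub_nonneg.2 (exp_neg_mul_le_one hμ (Nat.cast_nonneg (α := ℝ) n))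
    have h3 : 0 ≤ a / μ * Real.exp (-(μ * n)) := by positivity
    have h4 : 0 ≤ a ^ 3 / (2 * μ) * ((a + (1 - Real.exp (-(μ * n))) * x) ^ 2)⁻¹ := by positivity
    unfold flowMajorantPrim
    linarith
  have hquot : 0 ≤ a / μ := by positivity
  have hhalf : a / (2 * μ) = a / μ / 2 := by field_simp
  cases N with
  | zero => simp; positivity
  | succ N =>
    rw [Finset.sum_range_succ']
    have : ∑ n ∈ Finset.range N, flowMajorant a μ x (n + 1 : ℕ) ≤
        flowMajorantPrim a μ x N - flowMajorantPrim a μ x (0 : ℕ) := by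
      rw [← Finset.sum_range_sub (fun n : ℕ => flowMajorantPrim a μ x n)]
      exact Finset.sum_le_sum fun n _ => hstep n
    simp only [Nat.cast_zero] at this ⊢
    rw [h0]
    have := hE N
    linarith

end time

/-! ## Series with geometric weights -/

lemma summable_pow_mul {τ A : ℝ} {g : ℕ → ℂ} (hτ : |τ| < 1) (hg : ∀ n, ‖g n‖ ≤ A) :
    Summable fun n => (τ : ℂ) ^ n * g n := by
  refine Summable.of_norm_bounded ((summable_geometric_of_abs_lt_one
    (by rwa [abs_abs] : |(|τ|)| < 1)).mul_right A) fun n => ?_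
  rw [norm_mul, norm_pow, Complex.norm_real, Real.norm_eq_abs]
  gcongr
  exact hg n

lemma norm_tsum_pow_mul_le {τ A : ℝ} {g : ℕ → ℂ} (hτ : |τ| < 1) (hg : ∀ n, ‖g n‖ ≤ A) :
    ‖∑' n, (τ : ℂ) ^ n * g n‖ ≤ A / (1 - |τ|) := by
  have hs := hasSum_geometric_of_lt_one (abs_nonneg τ) hτ
  rw [div_eq_inv_mul]
  refine tsum_of_norm_bounded (hs.mul_right A) fun n => ?_
  rw [norm_mul, norm_pow, Complex.norm_real, Real.norm_eq_abs]
  gcongr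
  exact hg n

/-- Abel summation: `(1 - τ) ∑ τⁿ gₙ = g₀ + ∑ τⁿ⁺¹ (gₙ₊₁ - gₙ)`, and `1 - τ ≥ 1` for `τ ≤ 0`. Unlike
the geometric bound, this does not degenerate as `τ → -1`. -/
lemma norm_tsum_pow_mul_le_of_variation {τ A V : ℝ} {g : ℕ → ℂ} {d : ℕ → ℝ} (hτ : -1 < τ)
    (hτ0 : τ ≤ 0) (hg : ∀ n, ‖g n‖ ≤ A) (hd : ∀ n, ‖g (n + 1) - g n‖ ≤ d n)
    (hV : ∀ N, ∑ n ∈ Finset.range N, d n ≤ V) :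
    ‖∑' n, (τ : ℂ) ^ n * g n‖ ≤ A + V := by
  have habs : |τ| < 1 := by rw [abs_lt]; constructor <;> linarith
  have hA : 0 ≤ A := (norm_nonneg _).trans (hg 0)
  have hs := summable_pow_mul habs hg
  have hs' := summable_pow_mul habs (g := fun n => g (n + 1)) (fun n => hg (n + 1))
  have hd0 : ∀ n, 0 ≤ d n := fun n => (norm_nonneg _).trans (hd n)
  have hdsum : Summable d := summable_of_sum_range_le hd0 hV
  have key : (1 - (τ : ℂ)) * ∑' n, (τ : ℂ) ^ n * g n
      = g 0 + ∑' n, (τ : ℂ) ^ (n + 1) * (g (n + 1) - g n) := by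
    have h1 : ∑' n, (τ : ℂ) ^ (n + 1) * (g (n + 1) - g n)
        = τ * ∑' n, (τ : ℂ) ^ n * g (n + 1) - τ * ∑' n, (τ : ℂ) ^ n * g n := by
      rw [← tsum_mul_left, ← tsum_mul_left, ← (hs'.mul_left _).tsum_sub (hs.mul_left _)]
      exact tsum_congr fun n => by ring
    have h2 : ∑' n, (τ : ℂ) ^ n * g n = g 0 + τ * ∑' n, (τ : ℂ) ^ n * g (n + 1) := by
      rw [hs.tsum_eq_zero_add, ← tsum_mul_left]
      simp only [pow_zero, one_mul]
      congr 1
      exact tsum_congr fun n => by ring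
    rw [h1]
    linear_combination h2
  have hn : ‖g 0 + ∑' n, (τ : ℂ) ^ (n + 1) * (g (n + 1) - g n)‖ ≤ A + V := by
    refine (norm_add_le _ _).trans (add_le_add (hg 0) ?_)
    refine (tsum_of_norm_bounded hdsum.hasSum fun n => ?_).trans
      (hdsum.tsum_le_of_sum_range_le hV)
    rw [norm_mul, norm_pow, Complex.norm_real, Real.norm_eq_abs]
    calc |τ| ^ (n + 1) * ‖g (n + 1) - g n‖ ≤ 1 * d n := by
          gcongr
          · exact pow_le_one₀ (abs_nonneg _) habs.le
          · exact hd n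
      _ = d n := one_mul _
  rw [← key, norm_mul] at hn
  refine le_trans ?_ hn
  have : (1 : ℝ) ≤ ‖1 - (τ : ℂ)‖ := by
    rw [← Complex.ofReal_one, ← Complex.ofReal_sub, Complex.norm_real, Real.norm_eq_abs]
    exact le_trans (by linarith) (le_abs_self _)
  nlinarith [norm_nonneg (∑' n, (τ : ℂ) ^ n * g n)]

/-- On `[n, n + 1]` the difference of summand and integrand is `τⁿ (g(n) - g(t)) + (τⁿ - τᵗ) g(t)`.
The first part is summed by the variation, the second telescopes to at most `A`. The bound is
uniform in `τ ∈ (0, 1)`. -/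
lemma norm_tsum_sub_integral_le {τ A V : ℝ} {g : ℝ → ℂ} {d : ℕ → ℝ} (hτ : 0 < τ) (hτ1 : τ < 1)
    (hc : ContinuousOn g (Set.Ici 0)) (hg : ∀ t, 0 ≤ t → ‖g t‖ ≤ A)
    (hd : ∀ n : ℕ, ∀ t : ℝ, n ≤ t → t ≤ n + 1 → ‖g n - g t‖ ≤ d n)
    (hV : ∀ N, ∑ n ∈ Finset.range N, d n ≤ V) :
    ‖∑' n : ℕ, (τ : ℂ) ^ n * g n - ∫ t in Set.Ioi (0 : ℝ), (Real.exp (Real.log τ * t) : ℂ) * g t‖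
      ≤ A + V := by
  have hA : 0 ≤ A := (norm_nonneg _).trans (hg 0 le_rfl)
  have hlog : Real.log τ < 0 := Real.log_neg hτ hτ1
  have habs : |τ| < 1 := by rwa [abs_of_pos hτ]
  set f : ℝ → ℂ := fun t => (Real.exp (Real.log τ * t) : ℂ) * g t with hf
  have hfc : ContinuousOn f (Set.Ici 0) := by
    refine ContinuousOn.mul ?_ hc
    exact (by fun_prop : Continuous fun t : ℝ =>
      ((Real.exp (Real.log τ * t) : ℝ) : ℂ)).continuousOn
  have hfint : IntegrableOn f (Set.Ioi 0) := by
    have h1 : IntegrableOn (fun t => Real.exp (Real.log τ * t) * A) (Set.Ioi 0) :=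
      (integrableOn_exp_mul_Ioi hlog 0).mul_const A
    refine h1.mono' ((hfc.mono Set.Ioi_subset_Ici_self).aestronglyMeasurable
      measurableSet_Ioi) ?_
    filter_upwards [ae_restrict_mem measurableSet_Ioi] with t ht
    rw [hf, norm_mul, Complex.norm_real, Real.norm_of_nonneg (Real.exp_pos _).le]
    gcongr
    exact hg t (le_of_lt ht)
  have hsum : Summable fun n : ℕ => (τ : ℂ) ^ n * g n :=
    summable_pow_mul habs fun n => hg n (Nat.cast_nonneg n)
  have hlim := (hsum.hasSum.tendsto_sum_nat).sub
    ((intervalIntegral_tendsto_integral_Ioi 0 hfint tendsto_natCast_atTop_atTop))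
  refine le_of_tendsto hlim.norm (Filter.Eventually.of_forall fun N => ?_)
  have hii : ∀ n : ℕ, IntervalIntegrable f volume n (n + 1 : ℕ) := by
    intro n
    refine (hfc.mono ?_).intervalIntegrable
    rw [Set.uIcc_of_le (by push_cast; linarith)]
    exact fun t ht => (Nat.cast_nonneg n).trans ht.1
  have hadj := intervalIntegral.sum_integral_adjacent_intervals (μ := volume) (f := f)
    (a := fun n : ℕ => (n : ℝ)) (n := N) (fun n _ => hii n)
  simp only [Nat.cast_zero] at hadj
  rw [← hadj, ← Finset.sum_sub_distrib]
  have hterm : ∀ n : ℕ, ‖(τ : ℂ) ^ n * g n - ∫ t in (n : ℝ)..(n + 1 : ℕ), f t‖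
      ≤ d n + (τ ^ n - τ ^ (n + 1)) * A := by
    intro n
    have hconst : (τ : ℂ) ^ n * g n = ∫ _ in (n : ℝ)..(n + 1 : ℕ), (τ : ℂ) ^ n * g n := by
      rw [intervalIntegral.integral_const]; simp
    rw [hconst, ← intervalIntegral.integral_sub intervalIntegrable_const (hii n)]
    have hb := intervalIntegral.norm_integral_le_of_norm_le_const (a := (n : ℝ))
      (b := (n + 1 : ℕ)) (f := fun t => (τ : ℂ) ^ n * g n - f t)
      (C := d n + (τ ^ n - τ ^ (n + 1)) * A) ?_
    · refine hb.trans (le_of_eq ?_)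
      have : ((n + 1 : ℕ) : ℝ) - n = 1 := by push_cast; ring
      rw [this]; simp
    · intro t ht
      rw [Set.uIoc_of_le (by push_cast; linarith)] at ht
      have ht1 : (n : ℝ) ≤ t := ht.1.le
      have ht2 : t ≤ n + 1 := by simpa using ht.2
      have ht0 : 0 ≤ t := (Nat.cast_nonneg n).trans ht1
      have hpow : ∀ k : ℕ, τ ^ k = Real.exp (Real.log τ * k) := by
        intro k
        rw [mul_comm, Real.exp_nat_mul, Real.exp_log hτ]
      have hle1 : Real.exp (Real.log τ * t) ≤ τ ^ n := by
        rw [hpow]; exact Real.exp_le_exp.2 (by nlinarith)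
      have hle2 : τ ^ (n + 1) ≤ Real.exp (Real.log τ * t) := by
        rw [hpow]; refine Real.exp_le_exp.2 ?_
        push_cast; nlinarith
      have hsplit : (τ : ℂ) ^ n * g n - f t = (τ : ℂ) ^ n * (g n - g t)
          + ((τ ^ n - Real.exp (Real.log τ * t) : ℝ) : ℂ) * g t := by
        simp only [hf]; push_cast; ring
      rw [hsplit]
      refine (norm_add_le _ _).trans (add_le_add ?_ ?_)
      · rw [norm_mul, norm_pow, Complex.norm_real, Real.norm_of_nonneg hτ.le]
        calc τ ^ n * ‖g n - g t‖ ≤ 1 * d n := by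
              gcongr
              · exact pow_le_one₀ hτ.le hτ1.le
              · exact hd n t ht1 ht2
          _ = d n := one_mul _
      · rw [norm_mul, Complex.norm_real, Real.norm_of_nonneg (by linarith)]
        gcongr
        · linarith
        · exact hg t ht0
  refine (norm_sum_le _ _).trans ((Finset.sum_le_sum fun n _ => hterm n).trans ?_)
  rw [Finset.sum_add_distrib, ← Finset.sum_mul]
  have htel : ∑ n ∈ Finset.range N, (τ ^ n - τ ^ (n + 1)) = 1 - τ ^ N := by
    have := Finset.sum_range_sub' (fun n => τ ^ n) N
    simpa using this
  rw [htel]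
  have h1 : (1 - τ ^ N) * A ≤ 1 * A := by
    gcongr
    have : 0 ≤ τ ^ N := by positivity
    linarith
  linarith [hV N]

/-! ## The image series -/

/-- The sum `∑ τⁿ F(zₙ)`, where `zₙ` is the image of `z` under the flow at time `n`. -/
def imageSum (F : ℂ → ℂ) (a μ τ : ℝ) (z : ℂ) : ℂ :=
  ∑' n : ℕ, (τ : ℂ) ^ n * F (flow a (Real.exp (μ * n)) z)

/-- The complex derivative of `F ∘ flow`. -/
def imageTerm (F : ℂ → ℂ) (a μ : ℝ) (z : ℂ) (t : ℝ) : ℂ :=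
  deriv F (flow a (Real.exp (μ * t)) z) * flowDeriv a (Real.exp (μ * t)) z

/-- The complex derivative of `imageSum F a μ τ`. -/
def imageSumDeriv (F : ℂ → ℂ) (a μ τ : ℝ) (z : ℂ) : ℂ :=
  ∑' n : ℕ, (τ : ℂ) ^ n * imageTerm F a μ z n

/-- On the disk of radius `R`, the first two derivatives of `F` are at most `A`, and `A` is a
Lipschitz constant of `F'` at the origin. -/
structure DerivBounds (F : ℂ → ℂ) (R A : ℝ) : Prop where
  deriv_le : ∀ x : ℂ, ‖x‖ ≤ R → ‖deriv F x‖ ≤ A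
  deriv2_le : ∀ x : ℂ, ‖x‖ ≤ R → ‖deriv (deriv F) x‖ ≤ A
  deriv_sub_le : ∀ x : ℂ, ‖x‖ ≤ R → ‖deriv F x - deriv F 0‖ ≤ A * ‖x‖

lemma DerivBounds.nonneg {F : ℂ → ℂ} {R A : ℝ} (h : DerivBounds F R A) (hR : 0 ≤ R) : 0 ≤ A :=
  (norm_nonneg _).trans (h.deriv_le 0 (by simpa using hR))

lemma differentiable_deriv {F : ℂ → ℂ} (hF : Differentiable ℂ F) : Differentiable ℂ (deriv F) :=
  (hF.contDiff (n := 2)).differentiable_deriv_two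

lemma exists_derivBounds {F : ℂ → ℂ} (hF : Differentiable ℂ F) (R : ℝ) :
    ∃ A, DerivBounds F R A := by
  have hF' := differentiable_deriv hF
  have hF'' := differentiable_deriv hF'
  obtain ⟨A₁, h₁⟩ := (isCompact_closedBall (0 : ℂ) R).exists_bound_of_continuousOn
    hF'.continuous.continuousOn
  obtain ⟨A₂, h₂⟩ := (isCompact_closedBall (0 : ℂ) R).exists_bound_of_continuousOn
    hF''.continuous.continuousOn
  refine ⟨max A₁ A₂, fun x hx => (h₁ x (by simpa using hx)).trans (le_max_left _ _),
    fun x hx => (h₂ x (by simpa using hx)).trans (le_max_right _ _), fun x hx => ?_⟩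
  have h0 : (0 : ℂ) ∈ Metric.closedBall (0 : ℂ) R := by
    simpa using (norm_nonneg x).trans hx
  have := (convex_closedBall (0 : ℂ) R).norm_image_sub_le_of_norm_deriv_le
    (f := deriv F) (C := max A₁ A₂) (fun y _ => hF' y)
    (fun y hy => (h₂ y hy).trans (le_max_right _ _)) h0 (y := x) (by simpa using hx)
  simpa using this

lemma derivBounds_id (R : ℝ) : DerivBounds (fun x : ℂ => x) R 1 := by
  have h : deriv (fun x : ℂ => x) = fun _ => 1 := by ext; simp
  refine ⟨fun x _ => by simp, fun x _ => by simp [h], fun x _ => by simp⟩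

section series
variable {F : ℂ → ℂ} {a μ τ R A K : ℝ} {z : ℂ}

lemma norm_flow_exp_le (ha : 0 < a) (ha1 : a ≤ 1) (hμ : 0 < μ) (hz : 0 ≤ z.re) (hzR : ‖z‖ ≤ R)
    {t : ℝ} (ht : 0 ≤ t) : ‖flow a (Real.exp (μ * t)) z‖ ≤ R + 1 :=
  (norm_flow_le ha (one_le_exp_mul hμ ht) hz).trans (by linarith)

lemma norm_imageTerm_le (hB : DerivBounds F (R + 1) A) (ha : 0 < a) (ha1 : a ≤ 1) (hμ : 0 < μ)
    (hz : 0 ≤ z.re) (hzR : ‖z‖ ≤ R) {t : ℝ} (ht : 0 ≤ t) : ‖imageTerm F a μ z t‖ ≤ A := by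
  have h1 := hB.deriv_le _ (norm_flow_exp_le ha ha1 hμ hz hzR ht)
  have h2 := norm_flowDeriv_le_one ha (one_le_exp_mul hμ ht) hz
  rw [imageTerm, norm_mul]
  calc _ ≤ A * 1 := mul_le_mul h1 h2 (norm_nonneg _) ((norm_nonneg _).trans h1)
    _ = A := mul_one A

lemma hasDerivAt_imageTerm (hF : Differentiable ℂ F) (ha : 0 < a) (hμ : 0 < μ) (hz : 0 ≤ z.re)
    {t : ℝ} (ht : 0 ≤ t) :
    HasDerivAt (imageTerm F a μ z)
      (deriv (deriv F) (flow a (Real.exp (μ * t)) z)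
          * (μ / (2 * a) * (a ^ 2 - flow a (Real.exp (μ * t)) z ^ 2))
          * flowDeriv a (Real.exp (μ * t)) z
        + deriv F (flow a (Real.exp (μ * t)) z)
          * (-(μ / a) * (flow a (Real.exp (μ * t)) z * flowDeriv a (Real.exp (μ * t)) z))) t := by
  have h1 := hasDerivAt_flow_time ha hμ hz ht
  have h2 := (differentiable_deriv hF (flow a (Real.exp (μ * t)) z)).hasDerivAt
  exact (h2.comp t h1).mul (hasDerivAt_flowDeriv_time ha hμ hz ht)

lemma norm_deriv_imageTerm_le (hB : DerivBounds F (R + 1) A) (ha : 0 < a) (ha1 : a ≤ 1)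
    (hμ : 0 < μ) (hμa : μ ≤ K * a) (hz : 0 ≤ z.re) (hzR : ‖z‖ ≤ R) {t : ℝ} (ht : 0 ≤ t) :
    ‖deriv (deriv F) (flow a (Real.exp (μ * t)) z)
          * (μ / (2 * a) * (a ^ 2 - flow a (Real.exp (μ * t)) z ^ 2))
          * flowDeriv a (Real.exp (μ * t)) z
        + deriv F (flow a (Real.exp (μ * t)) z)
          * (-(μ / a) * (flow a (Real.exp (μ * t)) z * flowDeriv a (Real.exp (μ * t)) z))‖
      ≤ A * K * (98 + 32 * R) * flowMajorant a μ ‖z‖ t := by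
  have hb := norm_flow_exp_le ha ha1 hμ hz hzR ht
  have h1 := hB.deriv_le _ hb
  have h2 := hB.deriv2_le _ hb
  have h3 := norm_flow_mul_norm_flowDeriv_le ha hμ hz ht
  have h4 := mul_norm_flowDeriv_le ha hμ hz ht
  have hm := flowMajorant_nonneg ha hμ (norm_nonneg z) ht
  have hA : 0 ≤ A := (norm_nonneg _).trans h1
  have hK : μ / a ≤ K := (div_le_iff₀ ha).2 hμa
  have hK0 : 0 ≤ K := (by positivity : 0 ≤ μ / a).trans hK
  set f := flow a (Real.exp (μ * t)) z
  set d := flowDeriv a (Real.exp (μ * t)) z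
  set m := flowMajorant a μ ‖z‖ t
  have hR : 0 ≤ R := (norm_nonneg _).trans hzR
  have e1 : ‖(a : ℂ) ^ 2 - f ^ 2‖ ≤ a ^ 2 + ‖f‖ ^ 2 := by
    refine (norm_sub_le _ _).trans (le_of_eq ?_)
    simp
  have e2 : (a ^ 2 + ‖f‖ ^ 2) * ‖d‖ ≤ (4 + 64 * (R + 1)) * m := by
    have i1 : a * (a * ‖d‖) ≤ 1 * (4 * m) := by gcongr
    have i2 : ‖f‖ * (‖f‖ * ‖d‖) ≤ (R + 1) * (64 * m) := by gcongr
    nlinarith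
  have e3 : ‖((μ : ℂ) / (2 * a))‖ = μ / a / 2 := by
    simp [abs_of_pos ha, abs_of_pos hμ]; field_simp
  have e4 : ‖-((μ : ℂ) / a)‖ = μ / a := by
    simp [abs_of_pos ha, abs_of_pos hμ]
  refine (norm_add_le _ _).trans ?_
  rw [norm_mul, norm_mul, norm_mul, norm_mul, norm_mul, norm_mul, e3, e4]
  have t1 : ‖deriv (deriv F) f‖ * (μ / a / 2 * ‖(a : ℂ) ^ 2 - f ^ 2‖) * ‖d‖
      ≤ A * (K / 2 * ((4 + 64 * (R + 1)) * m)) := by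
    calc _ ≤ ‖deriv (deriv F) f‖ * (μ / a / 2 * (a ^ 2 + ‖f‖ ^ 2)) * ‖d‖ := by gcongr
      _ = ‖deriv (deriv F) f‖ * (μ / a / 2 * ((a ^ 2 + ‖f‖ ^ 2) * ‖d‖)) := by ring
      _ ≤ _ := by gcongr
  have t2 : ‖deriv F f‖ * (μ / a * (‖f‖ * ‖d‖)) ≤ A * (K * (64 * m)) := by gcongr
  -- The constant is `(4 + 64 (R + 1)) / 2 + 64 = 98 + 32 R`.
  refine (add_le_add t1 t2).trans (le_of_eq ?_)
  ring

lemma norm_imageTerm_sub_le (hF : Differentiable ℂ F) (hB : DerivBounds F (R + 1) A) (ha : 0 < a)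
    (ha1 : a ≤ 1) (hμ : 0 < μ) (hμa : μ ≤ K * a) (hz : 0 ≤ z.re) (hzR : ‖z‖ ≤ R) {t t' : ℝ}
    (ht : 0 ≤ t) (htt : t ≤ t') (ht' : t' ≤ t + 1) :
    ‖imageTerm F a μ z t' - imageTerm F a μ z t‖
      ≤ A * K * (98 + 32 * R) * flowMajorant a μ ‖z‖ t := by
  have hR : 0 ≤ R := (norm_nonneg _).trans hzR
  have hA := hB.nonneg (by linarith)
  have hK0 : 0 ≤ K := (by positivity : 0 ≤ μ / a).trans ((div_le_iff₀ ha).2 hμa)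
  have hm := flowMajorant_nonneg ha hμ (norm_nonneg z) ht
  have := (convex_Icc t (t + 1)).norm_image_sub_le_of_norm_hasDerivWithin_le
    (C := A * K * (98 + 32 * R) * flowMajorant a μ ‖z‖ t)
    (fun x hx => (hasDerivAt_imageTerm hF ha hμ hz (ht.trans hx.1)).hasDerivWithinAt)
    (fun x hx => (norm_deriv_imageTerm_le hB ha ha1 hμ hμa hz hzR (ht.trans hx.1)).trans
      (mul_le_mul_of_nonneg_left (flowMajorant_antitone ha hμ (norm_nonneg z) ht
        (ht.trans hx.1) hx.1) (by positivity)))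
    (x := t) (y := t') ⟨le_rfl, by linarith⟩ ⟨htt, ht'⟩
  refine this.trans ?_
  rw [Real.norm_of_nonneg (by linarith)]
  have h0 : 0 ≤ A * K * (98 + 32 * R) * flowMajorant a μ ‖z‖ t := by positivity
  nlinarith

lemma sum_flowMajorant_le' (ha : 0 < a) (ha1 : a ≤ 1) (hμ : 0 < μ) (haμ : a ≤ K * μ)
    (hzR : ‖z‖ ≤ R) (N : ℕ) :
    ∑ n ∈ Finset.range N, flowMajorant a μ ‖z‖ n ≤ 1 + R + 2 * K := by
  have := sum_flowMajorant_le ha hμ (norm_nonneg z) N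
  have h : a / μ ≤ K := (div_le_iff₀ hμ).2 haμ
  linarith

lemma sum_mul_flowMajorant_le {c : ℝ} (hc : 0 ≤ c) (ha : 0 < a) (ha1 : a ≤ 1) (hμ : 0 < μ)
    (haμ : a ≤ K * μ) (hzR : ‖z‖ ≤ R) (N : ℕ) :
    ∑ n ∈ Finset.range N, c * flowMajorant a μ ‖z‖ n ≤ c * (1 + R + 2 * K) := by
  rw [← Finset.mul_sum]
  exact mul_le_mul_of_nonneg_left (sum_flowMajorant_le' ha ha1 hμ haμ hzR N) hc

lemma hasDerivAt_imageSum (hF : Differentiable ℂ F) (ha : 0 < a) (ha1 : a ≤ 1) (hμ : 0 < μ)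
    (hτ : |τ| < 1) (hz : 0 < z.re) :
    HasDerivAt (imageSum F a μ τ) (imageSumDeriv F a μ τ z) z := by
  set R := ‖z‖ + 1
  obtain ⟨A, hB⟩ := exists_derivBounds hF (R + 1)
  obtain ⟨A₀, h₀⟩ := (isCompact_closedBall (0 : ℂ) (R + 1)).exists_bound_of_continuousOn
    hF.continuous.continuousOn
  have hopen : IsOpen ({y : ℂ | 0 < y.re} ∩ Metric.ball 0 R) :=
    (isOpen_lt continuous_const Complex.continuous_re).inter Metric.isOpen_ball
  have hconv : Convex ℝ ({y : ℂ | 0 < y.re} ∩ Metric.ball 0 R) :=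
    (convex_halfSpace_re_gt 0).inter (convex_ball 0 R)
  have hzmem : z ∈ {y : ℂ | 0 < y.re} ∩ Metric.ball 0 R := ⟨hz, by simp [R]⟩
  refine hasDerivAt_tsum_of_isPreconnected
    (u := fun n => |τ| ^ n * A) (g := fun (n : ℕ) y => (τ : ℂ) ^ n * F (flow a (Real.exp (μ * n)) y))
    (g' := fun (n : ℕ) y => (τ : ℂ) ^ n * imageTerm F a μ y n)
    ((summable_geometric_of_abs_lt_one (by rwa [abs_abs])).mul_right A) hopen
    hconv.isPreconnected ?_ ?_ hzmem ?_ hzmem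
  · intro n y hy
    have hs := one_le_exp_mul hμ (Nat.cast_nonneg (α := ℝ) n)
    exact (((hF _).hasDerivAt.comp y (hasDerivAt_flow ha hs hy.1))).const_mul _
  · intro n y hy
    rw [norm_mul, norm_pow, Complex.norm_real, Real.norm_eq_abs]
    have hyR : ‖y‖ ≤ R := by simpa using (Metric.mem_ball.1 hy.2).le
    gcongr
    exact norm_imageTerm_le hB ha ha1 hμ (le_of_lt hy.1) hyR (Nat.cast_nonneg n)
  · refine summable_pow_mul hτ (A := A₀) fun n => h₀ _ ?_
    simpa using norm_flow_exp_le ha ha1 hμ hz.le (R := R) (by simp [R]) (Nat.cast_nonneg n)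

/-- Splitting off the term `n = 0` leaves the series started one step later. This functional
equation carries the algebra of the transmission problem. -/
lemma imageSum_eq (hF : Differentiable ℂ F) (ha : 0 < a) (ha1 : a ≤ 1) (hμ : 0 < μ)
    (hτ : |τ| < 1) (hz : 0 < z.re) :
    imageSum F a μ τ z = F z + τ * imageSum F a μ τ (flow a (Real.exp μ) z) := by
  obtain ⟨A₀, h₀⟩ := (isCompact_closedBall (0 : ℂ) (‖z‖ + 1)).exists_bound_of_continuousOn
    hF.continuous.continuousOn
  have hs : Summable fun n : ℕ => (τ : ℂ) ^ n * F (flow a (Real.exp (μ * n)) z) :=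
    summable_pow_mul hτ (A := A₀) fun n => h₀ _ (by
      simpa using norm_flow_exp_le ha ha1 hμ hz.le le_rfl (Nat.cast_nonneg n))
  rw [imageSum, hs.tsum_eq_zero_add, imageSum, ← tsum_mul_left]
  congr 1
  · simp [flow_one ha]
  · refine tsum_congr fun n => ?_
    rw [flow_flow ha (one_le_exp_mul hμ (Nat.cast_nonneg n))
      (Real.one_le_exp hμ.le) hz, ← Real.exp_add]
    push_cast
    rw [mul_add, mul_one]
    ring

lemma norm_imageSumDeriv_le (hB : DerivBounds F (R + 1) A) (ha : 0 < a) (ha1 : a ≤ 1)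
    (hμ : 0 < μ) (hτ : |τ| < 1) (hz : 0 ≤ z.re) (hzR : ‖z‖ ≤ R) :
    ‖imageSumDeriv F a μ τ z‖ ≤ A / (1 - |τ|) :=
  norm_tsum_pow_mul_le hτ fun n => norm_imageTerm_le hB ha ha1 hμ hz hzR (Nat.cast_nonneg n)

lemma norm_imageSumDeriv_le_of_nonpos (hF : Differentiable ℂ F) (hB : DerivBounds F (R + 1) A)
    (ha : 0 < a) (ha1 : a ≤ 1) (hμ : 0 < μ) (hμa : μ ≤ K * a) (haμ : a ≤ K * μ) (hτ : -1 < τ)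
    (hτ0 : τ ≤ 0) (hz : 0 ≤ z.re) (hzR : ‖z‖ ≤ R) :
    ‖imageSumDeriv F a μ τ z‖ ≤ A + A * K * (98 + 32 * R) * (1 + R + 2 * K) := by
  have hR : 0 ≤ R := (norm_nonneg _).trans hzR
  have hA := hB.nonneg (by linarith)
  have hK0 : 0 ≤ K := (by positivity : 0 ≤ μ / a).trans ((div_le_iff₀ ha).2 hμa)
  refine norm_tsum_pow_mul_le_of_variation hτ hτ0
    (fun n => norm_imageTerm_le hB ha ha1 hμ hz hzR (Nat.cast_nonneg n)) (fun n => ?_)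
    (sum_mul_flowMajorant_le (by positivity) ha ha1 hμ haμ hzR)
  push_cast
  exact norm_imageTerm_sub_le hF hB ha ha1 hμ hμa hz hzR (Nat.cast_nonneg n) (by linarith) le_rfl

lemma norm_tsum_weight_le {f : ℕ → ℂ} {d : ℕ → ℝ} {V : ℝ} (hτ : |τ| < 1)
    (hf : ∀ n, ‖f n‖ ≤ d n) (hV : ∀ N, ∑ n ∈ Finset.range N, d n ≤ V) :
    ‖∑' n, (τ : ℂ) ^ n * f n‖ ≤ V := by
  have hd0 : ∀ n, 0 ≤ d n := fun n => (norm_nonneg _).trans (hf n)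
  have hdsum : Summable d := summable_of_sum_range_le hd0 hV
  refine (tsum_of_norm_bounded hdsum.hasSum fun n => ?_).trans (hdsum.tsum_le_of_sum_range_le hV)
  rw [norm_mul, norm_pow, Complex.norm_real, Real.norm_eq_abs]
  calc |τ| ^ n * ‖f n‖ ≤ 1 * d n := by
        gcongr
        · exact pow_le_one₀ (abs_nonneg _) hτ.le
        · exact hf n
    _ = d n := one_mul _

/-- Linearization of the incident field at the origin. -/
lemma norm_imageSumDeriv_sub_linear_le (hB : DerivBounds F (R + 1) A) (ha : 0 < a) (ha1 : a ≤ 1)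
    (hμ : 0 < μ) (haμ : a ≤ K * μ) (hτ : |τ| < 1) (hz : 0 ≤ z.re) (hzR : ‖z‖ ≤ R) :
    ‖imageSumDeriv F a μ τ z - deriv F 0 * imageSumDeriv (fun x => x) a μ τ z‖
      ≤ A * 64 * (1 + R + 2 * K) := by
  have hR : 0 ≤ R := (norm_nonneg _).trans hzR
  have hA := hB.nonneg (by linarith)
  have hs := summable_pow_mul hτ (g := fun n : ℕ => imageTerm F a μ z n)
    fun n => norm_imageTerm_le hB ha ha1 hμ hz hzR (Nat.cast_nonneg n)
  have hs' := summable_pow_mul hτ (g := fun n : ℕ => imageTerm (fun x => x) a μ z n)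
    fun n => norm_imageTerm_le (derivBounds_id _) ha ha1 hμ hz hzR (Nat.cast_nonneg n)
  rw [imageSumDeriv, imageSumDeriv, ← tsum_mul_left, ← hs.tsum_sub (hs'.mul_left _)]
  have : ∀ n : ℕ, (τ : ℂ) ^ n * imageTerm F a μ z n
      - deriv F 0 * ((τ : ℂ) ^ n * imageTerm (fun x => x) a μ z n)
      = (τ : ℂ) ^ n * ((deriv F (flow a (Real.exp (μ * n)) z) - deriv F 0)
        * flowDeriv a (Real.exp (μ * n)) z) := by
    intro n; simp [imageTerm]; ring
  rw [tsum_congr this]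
  refine norm_tsum_weight_le hτ (fun n => ?_)
    (sum_mul_flowMajorant_le (c := A * 64) (by positivity) ha ha1 hμ haμ hzR)
  have hn : (0 : ℝ) ≤ n := Nat.cast_nonneg n
  rw [norm_mul]
  calc _ ≤ A * ‖flow a (Real.exp (μ * n)) z‖ * ‖flowDeriv a (Real.exp (μ * n)) z‖ := by
        gcongr
        exact hB.deriv_sub_le _ (norm_flow_exp_le ha ha1 hμ hz hzR hn)
    _ = A * (‖flow a (Real.exp (μ * n)) z‖ * ‖flowDeriv a (Real.exp (μ * n)) z‖) := by ring
    _ ≤ A * (64 * flowMajorant a μ ‖z‖ n) := by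
        exact mul_le_mul_of_nonneg_left (norm_flow_mul_norm_flowDeriv_le ha hμ hz hn) hA
    _ = _ := by ring

/-- Comparison of the image series with an integral. -/
lemma norm_imageSumDeriv_sub_integral_le (ha : 0 < a) (ha1 : a ≤ 1) (hμ : 0 < μ)
    (hμa : μ ≤ K * a) (haμ : a ≤ K * μ) (hτ : 0 < τ) (hτ1 : τ < 1) (hz : 0 ≤ z.re)
    (hzR : ‖z‖ ≤ R) :
    ‖imageSumDeriv (fun x => x) a μ τ z - ∫ t in Set.Ioi (0 : ℝ),
        (Real.exp (Real.log τ * t) : ℂ) * flowDeriv a (Real.exp (μ * t)) z‖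
      ≤ 1 + 1 * K * (98 + 32 * R) * (1 + R + 2 * K) := by
  have hR : 0 ≤ R := (norm_nonneg _).trans hzR
  have hK0 : 0 ≤ K := (by positivity : 0 ≤ μ / a).trans ((div_le_iff₀ ha).2 hμa)
  have heq : ∀ t, imageTerm (fun x => x) a μ z t = flowDeriv a (Real.exp (μ * t)) z := by
    intro t; simp [imageTerm]
  have := norm_tsum_sub_integral_le (g := imageTerm (fun x => x) a μ z) hτ hτ1
    (fun t ht => (hasDerivAt_imageTerm differentiable_id ha hμ hz
      ht).continuousAt.continuousWithinAt)
    (fun t ht => norm_imageTerm_le (derivBounds_id _) ha ha1 hμ hz hzR ht)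
    (fun n t h1 h2 => by
      rw [norm_sub_rev]
      exact norm_imageTerm_sub_le differentiable_id (derivBounds_id _) ha ha1 hμ hμa hz hzR
        (Nat.cast_nonneg n) h1 h2)
    (sum_mul_flowMajorant_le (by positivity) ha ha1 hμ haμ hzR)
  simpa only [heq, imageSumDeriv] using this

lemma flowDeriv_mul_flowDeriv {s s' : ℝ} (ha : 0 < a) (hs : 1 ≤ s) (hs' : 1 ≤ s')
    (hz : 0 < z.re) :
    flowDeriv a s (flow a s' z) * flowDeriv a s' z = flowDeriv a (s * s') z := by
  have h1 := (hasDerivAt_flow ha hs (flow_re_pos ha hs' hz)).comp z (hasDerivAt_flow ha hs' hz)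
  have h2 := hasDerivAt_flow ha (one_le_mul_of_one_le_of_one_le hs hs') hz
  refine h1.unique (h2.congr_of_eventuallyEq ?_)
  filter_upwards [(isOpen_lt continuous_const Complex.continuous_re).mem_nhds hz] with y hy
  exact flow_flow ha hs hs' hy

/-- The image series changes by a bounded amount along the flow during a unit of time. -/
lemma norm_imageSumDeriv_sub_shift_le (ha : 0 < a) (ha1 : a ≤ 1) (hμ : 0 < μ)
    (hμa : μ ≤ K * a) (haμ : a ≤ K * μ) (hτ : |τ| < 1) (hz : 0 < z.re) (hzR : ‖z‖ ≤ R)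
    {t : ℝ} (ht : 0 ≤ t) (ht1 : t ≤ 1) :
    ‖imageSumDeriv (fun x => x) a μ τ (flow a (Real.exp (μ * t)) z)
          * flowDeriv a (Real.exp (μ * t)) z - imageSumDeriv (fun x => x) a μ τ z‖
      ≤ 1 * K * (98 + 32 * R) * (1 + R + 2 * K) := by
  have hR : 0 ≤ R := (norm_nonneg _).trans hzR
  have hK0 : 0 ≤ K := (by positivity : 0 ≤ μ / a).trans ((div_le_iff₀ ha).2 hμa)
  have hs := summable_pow_mul hτ (g := fun n : ℕ => imageTerm (fun x => x) a μ z n)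
    fun n => norm_imageTerm_le (derivBounds_id _) ha ha1 hμ hz.le hzR (Nat.cast_nonneg n)
  have hs' := summable_pow_mul hτ (g := fun n : ℕ => imageTerm (fun x => x) a μ z (n + t))
    fun n => norm_imageTerm_le (derivBounds_id _) ha ha1 hμ hz.le hzR (by positivity)
  -- By the semigroup law and the chain rule the shifted series has its terms at times `n + t`, so
  -- the two series can be compared term by term.
  have hshift : imageSumDeriv (fun x => x) a μ τ (flow a (Real.exp (μ * t)) z)
      * flowDeriv a (Real.exp (μ * t)) z
      = ∑' n : ℕ, (τ : ℂ) ^ n * imageTerm (fun x => x) a μ z (n + t) := by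
    rw [imageSumDeriv, ← tsum_mul_right]
    refine tsum_congr fun n => ?_
    have := flowDeriv_mul_flowDeriv ha (one_le_exp_mul hμ (Nat.cast_nonneg (α := ℝ) n))
      (one_le_exp_mul hμ ht) hz
    simp only [imageTerm, deriv_id'', one_mul]
    rw [mul_assoc, this, ← Real.exp_add, mul_add]
  rw [hshift, imageSumDeriv, ← hs'.tsum_sub hs]
  simp only [← mul_sub]
  refine norm_tsum_weight_le hτ (fun n => ?_)
    (sum_mul_flowMajorant_le (by positivity) ha ha1 hμ haμ hzR)
  exact norm_imageTerm_sub_le differentiable_id (derivBounds_id _) ha ha1 hμ hμa hz.le hzR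
    (Nat.cast_nonneg n) (by linarith) (by linarith)

end series

/-! ## The Lerch function along the flow -/

/-- `L(w⁻¹; b)` as a function of the point `z`, where `w = (a + z) / (a - z)`. -/
def lerchMap (a b : ℝ) (z : ℂ) : ℂ := lerchL ((a - z) / (a + z)) b

/-- The complex derivative of `lerchMap a b`. -/
def lerchMapDeriv (a b : ℝ) (z : ℂ) : ℂ :=
  ∫ t in Set.Ioi (0 : ℝ), (Real.exp (-b * t) : ℂ) * flowDeriv a (Real.exp t) z / (2 * a)

section lerch
variable {a b : ℝ} {z : ℂ}

lemma add_ne_zero_of_re (ha : 0 < a) (hz : 0 ≤ z.re) : (a : ℂ) + z ≠ 0 := by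
  intro h
  have := congrArg Complex.re h
  simp at this
  linarith

lemma flowDen_exp (t : ℝ) :
    flowDen a (Real.exp t) z
      = (Real.exp t : ℂ) * ((a + z) + (a - z) * (Real.exp (-t) : ℂ)) := by
  have : (Real.exp t : ℂ) * (Real.exp (-t) : ℂ) = 1 := by
    rw [← Complex.ofReal_mul, ← Real.exp_add]; simp
  rw [flowDen]
  linear_combination -(a - z) * this

/-- The substitution `s = e^t` identifies the Lerch integrand with the flow: `L(w⁻¹; b)` is a
continuous superposition of images of `z` with exponential weight, the analogue of the image series
for `F(x) = x`. -/
lemma lerchL_integrand (ha : 0 < a) (hz : 0 ≤ z.re) {t : ℝ} (ht : 0 ≤ t) :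
    -((a - z) / (a + z) * (Real.exp (-(b + 1) * t) : ℂ)
        / (1 + (a - z) / (a + z) * (Real.exp (-t) : ℂ)))
      = (Real.exp (-b * t) : ℂ) * (flow a (Real.exp t) z - a) / (2 * a) := by
  have h0 := add_ne_zero_of_re ha hz
  have ha' : (a : ℂ) ≠ 0 := by exact_mod_cast ha.ne'
  have hD := flowDen_ne_zero ha (Real.one_le_exp ht) hz
  have hs : (Real.exp t : ℂ) * (Real.exp (-t) : ℂ) = 1 := by
    rw [← Complex.ofReal_mul, ← Real.exp_add]; simp
  have he : (Real.exp (-(b + 1) * t) : ℂ) = (Real.exp (-b * t) : ℂ) * (Real.exp (-t) : ℂ) := by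
    rw [← Complex.ofReal_mul, ← Real.exp_add]; congr 2; ring
  have hflow : flow a (Real.exp t) z - a = -2 * a * (a - z) / flowDen a (Real.exp t) z := by
    rw [flow, eq_div_iff hD, sub_mul, div_mul_cancel₀ _ hD, flowDen]; ring
  rw [flowDen_exp] at hD
  have hE := right_ne_zero_of_mul hD
  have hs0 := left_ne_zero_of_mul hD
  rw [he, hflow, flowDen_exp]
  set s := ((Real.exp t : ℝ) : ℂ)
  set v := ((Real.exp (-t) : ℝ) : ℂ)
  have h1 : 1 + (a - z) / (a + z) * v = ((a + z) + (a - z) * v) / (a + z) := by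
    field_simp
  have hv : v = s⁻¹ := eq_inv_of_mul_eq_one_right hs
  rw [h1]
  have e1 : -2 * (a : ℂ) * (a - z) / (s * (a + z + (a - z) * v))
      = -2 * a * (a - z) * v / (a + z + (a - z) * v) := by
    rw [hv]; field_simp
  rw [e1]
  field_simp

lemma lerchP_integrand (ha : 0 < a) (hz : 0 ≤ z.re) {t : ℝ} (ht : 0 ≤ t) :
    (a - z) / (a + z) * (Real.exp (-(b + 1) * t) : ℂ)
        / (1 + (a - z) / (a + z) * (Real.exp (-t) : ℂ)) ^ 2
      = (a ^ 2 - z ^ 2) / (2 * a)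
        * ((Real.exp (-b * t) : ℂ) * flowDeriv a (Real.exp t) z / (2 * a)) := by
  have h0 := add_ne_zero_of_re ha hz
  have ha' : (a : ℂ) ≠ 0 := by exact_mod_cast ha.ne'
  have hD := flowDen_ne_zero ha (Real.one_le_exp ht) hz
  have hs : (Real.exp t : ℂ) * (Real.exp (-t) : ℂ) = 1 := by
    rw [← Complex.ofReal_mul, ← Real.exp_add]; simp
  have he : (Real.exp (-(b + 1) * t) : ℂ) = (Real.exp (-b * t) : ℂ) * (Real.exp (-t) : ℂ) := by
    rw [← Complex.ofReal_mul, ← Real.exp_add]; congr 2; ring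
  rw [flowDen_exp] at hD
  have hE := right_ne_zero_of_mul hD
  have hs0 := left_ne_zero_of_mul hD
  rw [he, flowDeriv, flowDen_exp]
  set s := ((Real.exp t : ℝ) : ℂ)
  set v := ((Real.exp (-t) : ℝ) : ℂ)
  have h1 : 1 + (a - z) / (a + z) * v = ((a + z) + (a - z) * v) / (a + z) := by
    field_simp
  have hv : v = s⁻¹ := eq_inv_of_mul_eq_one_right hs
  rw [h1]
  have e1 : 4 * s * (a : ℂ) ^ 2 / (s * (a + z + (a - z) * v)) ^ 2
      = 4 * v * a ^ 2 / (a + z + (a - z) * v) ^ 2 := by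
    rw [hv]; field_simp
  rw [e1]
  field_simp
  ring

lemma lerchMap_eq_integral (ha : 0 < a) (hz : 0 ≤ z.re) :
    lerchMap a b z = ∫ t in Set.Ioi (0 : ℝ),
      (Real.exp (-b * t) : ℂ) * (flow a (Real.exp t) z - a) / (2 * a) := by
  rw [lerchMap, lerchL, ← integral_neg]
  exact setIntegral_congr_fun measurableSet_Ioi fun t ht => lerchL_integrand ha hz (le_of_lt ht)

/-- With `ζ = w⁻¹ = e^{-ξ - iθ}` the operator `-ζ ∂/∂ζ` is `∂/∂ξ`, so `P` is the derivative of the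
Lerch function along the coordinate velocity. -/
lemma lerchP_eq (ha : 0 < a) (hz : 0 ≤ z.re) :
    lerchP ((a - z) / (a + z)) b = (a ^ 2 - z ^ 2) / (2 * a) * lerchMapDeriv a b z := by
  rw [lerchP, lerchMapDeriv, ← integral_const_mul]
  exact setIntegral_congr_fun measurableSet_Ioi fun t ht => lerchP_integrand ha hz (le_of_lt ht)

lemma continuousOn_flowDeriv_exp (ha : 0 < a) (hz : 0 ≤ z.re) :
    ContinuousOn (fun t => flowDeriv a (Real.exp t) z) (Set.Ici 0) := fun t ht => by
  have := hasDerivAt_flowDeriv_time (μ := 1) ha one_pos hz ht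
  simp only [one_mul] at this
  exact this.continuousAt.continuousWithinAt

lemma continuousOn_flow_exp (ha : 0 < a) (hz : 0 ≤ z.re) :
    ContinuousOn (fun t => flow a (Real.exp t) z) (Set.Ici 0) := fun t ht => by
  have := hasDerivAt_flow_time (μ := 1) ha one_pos hz ht
  simp only [one_mul] at this
  exact this.continuousAt.continuousWithinAt

lemma continuous_exp_weight (b : ℝ) : Continuous fun t : ℝ => ((Real.exp (-b * t) : ℝ) : ℂ) := by
  fun_prop

lemma norm_weight_flowDeriv_le (ha : 0 < a) (hb : 0 ≤ b) (hz : 0 ≤ z.re) {t : ℝ} (ht : 0 ≤ t) :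
    ‖(Real.exp (-b * t) : ℂ) * flowDeriv a (Real.exp t) z‖ ≤ 4 * Real.exp (-t) := by
  rw [norm_mul, Complex.norm_real, Real.norm_of_nonneg (Real.exp_pos _).le]
  have h1 : Real.exp (-b * t) ≤ 1 := Real.exp_le_one_iff.2 (by nlinarith)
  have h2 := norm_flowDeriv_le_inv ha (Real.one_le_exp ht) hz
  rw [← Real.exp_neg] at h2
  calc _ ≤ 1 * (4 * Real.exp (-t)) := by gcongr
    _ = _ := one_mul _

lemma integrableOn_const_mul_exp_neg (c : ℝ) :
    IntegrableOn (fun t => c * Real.exp (-t)) (Set.Ioi 0) := by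
  have := (integrableOn_exp_mul_Ioi (a := -1) (by norm_num) 0).const_mul c
  simpa [IntegrableOn] using this

lemma integrableOn_weight_flowDeriv (ha : 0 < a) (hb : 0 ≤ b) (hz : 0 ≤ z.re) :
    IntegrableOn (fun t => (Real.exp (-b * t) : ℂ) * flowDeriv a (Real.exp t) z) (Set.Ioi 0) := by
  refine (integrableOn_const_mul_exp_neg 4).mono'
    (((continuous_exp_weight b).continuousOn.mul ((continuousOn_flowDeriv_exp ha hz).mono
      Set.Ioi_subset_Ici_self)).aestronglyMeasurable measurableSet_Ioi) ?_
  filter_upwards [ae_restrict_mem measurableSet_Ioi] with t ht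
  exact norm_weight_flowDeriv_le ha hb hz (le_of_lt ht)

lemma norm_integral_weight_flowDeriv_le (ha : 0 < a) (hb : 0 ≤ b) (hz : 0 ≤ z.re) :
    ‖∫ t in Set.Ioi (0 : ℝ), (Real.exp (-b * t) : ℂ) * flowDeriv a (Real.exp t) z‖ ≤ 4 := by
  refine (norm_integral_le_of_norm_le (integrableOn_const_mul_exp_neg 4) ?_).trans ?_
  · filter_upwards [ae_restrict_mem measurableSet_Ioi] with t ht
    exact norm_weight_flowDeriv_le ha hb hz (le_of_lt ht)
  · rw [integral_const_mul, integral_exp_neg_Ioi]; simp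

/-- Differentiation under the integral; the bound `4 e^{-t}` on the derivative of the flow holds on
the whole half-plane and does not need `b > 0`. -/
lemma hasDerivAt_lerchMap (ha : 0 < a) (hb : 0 ≤ b) (hz : 0 < z.re) :
    HasDerivAt (lerchMap a b) (lerchMapDeriv a b z) z := by
  have hopen : IsOpen {y : ℂ | 0 < y.re} := isOpen_lt continuous_const Complex.continuous_re
  have hnhds := hopen.mem_nhds hz
  have ha2 : (2 * (a : ℂ)) ≠ 0 := mul_ne_zero two_ne_zero (by exact_mod_cast ha.ne')
  have hna : ‖(2 * (a : ℂ))‖ = 2 * a := by simp [abs_of_pos ha]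
  have hmeas : ∀ y : ℂ, 0 < y.re → AEStronglyMeasurable
      (fun t => (Real.exp (-b * t) : ℂ) * (flow a (Real.exp t) y - a) / (2 * a))
      (volume.restrict (Set.Ioi 0)) := fun y hy =>
    ((((continuous_exp_weight b).continuousOn.mul (((continuousOn_flow_exp ha hy.le).sub
      continuousOn_const))).div_const _).mono
        Set.Ioi_subset_Ici_self).aestronglyMeasurable measurableSet_Ioi
  have key := hasDerivAt_integral_of_dominated_loc_of_deriv_le
    (μ := volume.restrict (Set.Ioi (0 : ℝ)))
    (F := fun y t => (Real.exp (-b * t) : ℂ) * (flow a (Real.exp t) y - a) / (2 * a))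
    (F' := fun y t => (Real.exp (-b * t) : ℂ) * flowDeriv a (Real.exp t) y / (2 * a))
    (bound := fun t => 4 / (2 * a) * Real.exp (-t)) (x₀ := z) hnhds
    (by filter_upwards [hnhds] with y hy using hmeas y hy) ?_ ?_ ?_
    (integrableOn_const_mul_exp_neg _) ?_
  · refine key.2.congr_of_eventuallyEq ?_
    filter_upwards [hnhds] with y hy using lerchMap_eq_integral ha hy.le
  · refine (integrableOn_const_mul_exp_neg (‖(a : ℂ) - z‖ / a)).mono' (hmeas z hz) ?_
    filter_upwards [ae_restrict_mem measurableSet_Ioi] with t ht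
    have ht0 : 0 ≤ t := le_of_lt ht
    have hs := Real.one_le_exp ht0
    have hD := flowDen_ne_zero ha hs hz.le
    have hflow : flow a (Real.exp t) z - a = -2 * a * (a - z) / flowDen a (Real.exp t) z := by
      rw [flow, eq_div_iff hD, sub_mul, div_mul_cancel₀ _ hD, flowDen]; ring
    have h1 : Real.exp (-b * t) ≤ 1 := Real.exp_le_one_iff.2 (by nlinarith)
    have h2 := le_norm_flowDen (a := a) hs hz.le
    have h3 : Real.exp t * a ≤ ‖flowDen a (Real.exp t) z‖ := by nlinarith
    rw [hflow, norm_div, norm_mul, norm_div, hna, Complex.norm_real,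
      Real.norm_of_nonneg (Real.exp_pos _).le]
    have h4 : ‖-2 * (a : ℂ) * (a - z)‖ = 2 * a * ‖(a : ℂ) - z‖ := by simp [abs_of_pos ha]
    rw [h4]
    calc _ ≤ 1 * (2 * a * ‖(a : ℂ) - z‖ / (Real.exp t * a)) / (2 * a) := by gcongr
      _ = _ := by rw [Real.exp_neg]; field_simp
  · exact ((((continuous_exp_weight b).continuousOn.mul (continuousOn_flowDeriv_exp ha
      hz.le)).div_const _).mono Set.Ioi_subset_Ici_self).aestronglyMeasurable measurableSet_Ioi
  · filter_upwards [ae_restrict_mem measurableSet_Ioi] with t ht y hy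
    rw [norm_div, hna]
    calc _ ≤ 4 * Real.exp (-t) / (2 * a) := by
          gcongr
          exact norm_weight_flowDeriv_le ha hb (le_of_lt hy) (le_of_lt ht)
      _ = _ := by ring
  · filter_upwards [ae_restrict_mem measurableSet_Ioi] with t ht y hy
    exact (((hasDerivAt_flow ha (Real.one_le_exp (le_of_lt ht)) hy).sub_const _).const_mul
      _).div_const _

end lerch

/-! ### Comparison of the image series with the Lerch function -/

lemma abs_exp_neg_sub_exp_neg_le {x y δ : ℝ} (hy : 0 ≤ y) (hδ : δ ≤ 1 / 2)
    (hδ0 : 0 ≤ δ) (hxy : |x - y| ≤ δ * y) : |Real.exp (-x) - Real.exp (-y)| ≤ δ := by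
  obtain ⟨h1, h2⟩ := abs_le.1 hxy
  have key : ∀ p q : ℝ, p ≤ q → q - p ≤ δ * y → y / 2 ≤ p →
      |Real.exp (-p) - Real.exp (-q)| ≤ δ := by
    intro p q hpq hd hp
    have e1 : Real.exp (-q) = Real.exp (-p) * Real.exp (-(q - p)) := by
      rw [← Real.exp_add]; congr 1; ring
    have e2 : 1 - (q - p) ≤ Real.exp (-(q - p)) := by
      have := Real.add_one_le_exp (-(q - p)); linarith
    have e3 : Real.exp (-q) ≤ Real.exp (-p) := Real.exp_le_exp.2 (by linarith)
    -- The relative error `δ` of the exponent costs `δ y e^{-p}`, and `y e^{-p} ≤ 1` because `p ≥ y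
    -- / 2`. Thus the difference is at most `δ`, uniformly in `y`.
    have e4 : y ≤ Real.exp p := by
      have := Real.quadratic_le_exp_of_nonneg (x := y / 2) (by positivity)
      have := Real.exp_le_exp.2 hp
      nlinarith [sq_nonneg (y / 2 - 1)]
    have e5 : Real.exp (-p) * y ≤ 1 := by
      rw [Real.exp_neg, inv_mul_le_iff₀ (Real.exp_pos p)]; linarith
    rw [abs_of_nonneg (by linarith), e1]
    have hp0 := Real.exp_pos (-p)
    calc Real.exp (-p) - Real.exp (-p) * Real.exp (-(q - p))
        = Real.exp (-p) * (1 - Real.exp (-(q - p))) := by ring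
      _ ≤ Real.exp (-p) * (δ * y) := by gcongr; linarith
      _ = δ * (Real.exp (-p) * y) := by ring
      _ ≤ δ * 1 := by gcongr
      _ = δ := mul_one δ
  rcases le_total x y with h | h
  · exact key x y h (by linarith) (by nlinarith)
  · rw [abs_sub_comm]
    exact key y x h (by linarith) (by linarith)

/-- Relations between the half distance `a` of the poles, the flow time `μ` of the combined
reflection, and `ρ = r_*²`, when the two circles are close to each other. -/
structure NearlyTouching (K ρ a μ : ℝ) : Prop where
  a_pos : 0 < a
  a_le_one : a ≤ 1
  mul_a_le : K * a ≤ 1 / 2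
  μ_pos : 0 < μ
  μ_le : μ ≤ K * a
  a_le : a ≤ K * μ
  ratio : |μ * ρ / (4 * a) - 1| ≤ K * a

section compare
variable {F : ℂ → ℂ} {a b μ τ ρ R A K : ℝ} {z : ℂ}

lemma NearlyTouching.K_nonneg (h : NearlyTouching K ρ a μ) : 0 ≤ K := by
  have h1 := h.a_pos
  have h2 := h.μ_pos
  exact (by positivity : 0 ≤ μ / a).trans ((div_le_iff₀ h1).2 h.μ_le)

/-- The substitution `u = μ t` produces the factor `1 / μ` and the exponent `-log τ / μ`. The Lerch
side has the factor `ρ / (4a)` and the exponent `b`. Both pairs agree up to a relative error `K a`,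
and the resulting error `8 K a / μ` is bounded because `a ≤ K μ`. -/
lemma norm_integral_sub_lerchMapDeriv_le (h : NearlyTouching K ρ a μ) (hτ : 0 < τ) (hτ1 : τ < 1)
    (hb : 0 ≤ b) (hbτ : |b - -Real.log τ / μ| ≤ K * a * (-Real.log τ / μ)) (hz : 0 ≤ z.re) :
    ‖(∫ t in Set.Ioi (0 : ℝ), (Real.exp (Real.log τ * t) : ℂ) * flowDeriv a (Real.exp (μ * t)) z)
        - ρ / 2 * lerchMapDeriv a b z‖ ≤ 8 * K ^ 2 := by
  have ha := h.a_pos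
  have hμ := h.μ_pos
  have hK := h.K_nonneg
  have ha' : (a : ℂ) ≠ 0 := by exact_mod_cast ha.ne'
  have hμ' : (μ : ℂ) ≠ 0 := by exact_mod_cast hμ.ne'
  set b' := -Real.log τ / μ with hb'
  have hb'0 : 0 ≤ b' := div_nonneg (by linarith [Real.log_neg hτ hτ1]) hμ.le
  set X := ∫ t in Set.Ioi (0 : ℝ), (Real.exp (-b * t) : ℂ) * flowDeriv a (Real.exp t) z with hX
  set Y := ∫ t in Set.Ioi (0 : ℝ), (Real.exp (-b' * t) : ℂ) * flowDeriv a (Real.exp t) z with hY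
  have e1 : (∫ t in Set.Ioi (0 : ℝ),
      (Real.exp (Real.log τ * t) : ℂ) * flowDeriv a (Real.exp (μ * t)) z) = (μ : ℂ)⁻¹ * Y := by
    have := integral_comp_mul_left_Ioi
      (fun u => (Real.exp (-b' * u) : ℂ) * flowDeriv a (Real.exp u) z) 0 hμ
    rw [mul_zero] at this
    rw [hY, ← Complex.ofReal_inv, ← Complex.real_smul, ← this]
    refine setIntegral_congr_fun measurableSet_Ioi fun t _ => ?_
    have : Real.log τ * t = -b' * (μ * t) := by rw [hb']; field_simp
    simp only [this]
  have e2 : lerchMapDeriv a b z = X / (2 * a) := by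
    rw [lerchMapDeriv, integral_div]
  have e3 : ‖X‖ ≤ 4 := norm_integral_weight_flowDeriv_le ha hb hz
  have e4 : ‖X - Y‖ ≤ 4 * (K * a) := by
    rw [hX, hY, ← integral_sub (integrableOn_weight_flowDeriv ha hb hz)
      (integrableOn_weight_flowDeriv ha hb'0 hz)]
    refine (norm_integral_le_of_norm_le (integrableOn_const_mul_exp_neg (4 * (K * a))) ?_).trans ?_
    · filter_upwards [ae_restrict_mem measurableSet_Ioi] with t ht
      have ht0 : 0 ≤ t := le_of_lt ht
      have h2 := norm_flowDeriv_le_inv ha (Real.one_le_exp ht0) hz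
      rw [← Real.exp_neg] at h2
      rw [← sub_mul, ← Complex.ofReal_sub, norm_mul, Complex.norm_real, Real.norm_eq_abs]
      have h3 : |Real.exp (-b * t) - Real.exp (-b' * t)| ≤ K * a := by
        rw [neg_mul, neg_mul]
        refine abs_exp_neg_sub_exp_neg_le (by positivity) h.mul_a_le (by positivity) ?_
        rw [← sub_mul, abs_mul, abs_of_nonneg ht0, ← mul_assoc]
        gcongr
      calc _ ≤ K * a * (4 * Real.exp (-t)) := by gcongr
        _ = _ := by ring
    · rw [integral_const_mul, integral_exp_neg_Ioi]; simp
  have e5 : (μ : ℂ)⁻¹ * Y - ρ / 2 * (X / (2 * a))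
      = (μ : ℂ)⁻¹ * (-(X - Y) + ((1 - μ * ρ / (4 * a) : ℝ) : ℂ) * X) := by
    push_cast; field_simp; ring
  rw [e1, e2, e5, norm_mul, norm_inv, Complex.norm_real, Real.norm_of_nonneg hμ.le]
  have e6 : ‖-(X - Y) + ((1 - μ * ρ / (4 * a) : ℝ) : ℂ) * X‖ ≤ 8 * (K * a) := by
    refine (norm_add_le _ _).trans ?_
    rw [norm_neg, norm_mul, Complex.norm_real, Real.norm_eq_abs, abs_sub_comm]
    have : |μ * ρ / (4 * a) - 1| * ‖X‖ ≤ K * a * 4 := by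
      have := h.ratio
      gcongr
    linarith
  rw [inv_mul_le_iff₀ hμ]
  refine e6.trans ?_
  have := mul_le_mul_of_nonneg_left h.a_le hK
  nlinarith

lemma norm_id_imageSumDeriv_sub_lerchMapDeriv_le (h : NearlyTouching K ρ a μ) (hτ : 0 < τ)
    (hτ1 : τ < 1) (hb : 0 ≤ b) (hbτ : |b - -Real.log τ / μ| ≤ K * a * (-Real.log τ / μ))
    (hz : 0 ≤ z.re) (hzR : ‖z‖ ≤ R) :
    ‖imageSumDeriv (fun x => x) a μ τ z - ρ / 2 * lerchMapDeriv a b z‖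
      ≤ 1 + 1 * K * (98 + 32 * R) * (1 + R + 2 * K) + 8 * K ^ 2 := by
  refine (norm_sub_le_norm_sub_add_norm_sub _ _ _).trans (add_le_add
    (norm_imageSumDeriv_sub_integral_le h.a_pos h.a_le_one h.μ_pos h.μ_le h.a_le hτ hτ1 hz hzR)
    (norm_integral_sub_lerchMapDeriv_le h hτ hτ1 hb hbτ hz))

/-- The derivative of the image series is, up to a bounded error, a multiple of the derivative of
the Lerch function. -/
lemma norm_imageSumDeriv_sub_lerchMapDeriv_le (hB : DerivBounds F (R + 1) A)
    (h : NearlyTouching K ρ a μ) (hτ : 0 < τ) (hτ1 : τ < 1) (hb : 0 ≤ b)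
    (hbτ : |b - -Real.log τ / μ| ≤ K * a * (-Real.log τ / μ)) (hz : 0 ≤ z.re) (hzR : ‖z‖ ≤ R) :
    ‖imageSumDeriv F a μ τ z - deriv F 0 * (ρ / 2 * lerchMapDeriv a b z)‖
      ≤ A * 64 * (1 + R + 2 * K)
        + A * (1 + 1 * K * (98 + 32 * R) * (1 + R + 2 * K) + 8 * K ^ 2) := by
  have hR : 0 ≤ R := (norm_nonneg _).trans hzR
  have hA := hB.nonneg (by linarith)
  refine (norm_sub_le_norm_sub_add_norm_sub _ (deriv F 0 * imageSumDeriv (fun x => x) a μ τ z)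
    _).trans (add_le_add (norm_imageSumDeriv_sub_linear_le hB h.a_pos h.a_le_one h.μ_pos h.a_le
      (by rwa [abs_of_pos hτ]) hz hzR) ?_)
  rw [← mul_sub, norm_mul]
  exact mul_le_mul (hB.deriv_le 0 (by simp; linarith))
    (norm_id_imageSumDeriv_sub_lerchMapDeriv_le h hτ hτ1 hb hbτ hz hzR) (norm_nonneg _) hA

/-- Transfers the trivial bound on `(1 - τ) T'` from the image series to the Lerch function. It
absorbs the difference of the two contrasts in the shell. -/
lemma norm_one_sub_mul_lerchMapDeriv_le (h : NearlyTouching K ρ a μ) (hτ : 0 < τ)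
    (hτ1 : τ < 1) (hb : 0 ≤ b) (hbτ : |b - -Real.log τ / μ| ≤ K * a * (-Real.log τ / μ))
    (hz : 0 ≤ z.re) (hzR : ‖z‖ ≤ R) :
    (1 - τ) * ‖ρ / 2 * lerchMapDeriv a b z‖
      ≤ 2 + 1 * K * (98 + 32 * R) * (1 + R + 2 * K) + 8 * K ^ 2 := by
  have h1 := norm_id_imageSumDeriv_sub_lerchMapDeriv_le h hτ hτ1 hb hbτ hz hzR
  have h2 := norm_imageSumDeriv_le (derivBounds_id (R + 1)) h.a_pos h.a_le_one h.μ_pos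
    (by rwa [abs_of_pos hτ]) hz hzR
  rw [abs_of_pos hτ, le_div_iff₀ (by linarith)] at h2
  have h3 := norm_sub_norm_le (ρ / 2 * lerchMapDeriv a b z : ℂ)
    (imageSumDeriv (fun x => x) a μ τ z)
  rw [norm_sub_rev] at h3
  have h4 := norm_nonneg (imageSumDeriv (fun x => x) a μ τ z - ρ / 2 * lerchMapDeriv a b z)
  nlinarith

lemma norm_lerchMapDeriv_sub_shift_le (h : NearlyTouching K ρ a μ) (hτ : 0 < τ)
    (hτ1 : τ < 1) (hb : 0 ≤ b) (hbτ : |b - -Real.log τ / μ| ≤ K * a * (-Real.log τ / μ))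
    (hz : 0 < z.re) (hzR : ‖z‖ ≤ R) {t : ℝ} (ht : 0 ≤ t) (ht1 : t ≤ 1)
    (hzt : ‖flow a (Real.exp (μ * t)) z‖ ≤ R) :
    ‖ρ / 2 * lerchMapDeriv a b (flow a (Real.exp (μ * t)) z) * flowDeriv a (Real.exp (μ * t)) z
        - ρ / 2 * lerchMapDeriv a b z‖
      ≤ 3 * (1 + 1 * K * (98 + 32 * R) * (1 + R + 2 * K) + 8 * K ^ 2) := by
  have hs := one_le_exp_mul h.μ_pos ht
  have h1 := norm_id_imageSumDeriv_sub_lerchMapDeriv_le h hτ hτ1 hb hbτ hz.le hzR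
  have h2 := norm_id_imageSumDeriv_sub_lerchMapDeriv_le h hτ hτ1 hb hbτ
    (flow_re_pos h.a_pos hs hz).le hzt
  have h3 := norm_imageSumDeriv_sub_shift_le h.a_pos h.a_le_one h.μ_pos h.μ_le h.a_le
    (τ := τ) (by rwa [abs_of_pos hτ]) hz hzR ht ht1
  have h4 := norm_flowDeriv_le_one h.a_pos hs hz.le
  set T := imageSumDeriv (fun x => x) a μ τ z
  set T' := imageSumDeriv (fun x => x) a μ τ (flow a (Real.exp (μ * t)) z)
  set d := flowDeriv a (Real.exp (μ * t)) z
  set Λ := (ρ : ℂ) / 2 * lerchMapDeriv a b z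
  set Λ' := (ρ : ℂ) / 2 * lerchMapDeriv a b (flow a (Real.exp (μ * t)) z)
  -- The Lerch terms are compared through the image series, at both points and along the shift; each
  -- of the three errors is bounded.
  have e : Λ' * d - Λ = -((T' - Λ') * d) + (T' * d - T) + (T - Λ) := by ring
  rw [e]
  refine (norm_add_le _ _).trans ?_
  refine (add_le_add_left (norm_add_le _ _) _).trans ?_
  rw [norm_neg, norm_mul]
  have h5 : ‖T' - Λ'‖ * ‖d‖ ≤ ‖T' - Λ'‖ * 1 := by gcongr
  have h6 : 0 ≤ K ^ 2 := sq_nonneg K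
  linarith

end compare

/-! ## Uniqueness of the weak solution -/

section translation
variable {E : Type*} [NormedAddCommGroup E] [InnerProductSpace ℝ E]

/-- Translation acts continuously on `L²`. -/
lemma continuous_integral_inner_translate {f h : ℂ → E} (hf : MemLp f 2 volume)
    (hh : MemLp h 2 volume) : Continuous fun t : ℂ => ∫ x, inner ℝ (f x) (h (x - t)) := by
  have hfact : Fact ((2 : ENNReal) ≠ ⊤) := ⟨by simp⟩
  have h1 : Continuous fun t : ℂ => (DomAddAct.mk (-t) +ᵥ hh.toLp h : Lp E 2 (volume : Measure ℂ)) :=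
    Continuous.vadd (DomAddAct.continuous_mk.comp continuous_neg) continuous_const
  have h2 : Continuous fun t : ℂ => inner ℝ (hf.toLp f) (DomAddAct.mk (-t) +ᵥ hh.toLp h) :=
    continuous_const.inner h1
  refine h2.congr fun t => ?_
  rw [L2.inner_def]
  refine integral_congr_ae ?_
  rw [DomAddAct.mk_vadd_toLp]
  filter_upwards [hf.coeFn_toLp, MemLp.coeFn_toLp (hh.comp_measurePreserving
    (measurePreserving_vadd (-t) (volume : Measure ℂ)))] with x h3 h4
  rw [h3]
  refine congrArg _ (h4.trans ?_)
  simp [vadd_eq_add, sub_eq_neg_add]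

/-- Fubini; integrability on the product comes from bounding the product of norms by the sum of
their squares. -/
lemma integral_inner_integral_translate [CompleteSpace E] {f h : ℂ → E}
    (hf : MemLp f 2 volume)
    (hh : MemLp h 2 volume) (hh1 : Integrable h) {ψ : ℂ → ℝ} (hψ : Continuous ψ)
    (hψc : HasCompactSupport ψ) :
    ∫ x, inner ℝ (f x) (∫ t, ψ t • h (x - t)) = ∫ t, ψ t * ∫ x, inner ℝ (f x) (h (x - t)) := by
  have hψi : Integrable ψ := hψ.integrable_of_hasCompactSupport hψc
  have hf2 : Integrable fun x => ‖f x‖ ^ 2 := hf.integrable_norm_pow (by norm_num)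
  have hh2 : Integrable fun x => ‖h x‖ ^ 2 := hh.integrable_norm_pow (by norm_num)
  have hint : Integrable (fun p : ℂ × ℂ => ψ p.2 * inner ℝ (f p.1) (h (p.1 - p.2)))
      (volume.prod volume) := by
    have b1 : Integrable (fun p : ℂ × ℂ => ‖f p.1‖ ^ 2 * ‖ψ p.2‖) (volume.prod volume) :=
      hf2.mul_prod hψi.norm
    have b2 : Integrable (fun p : ℂ × ℂ => ‖ψ p.2‖ * ‖h (p.1 - p.2)‖ ^ 2)
        (volume.prod volume) :=
      hψi.norm.convolution_integrand (ContinuousLinearMap.mul ℝ ℝ) hh2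
    refine (b1.add b2).mono' ?_ (Filter.Eventually.of_forall fun p => ?_)
    · have m1 : AEStronglyMeasurable (fun p : ℂ × ℂ => ψ p.2 • h (p.1 - p.2))
          (volume.prod volume) :=
        hψi.aestronglyMeasurable.convolution_integrand (ContinuousLinearMap.lsmul ℝ ℝ)
          hh1.aestronglyMeasurable
      have m2 : AEStronglyMeasurable (fun p : ℂ × ℂ => f p.1) (volume.prod volume) :=
        hf.aestronglyMeasurable.comp_fst
      refine (m2.inner (𝕜 := ℝ) m1).congr (Filter.Eventually.of_forall fun p => ?_)
      simp [inner_smul_right]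
    · simp only [Pi.add_apply]
      rw [norm_mul]
      have := norm_inner_le_norm (𝕜 := ℝ) (f p.1) (h (p.1 - p.2))
      have h0 := norm_nonneg (ψ p.2)
      nlinarith [sq_nonneg (‖f p.1‖ - ‖h (p.1 - p.2)‖), norm_nonneg (f p.1),
        norm_nonneg (h (p.1 - p.2)), sq_nonneg (‖f p.1‖), sq_nonneg (‖h (p.1 - p.2)‖)]
  have hae : ∀ᵐ x : ℂ, Integrable fun t => ψ t • h (x - t) := by
    have := hψi.ae_convolution_exists (ContinuousLinearMap.lsmul ℝ ℝ) hh1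
    filter_upwards [this] with x hx using hx
  calc ∫ x, inner ℝ (f x) (∫ t, ψ t • h (x - t))
      = ∫ x, ∫ t, ψ t * inner ℝ (f x) (h (x - t)) := by
        refine integral_congr_ae ?_
        filter_upwards [hae] with x hx
        rw [← integral_inner hx]
        simp [inner_smul_right]
    _ = ∫ t, ∫ x, ψ t * inner ℝ (f x) (h (x - t)) := integral_integral_swap hint
    _ = _ := by simp_rw [integral_const_mul]

end translation

lemma inner_gradient_eq (φ : ℂ → ℝ) (x w : ℂ) : inner ℝ (gradient φ x) w = fderiv ℝ φ x w := by
  rw [gradient, InnerProductSpace.toDual_symm_apply]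

lemma continuous_gradient {φ : ℂ → ℝ} (hφ : ContDiff ℝ ∞ φ) : Continuous (gradient φ) :=
  (InnerProductSpace.toDual ℝ ℂ).symm.continuous.comp (hφ.continuous_fderiv (by simp))

lemma hasCompactSupport_gradient {φ : ℂ → ℝ} (hφ : HasCompactSupport φ) :
    HasCompactSupport (gradient φ) :=
  (hφ.fderiv (𝕜 := ℝ)).comp_left (g := (InnerProductSpace.toDual ℝ ℂ).symm) (map_zero _)

/-! ### Mollification -/

section mollify
variable {v : ℂ → ℝ} {g : ℂ → ℂ} {ψ : ℂ → ℝ}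

/-- The mollification of `v` by `ψ`. -/
def mollify (v ψ : ℂ → ℝ) (x : ℂ) : ℝ := ∫ t, v t * ψ (x - t)

lemma mollify_eq_convolution : mollify v ψ = convolution v ψ (ContinuousLinearMap.mul ℝ ℝ) volume :=
  rfl

lemma mollify_eq_swap (x : ℂ) : mollify v ψ x = ∫ t, ψ t * v (x - t) := by
  rw [mollify, ← integral_sub_left_eq_self _ volume x]
  simp [mul_comm]

lemma contDiff_mollify (hv : Continuous v) (hψ : ContDiff ℝ ∞ ψ) (hψc : HasCompactSupport ψ) :
    ContDiff ℝ ∞ (mollify v ψ) := by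
  rw [mollify_eq_convolution]
  exact hψc.contDiff_convolution_right _ hv.locallyIntegrable hψ

lemma gradient_comp_sub {x t : ℂ} (hψ : ContDiff ℝ ∞ ψ) :
    gradient (fun t => ψ (x - t)) t = -gradient ψ (x - t) := by
  have h1 : HasFDerivAt ψ (fderiv ℝ ψ (x - t)) (x - t) :=
    (hψ.differentiable (by simp) _).hasFDerivAt
  have h2 : HasFDerivAt (fun t => x - t) (-ContinuousLinearMap.id ℝ ℂ) t :=
    (hasFDerivAt_id t).const_sub x
  have h3 := (h1.comp t h2).fderiv
  rw [gradient, gradient, ← map_neg]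
  congr 1
  refine h3.trans ?_
  ext w
  simp

/-- The derivative falls on the kernel, and `t ↦ ψ (x - t)` is an admissible test function in the
definition of the weak gradient. -/
lemma gradient_mollify (hv : Continuous v) (hg : HasWeakGradient v g) (hψ : ContDiff ℝ ∞ ψ)
    (hψc : HasCompactSupport ψ) (x : ℂ) :
    gradient (mollify v ψ) x = ∫ t, ψ (x - t) • g t := by
  have hφ : ContDiff ℝ ∞ fun t => ψ (x - t) := hψ.comp (contDiff_const.sub contDiff_id)
  have hφc : HasCompactSupport fun t => ψ (x - t) :=
    hψc.comp_homeomorph (Homeomorph.subLeft x)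
  have h1 := hg _ hφ hφc
  have h2 := hψc.hasFDerivAt_convolution_right (ContinuousLinearMap.mul ℝ ℝ)
    (hv.locallyIntegrable (μ := volume)) (hψ.of_le (by simp)) x
  have hi : Integrable fun t => v t • gradient (fun t => ψ (x - t)) t :=
    (hv.smul (continuous_gradient hφ)).integrable_of_hasCompactSupport
      ((hasCompactSupport_gradient hφc).smul_left)
  refine ext_inner_right ℝ fun w => ?_
  rw [inner_gradient_eq, mollify_eq_convolution, h2.fderiv,
    convolution_precompR_apply _ (hv.locallyIntegrable) (hψc.fderiv (𝕜 := ℝ))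
      (hψ.continuous_fderiv (by simp)), ← neg_eq_iff_eq_neg.2 h1, inner_neg_left,
    real_inner_comm, ← integral_inner hi, ← integral_neg]
  refine integral_congr_ae (Filter.Eventually.of_forall fun t => ?_)
  simp only [ContinuousLinearMap.mul_apply', inner_smul_right, gradient_comp_sub hψ,
    inner_neg_right]
  rw [real_inner_comm, inner_gradient_eq]
  ring

end mollify

/-! ### Energy estimates and vanishing of decaying solutions -/

section energy
variable {v : ℂ → ℝ} {g : ℂ → ℂ} {σ : ℂ → ℝ} {M : ℝ}

lemma gradient_sq_mul {χ m : ℂ → ℝ} (hχ : ContDiff ℝ ∞ χ) (hm : ContDiff ℝ ∞ m) (x : ℂ) :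
    gradient (fun x => χ x ^ 2 * m x) x
      = χ x ^ 2 • gradient m x + (2 * χ x * m x) • gradient χ x := by
  have h1 : HasFDerivAt χ (fderiv ℝ χ x) x := (hχ.differentiable (by simp) x).hasFDerivAt
  have h2 : HasFDerivAt m (fderiv ℝ m x) x := (hm.differentiable (by simp) x).hasFDerivAt
  refine ext_inner_right ℝ fun w => ?_
  have h3 : fderiv ℝ (fun x => χ x ^ 2 * m x) x = _ := ((h1.pow 2).mul h2).fderiv
  rw [inner_add_left, inner_smul_left, inner_smul_left, inner_gradient_eq, inner_gradient_eq,
    inner_gradient_eq, h3]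
  simp
  ring

lemma exists_radius {χ : ℂ → ℝ} (hχc : HasCompactSupport χ) :
    ∃ R : ℝ, 0 ≤ R ∧ ∀ x, R < ‖x‖ → χ x = 0 := by
  obtain ⟨R, hR⟩ := hχc.isCompact.isBounded.subset_closedBall (0 : ℂ)
  refine ⟨max R 0, le_max_right _ _, fun x hx => ?_⟩
  by_contra h
  have := hR (subset_tsupport _ (Function.mem_support.2 h))
  rw [mem_closedBall_zero_iff] at this
  exact absurd ((le_max_left R 0).trans_lt hx) (not_lt.2 this)

lemma memLp_of_norm_le {E E' : Type*} [NormedAddCommGroup E] [NormedAddCommGroup E'] {A : ℂ → E}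
    {G : ℂ → E'} {C : ℝ} (hG : MemLp G 2 volume)
    (hA : AEStronglyMeasurable A volume) (h : ∀ x, ‖A x‖ ≤ C * ‖G x‖) : MemLp A 2 volume :=
  hG.of_le_mul hA (Filter.Eventually.of_forall h)

/-- Testing the equation with `χ² v` is admissible. -/
lemma energy_identity (hσ : AEStronglyMeasurable σ volume) (hσM : ∀ x, |σ x| ≤ M)
    (hv : Continuous v) (hgL : ∀ K : Set ℂ, IsCompact K → MemLp g 2 (volume.restrict K))
    (hg : HasWeakGradient v g)
    (heq : ∀ φ : ℂ → ℝ, ContDiff ℝ ∞ φ → HasCompactSupport φ →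
      ∫ z, σ z * inner ℝ (g z) (gradient φ z) = 0)
    {χ : ℂ → ℝ} (hχ : ContDiff ℝ ∞ χ) (hχc : HasCompactSupport χ) :
    (∫ x, σ x * (χ x ^ 2 * ‖g x‖ ^ 2)) + ∫ x, 2 * σ x * χ x * v x * inner ℝ (g x) (gradient χ x)
      = 0 := by
  obtain ⟨R, hR0, hR⟩ := exists_radius hχc
  have hM : 0 ≤ M := (abs_nonneg _).trans (hσM 0)
  -- The radius is `R + 1` because mollifiers supported in the unit ball see values up to distance
  -- `1` from the support of `χ`. Truncating to `S` makes everything globally square integrable.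
  set S := Metric.closedBall (0 : ℂ) (R + 1) with hS
  have hSc : IsCompact S := isCompact_closedBall _ _
  have hSm : MeasurableSet S := hSc.isClosed.measurableSet
  set G : ℂ → ℂ := S.indicator g with hG
  set V : ℂ → ℝ := S.indicator v with hV
  have hGL : MemLp G 2 volume := (memLp_indicator_iff_restrict hSm).2 (hgL S hSc)
  have hfin : IsFiniteMeasure (volume.restrict S) := ⟨by
    rw [Measure.restrict_apply_univ]; exact hSc.measure_lt_top⟩
  have hVL : MemLp V 2 volume := by
    obtain ⟨C, hC⟩ := hSc.exists_bound_of_continuousOn hv.continuousOn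
    refine (memLp_indicator_iff_restrict hSm).2
      (MemLp.of_bound hv.aestronglyMeasurable.restrict C ?_)
    filter_upwards [ae_restrict_mem hSm] with x hx using hC x hx
  have hG1 : Integrable G := by
    rw [hG, integrable_indicator_iff hSm]
    exact (hgL S hSc).integrable (by norm_num)
  have hV1 : Integrable V := by
    rw [hV, integrable_indicator_iff hSm]
    exact hv.continuousOn.integrableOn_compact hSc
  have hmemS : ∀ x, χ x ≠ 0 → ‖x‖ ≤ R := fun x hx => not_lt.1 fun h => hx (hR x h)
  have hGg : ∀ x, χ x ≠ 0 → G x = g x := fun x hx =>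
    Set.indicator_of_mem (by rw [hS, mem_closedBall_zero_iff]; linarith [hmemS x hx]) g
  have hVv : ∀ x, χ x ≠ 0 → V x = v x := fun x hx =>
    Set.indicator_of_mem (by rw [hS, mem_closedBall_zero_iff]; linarith [hmemS x hx]) v
  obtain ⟨C₁, hC₁⟩ := hχc.exists_bound_of_continuous hχ.continuous
  obtain ⟨C₂, hC₂⟩ := (hasCompactSupport_gradient hχc).exists_bound_of_continuous
    (continuous_gradient hχ)
  have hC₁0 : 0 ≤ C₁ := (norm_nonneg _).trans (hC₁ 0)
  have hC₂0 : 0 ≤ C₂ := (norm_nonneg _).trans (hC₂ 0)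
  set A : ℂ → ℂ := fun x => (σ x * χ x ^ 2) • G x with hA
  set B : ℂ → ℝ := fun x => 2 * σ x * χ x * inner ℝ (G x) (gradient χ x) with hB
  have hχm := hχ.continuous.aestronglyMeasurable (μ := (volume : Measure ℂ))
  have hAm : AEStronglyMeasurable A volume := (hσ.mul (hχm.pow 2)).smul hGL.aestronglyMeasurable
  have hBm : AEStronglyMeasurable B volume :=
    (((aestronglyMeasurable_const (b := (2 : ℝ))).mul hσ).mul hχm).mul
      (hGL.aestronglyMeasurable.inner (continuous_gradient hχ).aestronglyMeasurable)
  have hAle : ∀ x, ‖A x‖ ≤ M * C₁ ^ 2 * ‖G x‖ := fun x => by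
    rw [hA, norm_smul, norm_mul, norm_pow]
    have h1 := hσM x
    have h2 := hC₁ x
    rw [Real.norm_eq_abs (σ x)]
    gcongr
  have hBle : ∀ x, ‖B x‖ ≤ 2 * M * C₁ * C₂ * ‖G x‖ := fun x => by
    rw [hB, norm_mul, norm_mul, norm_mul]
    have h1 := hσM x
    have h2 := hC₁ x
    have h3 := (norm_inner_le_norm (𝕜 := ℝ) (G x) (gradient χ x)).trans
      (mul_le_mul_of_nonneg_left (hC₂ x) (norm_nonneg _))
    rw [Real.norm_eq_abs (σ x), Real.norm_of_nonneg (by norm_num : (0 : ℝ) ≤ 2)]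
    calc _ ≤ 2 * M * C₁ * (‖G x‖ * C₂) := by gcongr
      _ = _ := by ring
  have hAL : MemLp A 2 volume := memLp_of_norm_le hGL hAm hAle
  have hBL : MemLp B 2 volume := memLp_of_norm_le hGL hBm hBle
  have hA1 : Integrable A := (hG1.norm.const_mul _).mono' hAm (Filter.Eventually.of_forall hAle)
  have hB1 : Integrable B := (hG1.norm.const_mul _).mono' hBm (Filter.Eventually.of_forall hBle)
  -- The function `k` is the energy expression with `g` and `v` translated by `t` in one slot, and
  -- the identity to be proved is `k 0 = 0`. Testing with `χ² (v ∗ ψ)` gives `∫ ψ k = 0`. As `k` is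
  -- continuous, it vanishes near `0`, and no convergence of mollifications is needed.
  set k : ℂ → ℝ := fun t => (∫ x, inner ℝ (A x) (G (x - t))) + ∫ x, inner ℝ (B x) (V (x - t))
    with hk
  have hkc : Continuous k := (continuous_integral_inner_translate hAL hGL).add
    (continuous_integral_inner_translate hBL hVL)
  have hk0 : ∀ ψ : ℂ → ℝ, ContDiff ℝ ∞ ψ → HasCompactSupport ψ → tsupport ψ ⊆ Metric.ball 0 1 →
      ∫ t, ψ t • k t = 0 := by
    intro ψ hψ hψc hψs
    have hψ1 : ∀ t, ψ t ≠ 0 → ‖t‖ < 1 := fun t ht => by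
      simpa using hψs (subset_tsupport _ (Function.mem_support.2 ht))
    have hm := contDiff_mollify hv hψ hψc
    have hgm : ∀ x, χ x ≠ 0 → gradient (mollify v ψ) x = ∫ t, ψ t • G (x - t) := by
      intro x hx
      rw [gradient_mollify hv hg hψ hψc, ← integral_sub_left_eq_self _ volume x]
      refine integral_congr_ae (Filter.Eventually.of_forall fun t => ?_)
      simp only [sub_sub_cancel]
      by_cases ht : ψ t = 0
      · simp [ht]
      · rw [hG, Set.indicator_of_mem]
        rw [hS, mem_closedBall_zero_iff]
        exact (norm_sub_le _ _).trans (add_le_add (hmemS x hx) (hψ1 t ht).le)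
    have hvm : ∀ x, χ x ≠ 0 → mollify v ψ x = ∫ t, ψ t • V (x - t) := by
      intro x hx
      rw [mollify_eq_swap]
      refine integral_congr_ae (Filter.Eventually.of_forall fun t => ?_)
      simp only [smul_eq_mul]
      by_cases ht : ψ t = 0
      · simp [ht]
      · rw [hV, Set.indicator_of_mem]
        rw [hS, mem_closedBall_zero_iff]
        exact (norm_sub_le _ _).trans (add_le_add (hmemS x hx) (hψ1 t ht).le)
    have htest := heq (fun x => χ x ^ 2 * mollify v ψ x) ((hχ.pow 2).mul hm) (by
      refine HasCompactSupport.mul_right ?_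
      exact hχc.comp_left (g := fun y : ℝ => y ^ 2) (by simp))
    have hsplit : ∀ x, σ x * inner ℝ (g x) (gradient (fun x => χ x ^ 2 * mollify v ψ x) x)
        = inner ℝ (A x) (∫ t, ψ t • G (x - t)) + inner ℝ (B x) (∫ t, ψ t • V (x - t)) := by
      intro x
      rw [gradient_sq_mul hχ hm]
      by_cases hx : χ x = 0
      · simp [hA, hB, hx]
      · rw [← hgm x hx, ← hvm x hx]
        simp only [hA, hB, hGg x hx, inner_add_right, inner_smul_right, inner_smul_left]
        simp
        ring
    have hint1 : Integrable fun x => inner ℝ (A x) (∫ t, ψ t • G (x - t)) := by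
      obtain ⟨C, hC⟩ := hSc.exists_bound_of_continuousOn (continuous_gradient hm).continuousOn
      have heq : (fun x => inner ℝ (A x) (∫ t, ψ t • G (x - t)))
          = fun x => inner ℝ (A x) (gradient (mollify v ψ) x) := by
        ext x
        by_cases hx : χ x = 0
        · simp [hA, hx]
        · rw [hgm x hx]
      rw [heq]
      refine (hA1.norm.mul_const C).mono'
        (hAm.inner (continuous_gradient hm).aestronglyMeasurable)
        (Filter.Eventually.of_forall fun x => ?_)
      by_cases hx : χ x = 0
      · simp [hA, hx]
      · refine (norm_inner_le_norm _ _).trans (mul_le_mul_of_nonneg_left (hC x ?_) (norm_nonneg _))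
        rw [hS, mem_closedBall_zero_iff]; linarith [hmemS x hx]
    have hint2 : Integrable fun x => inner ℝ (B x) (∫ t, ψ t • V (x - t)) := by
      obtain ⟨C, hC⟩ := hSc.exists_bound_of_continuousOn hm.continuous.continuousOn
      have heq : (fun x => inner ℝ (B x) (∫ t, ψ t • V (x - t)))
          = fun x => inner ℝ (B x) (mollify v ψ x) := by
        ext x
        by_cases hx : χ x = 0
        · simp [hB, hx]
        · rw [hvm x hx]
      rw [heq]
      refine (hB1.norm.mul_const C).mono'
        (hBm.inner hm.continuous.aestronglyMeasurable)
        (Filter.Eventually.of_forall fun x => ?_)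
      by_cases hx : χ x = 0
      · simp [hB, hx]
      · refine (norm_inner_le_norm _ _).trans (mul_le_mul_of_nonneg_left (hC x ?_) (norm_nonneg _))
        rw [hS, mem_closedBall_zero_iff]; linarith [hmemS x hx]
    simp_rw [hsplit] at htest
    rw [integral_add hint1 hint2,
      integral_inner_integral_translate hAL hGL hG1 hψ.continuous hψc,
      integral_inner_integral_translate hBL hVL hV1 hψ.continuous hψc] at htest
    simp only [hk, smul_eq_mul, mul_add]
    rw [integral_add, htest]
    · exact (hψ.continuous.mul
        (continuous_integral_inner_translate hAL hGL)).integrable_of_hasCompactSupport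
          hψc.mul_right
    · exact (hψ.continuous.mul
        (continuous_integral_inner_translate hBL hVL)).integrable_of_hasCompactSupport
          hψc.mul_right
  have hball : IsOpen (Metric.ball (0 : ℂ) 1) := Metric.isOpen_ball
  have hae := hball.ae_eq_zero_of_integral_contDiff_smul_eq_zero
    (μ := volume) (hkc.locallyIntegrable.locallyIntegrableOn _) hk0
  have hk00 : k 0 = 0 := by
    have := Measure.eqOn_open_of_ae_eq (μ := volume) (f := k) (g := fun _ => 0)
      ((ae_restrict_iff' hball.measurableSet).2 hae) hball hkc.continuousOn continuousOn_const
    exact this (Metric.mem_ball_self one_pos)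
  simp only [hk, sub_zero] at hk00
  rw [← hk00]
  congr 1
  · refine integral_congr_ae (Filter.Eventually.of_forall fun x => ?_)
    by_cases hx : χ x = 0
    · simp [hA, hx]
    · simp only [hA, hGg x hx, inner_smul_left]
      rw [real_inner_self_eq_norm_sq]
      simp
      ring
  · refine integral_congr_ae (Filter.Eventually.of_forall fun x => ?_)
    by_cases hx : χ x = 0
    · simp [hB, hx]
    · simp only [hB, hGg x hx, hVv x hx]
      simp
      ring

lemma integrable_mul_mul_norm_sq (hσ : AEStronglyMeasurable σ volume) (hσM : ∀ x, |σ x| ≤ M)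
    (hgL : ∀ K : Set ℂ, IsCompact K → MemLp g 2 (volume.restrict K))
    {χ : ℂ → ℝ} (hχ : Continuous χ) (hχc : HasCompactSupport χ) :
    Integrable fun x => σ x * (χ x ^ 2 * ‖g x‖ ^ 2) := by
  obtain ⟨C, hC⟩ := hχc.exists_bound_of_continuous hχ
  have hS := hχc.isCompact
  have hSm : MeasurableSet (tsupport χ) := (isClosed_tsupport _).measurableSet
  have h1 : IntegrableOn (fun x => ‖g x‖ ^ 2) (tsupport χ) :=
    (hgL _ hS).integrable_norm_pow (by norm_num)
  have h2 : IntegrableOn (fun x => σ x * (χ x ^ 2 * ‖g x‖ ^ 2)) (tsupport χ) := by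
    refine (h1.const_mul (M * C ^ 2)).mono' (hσ.restrict.mul
      ((hχ.pow 2).aestronglyMeasurable.mul h1.aestronglyMeasurable))
      (Filter.Eventually.of_forall fun x => ?_)
    have h3 := hσM x
    have h4 := hC x
    have hM : 0 ≤ M := (abs_nonneg _).trans h3
    rw [norm_mul, norm_mul, norm_pow, norm_pow, norm_norm, Real.norm_eq_abs (σ x), ← mul_assoc]
    gcongr
  rw [← integrableOn_iff_integrable_of_support_subset (s := tsupport χ)]
  · exact h2
  · intro x hx
    refine subset_tsupport _ (Function.mem_support.2 fun h => hx ?_)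
    simp [h]

/-- Caccioppoli's inequality. -/
lemma caccioppoli (hσ : AEStronglyMeasurable σ volume) (hσM : ∀ x, |σ x| ≤ M)
    (hσ0 : ∀ x, 0 ≤ σ x)
    (hv : Continuous v) (hgL : ∀ K : Set ℂ, IsCompact K → MemLp g 2 (volume.restrict K))
    (hg : HasWeakGradient v g)
    (heq : ∀ φ : ℂ → ℝ, ContDiff ℝ ∞ φ → HasCompactSupport φ →
      ∫ z, σ z * inner ℝ (g z) (gradient φ z) = 0)
    {χ : ℂ → ℝ} (hχ : ContDiff ℝ ∞ χ) (hχc : HasCompactSupport χ) :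
    ∫ x, σ x * (χ x ^ 2 * ‖g x‖ ^ 2) ≤ 4 * M * ∫ x, v x ^ 2 * ‖gradient χ x‖ ^ 2 := by
  have hM : 0 ≤ M := (abs_nonneg _).trans (hσM 0)
  have h1 := energy_identity hσ hσM hv hgL hg heq hχ hχc
  have i1 := integrable_mul_mul_norm_sq hσ hσM hgL hχ.continuous hχc
  have i2 : Integrable fun x => v x ^ 2 * ‖gradient χ x‖ ^ 2 := by
    have hs : HasCompactSupport fun x => ‖gradient χ x‖ ^ 2 :=
      (hasCompactSupport_gradient hχc).comp_left (g := fun y : ℂ => ‖y‖ ^ 2) (by simp)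
    have hc : Continuous fun x => v x ^ 2 * ‖gradient χ x‖ ^ 2 :=
      (hv.pow 2).mul ((continuous_gradient hχ).norm.pow 2)
    exact hc.integrable_of_hasCompactSupport hs.mul_left
  have h2 := norm_integral_le_of_norm_le (f := fun x => 2 * σ x * χ x * v x *
    inner ℝ (g x) (gradient χ x)) ((i1.const_mul (1 / 2)).add (i2.const_mul (2 * M)))
    (Filter.Eventually.of_forall fun x => ?_)
  · simp only [Pi.add_apply] at h2
    rw [integral_add (i1.const_mul _) (i2.const_mul _), integral_const_mul, integral_const_mul,
      Real.norm_eq_abs] at h2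
    have := (abs_le.1 h2).1
    linarith
  · simp only [Pi.add_apply]
    have h3 := norm_inner_le_norm (𝕜 := ℝ) (g x) (gradient χ x)
    have h4 := (le_abs_self _).trans (hσM x)
    rw [norm_mul, norm_mul, norm_mul, norm_mul, Real.norm_of_nonneg (hσ0 x),
      Real.norm_of_nonneg (by norm_num : (0 : ℝ) ≤ 2), ← sq_abs (χ x), ← sq_abs (v x),
      ← Real.norm_eq_abs, ← Real.norm_eq_abs]
    have h5 : ‖χ x‖ * ‖v x‖ * ‖inner ℝ (g x) (gradient χ x)‖
        ≤ (‖χ x‖ * ‖g x‖) * (‖v x‖ * ‖gradient χ x‖) := by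
      calc _ ≤ ‖χ x‖ * ‖v x‖ * (‖g x‖ * ‖gradient χ x‖) := by gcongr
        _ = _ := by ring
    -- Young's inequality `2pq ≤ p² / 2 + 2q²`; the half is absorbed in the left side.
    have h6 := sq_nonneg (‖χ x‖ * ‖g x‖ - 2 * (‖v x‖ * ‖gradient χ x‖))
    have h7 : 0 ≤ ‖v x‖ ^ 2 * ‖gradient χ x‖ ^ 2 := by positivity
    calc 2 * σ x * ‖χ x‖ * ‖v x‖ * ‖inner ℝ (g x) (gradient χ x)‖
        = σ x * (2 * (‖χ x‖ * ‖v x‖ * ‖inner ℝ (g x) (gradient χ x)‖)) := by ring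
      _ ≤ σ x * (1 / 2 * (‖χ x‖ ^ 2 * ‖g x‖ ^ 2) + 2 * (‖v x‖ ^ 2 * ‖gradient χ x‖ ^ 2)) := by
          refine mul_le_mul_of_nonneg_left ?_ (hσ0 x)
          nlinarith
      _ ≤ _ := by nlinarith

lemma nonpos_of_forall_le_div {x K s₀ : ℝ} (h : ∀ s, s₀ ≤ s → x ≤ K / s) : x ≤ 0 :=
  ge_of_tendsto (tendsto_const_nhds.div_atTop Filter.tendsto_id)
    ((Filter.eventually_ge_atTop s₀).mono h)

lemma exists_decay (hdec : v =O[Bornology.cobounded ℂ] fun z => ‖z‖⁻¹) :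
    ∃ D R₁ : ℝ, 0 ≤ D ∧ 0 < R₁ ∧ ∀ z, R₁ ≤ ‖z‖ → |v z| ≤ D * ‖z‖⁻¹ := by
  obtain ⟨D, hD, hD'⟩ := hdec.exists_nonneg
  have hb := hD'.bound
  rw [← comap_norm_atTop, Filter.eventually_comap] at hb
  obtain ⟨R, hR⟩ := Filter.eventually_atTop.1 hb
  refine ⟨D, max R 1, hD, lt_of_lt_of_le one_pos (le_max_right _ _), fun z hz => ?_⟩
  simpa using hR ‖z‖ (le_trans (le_max_left _ _) hz) z rfl

/-- Caccioppoli's inequality with cutoffs at scale `R`: where the gradient of the cutoff does not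
vanish, `v` and that gradient are both `O(1 / R)`, while the area is `O(R²)`. The energy in any
fixed disk is therefore `O(R⁻²)`. -/
lemma ae_eq_zero_of_weak_solution {c : ℝ} (hσ : AEStronglyMeasurable σ volume)
    (hσM : ∀ x, |σ x| ≤ M) (hc : 0 < c) (hσc : ∀ x, c ≤ σ x)
    (hv : Continuous v) (hgL : ∀ K : Set ℂ, IsCompact K → MemLp g 2 (volume.restrict K))
    (hg : HasWeakGradient v g)
    (heq : ∀ φ : ℂ → ℝ, ContDiff ℝ ∞ φ → HasCompactSupport φ →
      ∫ z, σ z * inner ℝ (g z) (gradient φ z) = 0)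
    (hdec : v =O[Bornology.cobounded ℂ] fun z => ‖z‖⁻¹) : ∀ᵐ x, g x = 0 := by
  obtain ⟨D, R₁, hD, hR₁, hvD⟩ := exists_decay hdec
  have hM : 0 ≤ M := (abs_nonneg _).trans (hσM 0)
  let f : ContDiffBump (0 : ℂ) := ⟨1, 2, one_pos, one_lt_two⟩
  have hf : ContDiff ℝ ∞ f := f.contDiff
  obtain ⟨C, hC⟩ := (hasCompactSupport_gradient f.hasCompactSupport).exists_bound_of_continuous
    (continuous_gradient hf)
  have hC0 : 0 ≤ C := (norm_nonneg _).trans (hC 0)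
  have hball : ∀ n : ℕ, ∫ x in Metric.closedBall (0 : ℂ) n, ‖g x‖ ^ 2 ≤ 0 := by
    intro n
    refine nonpos_of_forall_le_div (K := 4 * M * (D * C) ^ 2 * (4 * Real.pi) / c)
      (s₀ := max (max R₁ n) 1) fun R hR => ?_
    have hRR₁ : R₁ ≤ R := (le_max_left _ _).trans ((le_max_left _ _).trans hR)
    have hRn : (n : ℝ) ≤ R := (le_max_right _ _).trans ((le_max_left _ _).trans hR)
    have hR1 : 1 ≤ R := (le_max_right _ _).trans hR
    have hR0 : 0 < R := by linarith
    set χ : ℂ → ℝ := fun x => f (R⁻¹ • x) with hχdef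
    have hχ : ContDiff ℝ ∞ χ := hf.comp (contDiff_const_smul _)
    have hχc : HasCompactSupport χ := f.hasCompactSupport.comp_smul (inv_ne_zero hR0.ne')
    have hnorm : ∀ x : ℂ, ‖R⁻¹ • x‖ = ‖x‖ / R := fun x => by
      rw [norm_smul, norm_inv, Real.norm_of_nonneg hR0.le, inv_mul_eq_div]
    have hχ1 : ∀ x : ℂ, ‖x‖ ≤ R → χ x = 1 := fun x hx => by
      refine f.one_of_mem_closedBall ?_
      rw [mem_closedBall_zero_iff, hnorm, div_le_one hR0]
      exact hx
    have hχ0 : ∀ x : ℂ, 2 * R ≤ ‖x‖ → χ x = 0 := fun x hx => by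
      refine f.zero_of_le_dist ?_
      rw [dist_zero_right, hnorm, le_div_iff₀ hR0]
      exact hx
    have hgrad : ∀ x, gradient χ x = R⁻¹ • gradient f (R⁻¹ • x) := by
      intro x
      have h1 : HasFDerivAt f (fderiv ℝ f (R⁻¹ • x)) (R⁻¹ • x) :=
        (hf.differentiable (by simp) _).hasFDerivAt
      have h2 : HasFDerivAt (fun x : ℂ => R⁻¹ • x) (R⁻¹ • ContinuousLinearMap.id ℝ ℂ) x :=
        (hasFDerivAt_id x).const_smul R⁻¹
      have h3 : fderiv ℝ χ x = _ := (h1.comp x h2).fderiv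
      refine ext_inner_right ℝ fun w => ?_
      rw [inner_gradient_eq, h3, inner_smul_left, inner_gradient_eq]
      simp
    have hgle : ∀ x, ‖gradient χ x‖ ≤ C / R := fun x => by
      rw [hgrad, norm_smul, norm_inv, Real.norm_of_nonneg hR0.le, inv_mul_eq_div]
      gcongr
      exact hC _
    have hlocal : ∀ (x : ℂ) (b : ℝ), (∀ᶠ y in nhds x, χ y = b) → gradient χ x = 0 := by
      intro x b h
      have h1 : fderiv ℝ χ x = fderiv ℝ (fun _ => b) x := Filter.EventuallyEq.fderiv_eq h
      rw [gradient, h1]; simp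
    have hin : ∀ x : ℂ, ‖x‖ < R → gradient χ x = 0 := fun x hx =>
      hlocal x 1 (by
        filter_upwards [(isOpen_lt continuous_norm continuous_const).mem_nhds hx] with y hy
        exact hχ1 y (le_of_lt hy))
    have hout : ∀ x : ℂ, 2 * R < ‖x‖ → gradient χ x = 0 := fun x hx =>
      hlocal x 0 (by
        filter_upwards [(isOpen_lt continuous_const continuous_norm).mem_nhds hx] with y hy
        exact hχ0 y (le_of_lt hy))
    have hcac := caccioppoli hσ hσM (fun x => hc.le.trans (hσc x)) hv hgL hg heq hχ hχc
    have hrhs : ∫ x, v x ^ 2 * ‖gradient χ x‖ ^ 2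
        ≤ (D / R) ^ 2 * (C / R) ^ 2 * ((2 * R) ^ 2 * Real.pi) := by
      have hvol : volume.real (Metric.closedBall (0 : ℂ) (2 * R)) = (2 * R) ^ 2 * Real.pi := by
        rw [measureReal_def, Complex.volume_closedBall]
        simp [ENNReal.toReal_ofReal, hR0.le]
      have hsupp : ∀ x, x ∉ Metric.closedBall (0 : ℂ) (2 * R) →
          v x ^ 2 * ‖gradient χ x‖ ^ 2 = 0 := fun x hx => by
        rw [mem_closedBall_zero_iff, not_le] at hx
        simp [hout x hx]
      rw [← setIntegral_eq_integral_of_forall_compl_eq_zero hsupp, ← hvol]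
      refine (Real.le_norm_self _).trans (norm_setIntegral_le_of_norm_le_const
        (isCompact_closedBall _ _).measure_lt_top fun x hx => ?_)
      rcases lt_or_ge ‖x‖ R with hx' | hx'
      · rw [hin x hx']; simp; positivity
      · have h1 := hvD x (hRR₁.trans hx')
        have h2 : |v x| ≤ D / R := by
          refine h1.trans ?_
          rw [div_eq_mul_inv]
          gcongr
        rw [norm_mul, norm_pow, norm_pow, norm_norm, Real.norm_eq_abs]
        gcongr
        exact hgle x
    have hlhs : c * ∫ x in Metric.closedBall (0 : ℂ) n, ‖g x‖ ^ 2
        ≤ ∫ x, σ x * (χ x ^ 2 * ‖g x‖ ^ 2) := by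
      have i1 := integrable_mul_mul_norm_sq hσ hσM hgL hχ.continuous hχc
      rw [← integral_const_mul]
      refine le_trans (setIntegral_mono_on ?_ i1.integrableOn
        Metric.isClosed_closedBall.measurableSet fun x hx => ?_)
        (setIntegral_le_integral i1 (Filter.Eventually.of_forall fun x => ?_))
      · exact ((hgL _ (isCompact_closedBall _ _)).integrable_norm_pow (by norm_num)).const_mul c
      · rw [mem_closedBall_zero_iff] at hx
        rw [hχ1 x (hx.trans hRn), one_pow, one_mul]
        exact mul_le_mul_of_nonneg_right (hσc x) (sq_nonneg _)
      · have := hc.le.trans (hσc x)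
        simp only [Pi.zero_apply]
        positivity
    have h4 : c * ∫ x in Metric.closedBall (0 : ℂ) n, ‖g x‖ ^ 2
        ≤ 4 * M * ((D / R) ^ 2 * (C / R) ^ 2 * ((2 * R) ^ 2 * Real.pi)) :=
      hlhs.trans (hcac.trans (mul_le_mul_of_nonneg_left hrhs (by positivity)))
    have h5 : 4 * M * ((D / R) ^ 2 * (C / R) ^ 2 * ((2 * R) ^ 2 * Real.pi))
        = 4 * M * (D * C) ^ 2 * (4 * Real.pi) / R ^ 2 := by
      field_simp; ring
    have h6 : 4 * M * (D * C) ^ 2 * (4 * Real.pi) / R ^ 2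
        ≤ 4 * M * (D * C) ^ 2 * (4 * Real.pi) / R := by
      gcongr
      nlinarith
    rw [div_div, mul_comm c R, ← div_div, le_div_iff₀ hc]
    linarith
  have hae : ∀ n : ℕ, ∀ᵐ x, x ∈ Metric.closedBall (0 : ℂ) n → g x = 0 := by
    intro n
    have i1 : IntegrableOn (fun x => ‖g x‖ ^ 2) (Metric.closedBall (0 : ℂ) n) :=
      (hgL _ (isCompact_closedBall _ _)).integrable_norm_pow (by norm_num)
    have h0 : ∫ x in Metric.closedBall (0 : ℂ) n, ‖g x‖ ^ 2 = 0 :=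
      le_antisymm (hball n) (integral_nonneg fun x => sq_nonneg _)
    have h1 := (setIntegral_eq_zero_iff_of_nonneg_ae
      (Filter.Eventually.of_forall fun x => sq_nonneg _) i1).1 h0
    have h2 := (ae_restrict_iff' Metric.isClosed_closedBall.measurableSet).1 h1
    filter_upwards [h2] with x hx hxn
    simpa using hx hxn
  filter_upwards [ae_all_iff.2 hae] with x hx
  obtain ⟨n, hn⟩ := exists_nat_ge ‖x‖
  exact hx n (by simpa using hn)

/-- A weak solution which decays at infinity vanishes. -/
lemma eq_zero_of_weak_solution {c : ℝ} (hσ : AEStronglyMeasurable σ volume)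
    (hσM : ∀ x, |σ x| ≤ M) (hc : 0 < c) (hσc : ∀ x, c ≤ σ x)
    (hv : Continuous v) (hgL : ∀ K : Set ℂ, IsCompact K → MemLp g 2 (volume.restrict K))
    (hg : HasWeakGradient v g)
    (heq : ∀ φ : ℂ → ℝ, ContDiff ℝ ∞ φ → HasCompactSupport φ →
      ∫ z, σ z * inner ℝ (g z) (gradient φ z) = 0)
    (hdec : v =O[Bornology.cobounded ℂ] fun z => ‖z‖⁻¹) : v = 0 := by
  have hg0 := ae_eq_zero_of_weak_solution hσ hσM hc hσc hv hgL hg heq hdec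
  obtain ⟨D, R₁, hD, hR₁, hvD⟩ := exists_decay hdec
  have hmol : ∀ ψ : ℂ → ℝ, ContDiff ℝ ∞ ψ → HasCompactSupport ψ → mollify v ψ 0 = 0 := by
    intro ψ hψ hψc
    have hm := contDiff_mollify hv hψ hψc
    -- With vanishing weak gradient every mollification is constant, and its value can be read off
    -- at infinity.
    have hconst : ∀ x, mollify v ψ 0 = mollify v ψ x := by
      refine fun x => is_const_of_fderiv_eq_zero (𝕜 := ℝ) (hm.differentiable (by simp))
        (fun x => ?_) 0 x
      have : gradient (mollify v ψ) x = 0 := by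
        rw [gradient_mollify hv hg hψ hψc, integral_eq_zero_of_ae]
        filter_upwards [hg0] with t ht
        simp [ht]
      ext w
      rw [← inner_gradient_eq, this]
      simp
    obtain ⟨R, hR0, hR⟩ := exists_radius hψc
    have hψi : Integrable ψ := hψ.continuous.integrable_of_hasCompactSupport hψc
    have : ‖mollify v ψ 0‖ ≤ 0 := by
      refine nonpos_of_forall_le_div (K := (∫ t, ‖ψ t‖) * D) (s₀ := R₁) fun s hs => ?_
      have hs0 : 0 < s := hR₁.trans_le hs
      -- At the point `R + s` all values of `v` entering the mollification are taken at distance at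
      -- least `s` from the origin, where `v` is at most `D / s`.
      rw [hconst ((R + s : ℝ) : ℂ), mollify_eq_swap, mul_div_assoc, ← integral_mul_const]
      refine norm_integral_le_of_norm_le (hψi.norm.mul_const _)
        (Filter.Eventually.of_forall fun t => ?_)
      rw [norm_mul]
      by_cases ht : ψ t = 0
      · simp [ht]
      · have htR : ‖t‖ ≤ R := not_lt.1 fun h => ht (hR t h)
        have h1 : s ≤ ‖((R + s : ℝ) : ℂ) - t‖ := by
          have := norm_sub_norm_le ((R + s : ℝ) : ℂ) t
          rw [Complex.norm_real, Real.norm_of_nonneg (by linarith)] at this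
          linarith
        have h2 := hvD _ (hs.trans h1)
        rw [Real.norm_eq_abs (v _)]
        refine mul_le_mul_of_nonneg_left (h2.trans ?_) (norm_nonneg _)
        rw [div_eq_mul_inv]
        gcongr
    simpa using this
  have hae : ∀ᵐ x, v x = 0 := by
    refine ae_eq_zero_of_integral_contDiff_smul_eq_zero hv.locallyIntegrable fun ψ hψ hψc => ?_
    have := hmol (fun t => ψ (-t)) (hψ.comp contDiff_neg)
      (hψc.comp_homeomorph (Homeomorph.neg ℂ))
    rw [mollify] at this
    simpa [mul_comm] using this
  exact (hv.ae_eq_iff_eq volume continuous_const).1 hae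

end energy

/-! ## Weak gradients of locally Lipschitz functions -/

/-- `f` is Lipschitz on every bounded set. -/
def BoundedlyLipschitz (f : ℂ → ℝ) : Prop :=
  ∀ R : ℝ, ∃ K : NNReal, LipschitzOnWith K f (Metric.closedBall 0 R)

lemma BoundedlyLipschitz.continuous {f : ℂ → ℝ} (hf : BoundedlyLipschitz f) : Continuous f := by
  refine continuous_iff_continuousAt.2 fun x => ?_
  obtain ⟨K, hK⟩ := hf (‖x‖ + 1)
  exact hK.continuousOn.continuousAt (Metric.closedBall_mem_nhds_of_mem (by simp))

lemma measurable_gradient (f : ℂ → ℝ) : Measurable (gradient f) :=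
  (InnerProductSpace.toDual ℝ ℂ).symm.continuous.measurable.comp (measurable_fderiv ℝ f)

lemma norm_gradient_eq (f : ℂ → ℝ) (x : ℂ) : ‖gradient f x‖ = ‖fderiv ℝ f x‖ := by
  rw [gradient, LinearIsometryEquiv.norm_map]

lemma BoundedlyLipschitz.memLp_gradient {f : ℂ → ℝ} (hf : BoundedlyLipschitz f) {S : Set ℂ}
    (hS : IsCompact S) : MemLp (gradient f) 2 (volume.restrict S) := by
  obtain ⟨R, hR⟩ := hS.isBounded.subset_closedBall (0 : ℂ)
  obtain ⟨K, hK⟩ := hf (R + 1)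
  have hfin : IsFiniteMeasure (volume.restrict S) := ⟨by
    rw [Measure.restrict_apply_univ]; exact hS.measure_lt_top⟩
  refine MemLp.of_bound (measurable_gradient f).aestronglyMeasurable K ?_
  filter_upwards [ae_restrict_mem hS.isClosed.measurableSet] with x hx
  rw [norm_gradient_eq]
  have hx' := hR hx
  rw [mem_closedBall_zero_iff] at hx'
  exact norm_fderiv_le_of_lipschitzOn ℝ
    (Metric.closedBall_mem_nhds_of_mem (by rw [mem_ball_zero_iff]; linarith)) hK

/-- On the support of the test function `f` agrees with a globally Lipschitz function. Rademacher's
theorem and integration by parts of line derivatives apply to that extension. -/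
lemma BoundedlyLipschitz.hasWeakGradient {f : ℂ → ℝ} (hf : BoundedlyLipschitz f) :
    HasWeakGradient f (gradient f) := by
  intro φ hφ hφc
  obtain ⟨R, hR0, hR⟩ := exists_radius hφc
  obtain ⟨K, hK⟩ := hf (R + 1)
  obtain ⟨f', hf', hff'⟩ := hK.extend_real
  obtain ⟨K', hφL⟩ : ∃ K', LipschitzWith K' φ :=
    ContDiff.lipschitzWith_of_hasCompactSupport hφc hφ (by simp)
  have hφR : ∀ x, φ x ≠ 0 → ‖x‖ ≤ R := fun x hx => not_lt.1 fun h => hx (hR x h)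
  have hgR : ∀ x, gradient φ x ≠ 0 → ‖x‖ ≤ R := by
    intro x hx
    by_contra h
    refine hx ?_
    have : fderiv ℝ φ x = fderiv ℝ (fun _ => (0 : ℝ)) x := by
      refine Filter.EventuallyEq.fderiv_eq ?_
      filter_upwards [(isOpen_lt continuous_const continuous_norm).mem_nhds (not_le.1 h)]
        with y hy using hR y hy
    rw [gradient, this]; simp
  have hmem : ∀ x : ℂ, ‖x‖ ≤ R → f x = f' x := fun x hx =>
    hff' (by rw [mem_closedBall_zero_iff]; linarith)
  have hev : ∀ x : ℂ, ‖x‖ ≤ R → f =ᶠ[nhds x] f' := fun x hx => by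
    filter_upwards [Metric.closedBall_mem_nhds_of_mem (x := x) (c := (0 : ℂ)) (ε := R + 1)
      (by rw [mem_ball_zero_iff]; linarith)] with y hy using hff' hy
  have i1 : Integrable fun x => f x • gradient φ x :=
    (hf.continuous.smul (continuous_gradient hφ)).integrable_of_hasCompactSupport
      (hasCompactSupport_gradient hφc).smul_left
  have i2 : Integrable fun x => φ x • gradient f x := by
    have hs : Function.support (fun x => φ x • gradient f x) ⊆ tsupport φ := by
      intro x hx
      refine subset_tsupport _ (Function.mem_support.2 fun h => hx ?_)
      simp [h]
    rw [← integrableOn_iff_integrable_of_support_subset hs]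
    have hfin : IsFiniteMeasure (volume.restrict (tsupport φ)) := ⟨by
      rw [Measure.restrict_apply_univ]; exact hφc.isCompact.measure_lt_top⟩
    obtain ⟨C, hC⟩ := hφc.exists_bound_of_continuous hφ.continuous
    exact ((hf.memLp_gradient hφc.isCompact).integrable (by norm_num)).bdd_smul C
      hφ.continuous.aestronglyMeasurable (Filter.Eventually.of_forall hC)
  refine ext_inner_right ℝ fun w => ?_
  rw [inner_neg_left, real_inner_comm, ← integral_inner i1, real_inner_comm, ← integral_inner i2]
  have key := hf'.integral_lineDeriv_mul_eq (μ := volume) hφL hφc w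
  have e1 : ∫ x, inner ℝ w (f x • gradient φ x) = -∫ x, lineDeriv ℝ φ x (-w) * f' x := by
    rw [← integral_neg]
    refine integral_congr_ae (Filter.Eventually.of_forall fun x => ?_)
    simp only [inner_smul_right]
    rw [real_inner_comm, inner_gradient_eq,
      (hφ.differentiable (by simp) x).lineDeriv_eq_fderiv, map_neg]
    by_cases hx : gradient φ x = 0
    · have : fderiv ℝ φ x w = 0 := by rw [← inner_gradient_eq, hx]; simp
      rw [this]; simp
    · rw [hmem x (hgR x hx)]; ring
  have e2 : ∫ x, inner ℝ w (φ x • gradient f x) = ∫ x, lineDeriv ℝ f' x w * φ x := by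
    refine integral_congr_ae ?_
    filter_upwards [hf'.ae_differentiableAt (μ := volume)] with x hx
    simp only [inner_smul_right]
    rw [real_inner_comm, inner_gradient_eq, hx.lineDeriv_eq_fderiv]
    by_cases hx0 : φ x = 0
    · simp [hx0]
    · rw [(hev x (hφR x hx0)).fderiv_eq]; ring
  rw [e1, e2, key]

/-- The equation `∇ · (σ∇U) = 0` holds if `σ∇U` is, up to a rotation, the gradient of a function. -/
lemma integral_inner_gradient_eq_zero_of_conjugate {U W σ : ℂ → ℝ}
    (hW : BoundedlyLipschitz W)
    (hconj : ∀ᵐ x, gradient W x = Complex.I * (σ x * gradient U x)) {φ : ℂ → ℝ}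
    (hφ : ContDiff ℝ ∞ φ) (hφc : HasCompactSupport φ) :
    ∫ x, σ x * inner ℝ (gradient U x) (gradient φ x) = 0 := by
  set φ₁ : ℂ → ℝ := fun x => fderiv ℝ φ x 1 with h1def
  set φ₂ : ℂ → ℝ := fun x => fderiv ℝ φ x Complex.I with h2def
  have hφ' : ContDiff ℝ ∞ (fderiv ℝ φ) := hφ.fderiv_right (by simp)
  have h1 : ContDiff ℝ ∞ φ₁ := hφ'.clm_apply contDiff_const
  have h2 : ContDiff ℝ ∞ φ₂ := hφ'.clm_apply contDiff_const
  have h1c : HasCompactSupport φ₁ := (hφc.fderiv (𝕜 := ℝ)).comp_left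
    (g := fun L : ℂ →L[ℝ] ℝ => L 1) (by simp)
  have h2c : HasCompactSupport φ₂ := (hφc.fderiv (𝕜 := ℝ)).comp_left
    (g := fun L : ℂ →L[ℝ] ℝ => L Complex.I) (by simp)
  have hint : ∀ ψ : ℂ → ℝ, ContDiff ℝ ∞ ψ → HasCompactSupport ψ →
      Integrable (fun x => W x • gradient ψ x) := fun ψ hψ hψc =>
    (hW.continuous.smul (continuous_gradient hψ)).integrable_of_hasCompactSupport
      (hasCompactSupport_gradient hψc).smul_left
  have hint' : ∀ ψ : ℂ → ℝ, ContDiff ℝ ∞ ψ → HasCompactSupport ψ →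
      Integrable (fun x => ψ x • gradient W x) := fun ψ hψ hψc => by
    have hs : Function.support (fun x => ψ x • gradient W x) ⊆ tsupport ψ := by
      intro x hx
      refine subset_tsupport _ (Function.mem_support.2 fun h => hx ?_)
      simp [h]
    rw [← integrableOn_iff_integrable_of_support_subset hs]
    have hfin : IsFiniteMeasure (volume.restrict (tsupport ψ)) := ⟨by
      rw [Measure.restrict_apply_univ]; exact hψc.isCompact.measure_lt_top⟩
    obtain ⟨C, hC⟩ := hψc.exists_bound_of_continuous hψ.continuous
    exact ((hW.memLp_gradient hψc.isCompact).integrable (by norm_num)).bdd_smul C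
      hψ.continuous.aestronglyMeasurable (Filter.Eventually.of_forall hC)
  have hwk : ∀ (ψ : ℂ → ℝ) (w : ℂ), ContDiff ℝ ∞ ψ → HasCompactSupport ψ →
      ∫ x, inner ℝ w (W x • gradient ψ x) = -∫ x, inner ℝ w (ψ x • gradient W x) := by
    intro ψ w hψ hψc
    rw [integral_inner (hint ψ hψ hψc), hW.hasWeakGradient ψ hψ hψc, inner_neg_right,
      integral_inner (hint' ψ hψ hψc)]
  have hsymm : ∀ x, fderiv ℝ φ₁ x Complex.I = fderiv ℝ φ₂ x 1 := by
    intro x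
    have hd : DifferentiableAt ℝ (fderiv ℝ φ) x := hφ'.differentiable (by simp) x
    have hs : IsSymmSndFDerivAt ℝ φ x := hφ.contDiffAt.isSymmSndFDerivAt
      (by simpa using WithTop.coe_le_coe.2 (le_top (a := (2 : ℕ∞))))
    have e1 : HasFDerivAt φ₁ ((ContinuousLinearMap.apply ℝ ℝ (1 : ℂ)).comp
      (fderiv ℝ (fderiv ℝ φ) x)) x :=
      (ContinuousLinearMap.apply ℝ ℝ (1 : ℂ)).hasFDerivAt.comp x hd.hasFDerivAt
    have e2 : HasFDerivAt φ₂ ((ContinuousLinearMap.apply ℝ ℝ Complex.I).comp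
      (fderiv ℝ (fderiv ℝ φ) x)) x :=
      (ContinuousLinearMap.apply ℝ ℝ Complex.I).hasFDerivAt.comp x hd.hasFDerivAt
    rw [e1.fderiv, e2.fderiv]
    simpa using hs.eq Complex.I 1
  have hA := hwk φ₁ Complex.I h1 h1c
  have hB := hwk φ₂ 1 h2 h2c
  -- Second derivatives of `φ` commute: in the weak sense, a rotated gradient has zero divergence.
  have hAB : ∫ x, inner ℝ Complex.I (W x • gradient φ₁ x)
      = ∫ x, inner ℝ (1 : ℂ) (W x • gradient φ₂ x) := by
    refine integral_congr_ae (Filter.Eventually.of_forall fun x => ?_)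
    simp only [inner_smul_right]
    rw [real_inner_comm, inner_gradient_eq, hsymm, real_inner_comm, inner_gradient_eq]
  rw [hA, hB, neg_inj] at hAB
  have hi1 : Integrable fun x => inner ℝ Complex.I (φ₁ x • gradient W x) :=
    (hint' φ₁ h1 h1c).const_inner _
  have hi2 : Integrable fun x => inner ℝ (1 : ℂ) (φ₂ x • gradient W x) :=
    (hint' φ₂ h2 h2c).const_inner _
  rw [← sub_eq_zero, ← integral_sub hi1 hi2] at hAB
  rw [← hAB]
  refine integral_congr_ae ?_
  filter_upwards [hconj] with x hx
  rw [hx, h1def, h2def]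
  simp only [← inner_gradient_eq, inner_smul_right, Complex.inner]
  simp
  ring

/-! ## Gluing Lipschitz maps -/

/-- A segment from `A` to `B` is connected, so it meets `A ∩ B`; distances add along the segment.
The constant is not enlarged. -/
lemma lipschitzWith_of_closed_cover {Y : Type*} [PseudoMetricSpace Y] {f : ℂ → Y} {K : NNReal}
    {A B : Set ℂ} (hA : IsClosed A) (hB : IsClosed B) (hAB : A ∪ B = Set.univ)
    (hfA : LipschitzOnWith K f A) (hfB : LipschitzOnWith K f B) : LipschitzWith K f := by
  have key : ∀ x ∈ A, ∀ y ∈ B, dist (f x) (f y) ≤ K * dist x y := by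
    intro x hx y hy
    obtain ⟨p, hp, hpA, hpB⟩ := isPreconnected_closed_iff.1
      (convex_segment x y).isPreconnected A B hA hB (by rw [hAB]; exact Set.subset_univ _)
      ⟨x, left_mem_segment ℝ x y, hx⟩ ⟨y, right_mem_segment ℝ x y, hy⟩
    calc dist (f x) (f y) ≤ dist (f x) (f p) + dist (f p) (f y) := dist_triangle _ _ _
      _ ≤ K * dist x p + K * dist p y :=
          add_le_add (hfA.dist_le_mul x hx p hpA) (hfB.dist_le_mul p hpB y hy)
      _ = K * dist x y := by rw [← mul_add, dist_add_dist_of_mem_segment hp]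
  refine LipschitzWith.of_dist_le_mul fun x y => ?_
  have hx : x ∈ A ∪ B := hAB ▸ Set.mem_univ x
  have hy : y ∈ A ∪ B := hAB ▸ Set.mem_univ y
  rcases hx with hx | hx <;> rcases hy with hy | hy
  · exact hfA.dist_le_mul x hx y hy
  · exact key x hx y hy
  · rw [dist_comm, dist_comm x y]; exact key y hy x hx
  · exact hfB.dist_le_mul x hx y hy

/-! ## Reflections -/

/-- Reflection in the circle of center `c` and radius `r`. -/
def refl (c r : ℝ) (z : ℂ) : ℂ := c + (r : ℂ) ^ 2 / ((starRingEnd ℂ) z - c)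

/-- The antiholomorphic derivative of `refl c r`. -/
def reflDeriv (c r : ℝ) (z : ℂ) : ℂ := -((r : ℂ) ^ 2 / ((starRingEnd ℂ) z - c) ^ 2)

section refl
variable {c r : ℝ} {z : ℂ}

lemma norm_conj_sub (c : ℝ) (z : ℂ) : ‖(starRingEnd ℂ) z - c‖ = ‖z - c‖ := by
  rw [← Complex.norm_conj (z - c)]; simp

lemma norm_refl_sub (z : ℂ) : ‖refl c r z - c‖ = r ^ 2 / ‖z - c‖ := by
  simp [refl, norm_conj_sub]

lemma refl_mem_closedBall (hr : 0 < r) (hz : z ∉ Metric.ball (c : ℂ) r) :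
    refl c r z ∈ Metric.closedBall (c : ℂ) r := by
  rw [Metric.mem_ball, dist_eq_norm, not_lt] at hz
  rw [Metric.mem_closedBall, dist_eq_norm, norm_refl_sub, div_le_iff₀ (hr.trans_le hz)]
  nlinarith

lemma norm_reflDeriv_le (hr : 0 < r) (hz : z ∉ Metric.ball (c : ℂ) r) :
    ‖reflDeriv c r z‖ ≤ 1 := by
  rw [Metric.mem_ball, dist_eq_norm, not_lt] at hz
  rw [reflDeriv, norm_neg, norm_div, norm_pow, norm_pow, norm_conj_sub, Complex.norm_real,
    Real.norm_of_nonneg hr.le]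
  have := hr.trans_le hz
  rw [div_le_one (by positivity)]
  gcongr

lemma conj_sub_ne_zero (hr : 0 < r) (hz : z ∉ Metric.ball (c : ℂ) r) :
    (starRingEnd ℂ) z - c ≠ 0 := by
  rw [Metric.mem_ball, dist_eq_norm, not_lt] at hz
  rw [← norm_pos_iff, norm_conj_sub]
  exact hr.trans_le hz

lemma refl_of_mem_sphere (hr : 0 < r) (hz : ‖z - c‖ = r) : refl c r z = z := by
  have h0 : (starRingEnd ℂ) z - c ≠ 0 := by
    rw [← norm_pos_iff, norm_conj_sub, hz]; exact hr
  have h1 : (z - c) * ((starRingEnd ℂ) z - c) = (r : ℂ) ^ 2 := by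
    have := Complex.mul_conj' (z - c)
    rw [hz] at this
    simpa using this
  rw [refl, ← h1, mul_div_assoc, div_self h0]
  ring

lemma lipschitzOnWith_refl (hr : 0 < r) : LipschitzOnWith 1 (refl c r) (Metric.ball (c : ℂ) r)ᶜ := by
  refine LipschitzOnWith.of_dist_le_mul fun z hz w hw => ?_
  have hz0 := conj_sub_ne_zero hr hz
  have hw0 := conj_sub_ne_zero hr hw
  rw [Set.mem_compl_iff, Metric.mem_ball, dist_eq_norm, not_lt] at hz hw
  have h1 : refl c r z - refl c r w = (r : ℂ) ^ 2 * ((starRingEnd ℂ) (w - z))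
      / (((starRingEnd ℂ) z - c) * ((starRingEnd ℂ) w - c)) := by
    rw [refl, refl, map_sub]; field_simp; ring
  rw [dist_eq_norm, dist_eq_norm, h1, norm_div, norm_mul, norm_mul, norm_conj_sub, norm_conj_sub,
    Complex.norm_conj, norm_pow, Complex.norm_real, Real.norm_of_nonneg hr.le, norm_sub_rev w z]
  have hz1 := hr.trans_le hz
  have hw1 := hr.trans_le hw
  rw [div_le_iff₀ (by positivity)]
  have h2 : r * r ≤ ‖z - c‖ * ‖w - c‖ := mul_le_mul hz hw hr.le (norm_nonneg _)
  have h3 := norm_nonneg (z - w)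
  simp only [NNReal.coe_one, one_mul]
  nlinarith

open Classical in
/-- The identity in the disk and the reflection outside. -/
def fold (c r : ℝ) (z : ℂ) : ℂ := if z ∈ Metric.ball (c : ℂ) r then z else refl c r z

lemma fold_of_mem (hz : z ∈ Metric.ball (c : ℂ) r) : fold c r z = z := if_pos hz

lemma fold_of_notMem (hz : z ∉ Metric.ball (c : ℂ) r) : fold c r z = refl c r z := if_neg hz

lemma fold_of_mem_closedBall (hr : 0 < r) (hz : z ∈ Metric.closedBall (c : ℂ) r) :
    fold c r z = z := by
  by_cases h : z ∈ Metric.ball (c : ℂ) r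
  · exact fold_of_mem h
  · rw [fold_of_notMem h]
    rw [Metric.mem_closedBall, dist_eq_norm] at hz
    rw [Metric.mem_ball, dist_eq_norm, not_lt] at h
    exact refl_of_mem_sphere hr (le_antisymm hz h)

lemma fold_mem_closedBall (hr : 0 < r) (z : ℂ) : fold c r z ∈ Metric.closedBall (c : ℂ) r := by
  by_cases h : z ∈ Metric.ball (c : ℂ) r
  · rw [fold_of_mem h]; exact Metric.ball_subset_closedBall h
  · rw [fold_of_notMem h]; exact refl_mem_closedBall hr h

lemma closedBall_union_compl_ball (c : ℂ) (r : ℝ) :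
    Metric.closedBall c r ∪ (Metric.ball c r)ᶜ = Set.univ := by
  ext z
  simp only [Set.mem_union, Metric.mem_closedBall, Set.mem_compl_iff, Metric.mem_ball,
    Set.mem_univ, iff_true, not_lt]
  exact le_total _ _

lemma lipschitzOnWith_of_eqOn {X Y : Type*} [PseudoEMetricSpace X] [PseudoEMetricSpace Y]
    {f g : X → Y} {K : NNReal} {S : Set X} (hf : LipschitzOnWith K f S) (h : Set.EqOn g f S) :
    LipschitzOnWith K g S := fun x hx y hy => by
  rw [h hx, h hy]; exact hf hx hy

lemma lipschitzWith_fold (hr : 0 < r) : LipschitzWith 1 (fold c r) := by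
  refine lipschitzWith_of_closed_cover (A := Metric.closedBall (c : ℂ) r)
    (B := (Metric.ball (c : ℂ) r)ᶜ) Metric.isClosed_closedBall Metric.isOpen_ball.isClosed_compl
    (closedBall_union_compl_ball _ _) ?_ ?_
  · exact lipschitzOnWith_of_eqOn LipschitzWith.id.lipschitzOnWith
      fun z hz => fold_of_mem_closedBall hr hz
  · exact lipschitzOnWith_of_eqOn (lipschitzOnWith_refl hr) fun z hz => fold_of_notMem hz

end refl

/-! ## Gradients of real parts -/

lemma hasGradientAt_re {f : ℂ → ℂ} {f' z : ℂ} (hf : HasDerivAt f f' z) :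
    HasGradientAt (fun z => (f z).re) ((starRingEnd ℂ) f') z := by
  rw [hasGradientAt_iff_hasFDerivAt]
  have h := (Complex.reCLM.hasFDerivAt (x := f z)).comp z
    (hf.hasFDerivAt.restrictScalars ℝ)
  refine h.congr_fderiv ?_
  ext w
  simp [Complex.inner, mul_comm]

/-- The composite is a holomorphic function of the conjugate of `z`, so the conjugation in
`hasGradientAt_re` is undone and the derivative appears without a bar. -/
lemma hasGradientAt_re_refl {c r : ℝ} {f : ℂ → ℂ} {f' z : ℂ} (hz : (starRingEnd ℂ) z - c ≠ 0)
    (hf : HasDerivAt f f' (refl c r z)) :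
    HasGradientAt (fun z => (f (refl c r z)).re) (f' * reflDeriv c r z) z := by
  have hQ : HasDerivAt (fun x : ℂ => (c : ℂ) + (r : ℂ) ^ 2 / (x - c)) (reflDeriv c r z)
      ((starRingEnd ℂ) z) := by
    have := ((((hasDerivAt_id ((starRingEnd ℂ) z)).sub_const (c : ℂ)).inv hz).const_mul
      ((r : ℂ) ^ 2)).const_add (c : ℂ)
    refine (this.congr_deriv ?_)
    rw [reflDeriv]
    simp
    ring
  have h1 : HasDerivAt (fun x : ℂ => f ((c : ℂ) + (r : ℂ) ^ 2 / (x - c))) (f' * reflDeriv c r z)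
      ((starRingEnd ℂ) z) := HasDerivAt.comp ((starRingEnd ℂ) z) (h₂ := f) hf hQ
  have h2 := (Complex.reCLM.hasFDerivAt (x := f (refl c r z))).comp ((starRingEnd ℂ) z)
    (h1.hasFDerivAt.restrictScalars ℝ)
  have h3 := h2.comp z (Complex.conjCLE.toContinuousLinearMap.hasFDerivAt (x := z))
  rw [hasGradientAt_iff_hasFDerivAt]
  refine h3.congr_fderiv ?_
  ext w
  simp [Complex.inner, mul_comm]
  ring

lemma hasGradientAt_const_mul {f : ℂ → ℝ} {g z : ℂ} (b : ℝ) (hf : HasGradientAt f g z) :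
    HasGradientAt (fun z => b * f z) (b * g) z := by
  rw [hasGradientAt_iff_hasFDerivAt] at hf ⊢
  refine (hf.const_mul b).congr_fderiv ?_
  rw [← Complex.real_smul, map_smulₛₗ]
  simp

lemma hasGradientAt_add {f h : ℂ → ℝ} {g k z : ℂ} (hf : HasGradientAt f g z)
    (hh : HasGradientAt h k z) : HasGradientAt (fun z => f z + h z) (g + k) z := by
  rw [hasGradientAt_iff_hasFDerivAt] at hf hh ⊢
  rw [map_add]
  exact hf.add hh

lemma hasGradientAt_sub {f h : ℂ → ℝ} {g k z : ℂ} (hf : HasGradientAt f g z)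
    (hh : HasGradientAt h k z) : HasGradientAt (fun z => f z - h z) (g - k) z := by
  rw [hasGradientAt_iff_hasFDerivAt] at hf hh ⊢
  rw [map_sub]
  exact hf.sub hh

/-! ## The solution as a series of images -/

/-- Two nested circles centered on the positive real axis whose reflections exchange `a` and `-a`;
the combined reflection is the flow at time `μ`. -/
structure NestedCircles where
  (a μ cI rI cE rE : ℝ)
  a_pos : 0 < a
  a_le_one : a ≤ 1
  μ_pos : 0 < μ
  rI_pos : 0 < rI
  rE_pos : 0 < rE
  cI_pos : 0 < cI
  cI_lt : cI < cE
  sq_cI : cI ^ 2 = rI ^ 2 + a ^ 2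
  sq_cE : cE ^ 2 = rE ^ 2 + a ^ 2
  nested : cE - cI + rI < rE
  exp_μ : Real.exp μ * ((cI - a) * (cE + a)) = (cI + a) * (cE - a)

namespace NestedCircles
variable (D : NestedCircles)

/-- The inner disk. -/
def ballI : Set ℂ := Metric.ball (D.cI : ℂ) D.rI

/-- The outer disk. -/
def ballE : Set ℂ := Metric.ball (D.cE : ℂ) D.rE

/-- The closed inner disk. -/
def closedI : Set ℂ := Metric.closedBall (D.cI : ℂ) D.rI

/-- The closed outer disk. -/
def closedE : Set ℂ := Metric.closedBall (D.cE : ℂ) D.rE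

/-- Reflection in the inner circle. -/
def reflI (z : ℂ) : ℂ := refl D.cI D.rI z

/-- Reflection in the outer circle. -/
def reflE (z : ℂ) : ℂ := refl D.cE D.rE z

/-- A bound for the outer disk. -/
def radius : ℝ := D.cE + D.rE

lemma ballI_subset : D.ballI ⊆ D.closedI := Metric.ball_subset_closedBall

lemma ballE_subset : D.ballE ⊆ D.closedE := Metric.ball_subset_closedBall

lemma closedI_subset_ballE : D.closedI ⊆ D.ballE := by
  refine Metric.closedBall_subset_ball' ?_
  rw [dist_comm, dist_eq_norm, ← Complex.ofReal_sub, Complex.norm_real, Real.norm_of_nonneg]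
  · linarith [D.nested]
  · linarith [D.cI_lt]

lemma closedI_subset_closedE : D.closedI ⊆ D.closedE :=
  D.closedI_subset_ballE.trans D.ballE_subset

lemma rE_lt_cE : D.rE < D.cE := by
  have h1 := D.sq_cE
  have h2 := D.a_pos
  have h3 := D.cI_pos.trans D.cI_lt
  have h4 := D.rE_pos
  nlinarith

lemma re_pos {z : ℂ} (hz : z ∈ D.closedE) : 0 < z.re := by
  have h1 : ‖z - D.cE‖ ≤ D.rE := by simpa [closedE, dist_eq_norm] using hz
  have h2 := (Complex.abs_re_le_norm (z - D.cE)).trans h1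
  rw [Complex.sub_re, Complex.ofReal_re] at h2
  linarith [(abs_le.1 h2).1, D.rE_lt_cE]

lemma norm_le_radius {z : ℂ} (hz : z ∈ D.closedE) : ‖z‖ ≤ D.radius := by
  have h1 : ‖z - D.cE‖ ≤ D.rE := by simpa [closedE, dist_eq_norm] using hz
  have h2 := norm_add_le (z - D.cE) D.cE
  rw [sub_add_cancel, Complex.norm_real, Real.norm_of_nonneg (D.cI_pos.trans D.cI_lt).le] at h2
  rw [radius]
  linarith

lemma notMem_ballI {z : ℂ} (hz : z ∉ D.closedI) : z ∉ D.ballI := fun h => hz (D.ballI_subset h)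

lemma notMem_ballE {z : ℂ} (hz : z ∉ D.closedE) : z ∉ D.ballE := fun h => hz (D.ballE_subset h)

lemma notMem_closedI {z : ℂ} (hz : z ∉ D.ballE) : z ∉ D.closedI :=
  fun h => hz (D.closedI_subset_ballE h)

lemma reflI_mem {z : ℂ} (hz : z ∉ D.ballI) : D.reflI z ∈ D.closedI :=
  refl_mem_closedBall D.rI_pos hz

lemma reflE_mem {z : ℂ} (hz : z ∉ D.ballE) : D.reflE z ∈ D.closedE :=
  refl_mem_closedBall D.rE_pos hz

/-- In the coordinate `w` the reflections are `e^{2ξₑ} / w̄` and `e^{2ξᵢ} / w̄`, which differ by the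
factor `e^μ`; the field `exp_μ` states this in terms of centers. -/
lemma flow_reflE {z : ℂ} (hz : z ∉ D.ballE) :
    flow D.a (Real.exp D.μ) (D.reflE z) = D.reflI z := by
  have h1 := conj_sub_ne_zero D.rE_pos hz
  have h2 := conj_sub_ne_zero D.rI_pos (D.notMem_ballI (D.notMem_closedI hz))
  have h3 := flowDen_ne_zero D.a_pos (Real.one_le_exp D.μ_pos.le)
    (D.re_pos (D.reflE_mem hz)).le
  have hI : (D.rI : ℂ) ^ 2 = (D.cI : ℂ) ^ 2 - (D.a : ℂ) ^ 2 := by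
    have := D.sq_cI; rw [eq_sub_iff_add_eq]; exact_mod_cast this.symm
  have hE : (D.rE : ℂ) ^ 2 = (D.cE : ℂ) ^ 2 - (D.a : ℂ) ^ 2 := by
    have := D.sq_cE; rw [eq_sub_iff_add_eq]; exact_mod_cast this.symm
  have hexp : ((Real.exp D.μ : ℝ) : ℂ) * ((D.cI - D.a) * (D.cE + D.a))
      = (D.cI + D.a) * (D.cE - D.a) := by exact_mod_cast D.exp_μ
  rw [flow, div_eq_iff h3, flowDen, reflI, reflE, refl, refl, hI, hE]
  set X := (starRingEnd ℂ) z
  set s := ((Real.exp D.μ : ℝ) : ℂ)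
  field_simp
  linear_combination -(X ^ 2 - (D.a : ℂ) ^ 2) * hexp

open Classical in
/-- The combined reflection in the outer disk, continued by the reflection in the inner circle. -/
def mapN (z : ℂ) : ℂ := if z ∈ D.ballE then flow D.a (Real.exp D.μ) z else D.reflI z

lemma mapN_of_mem {z : ℂ} (hz : z ∈ D.ballE) : D.mapN z = flow D.a (Real.exp D.μ) z := if_pos hz

lemma mapN_of_notMem {z : ℂ} (hz : z ∉ D.ballE) : D.mapN z = D.reflI z := if_neg hz

lemma mapN_of_mem_closedE {z : ℂ} (hz : z ∈ D.closedE) :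
    D.mapN z = flow D.a (Real.exp D.μ) z := by
  by_cases h : z ∈ D.ballE
  · exact D.mapN_of_mem h
  · rw [D.mapN_of_notMem h, ← D.flow_reflE h]
    have h1 : ‖z - D.cE‖ ≤ D.rE := by simpa [closedE, dist_eq_norm] using hz
    have h2 : D.rE ≤ ‖z - D.cE‖ := by simpa [ballE, dist_eq_norm] using h
    rw [reflE, refl_of_mem_sphere D.rE_pos (le_antisymm h1 h2)]

/-- The flow contracts in the convex outer disk, the inner reflection contracts outside, and by
`flow_reflE` they agree on the outer circle, where `reflE` is the identity. -/
lemma lipschitzWith_mapN : LipschitzWith 1 D.mapN := by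
  refine lipschitzWith_of_closed_cover (A := D.closedE) (B := D.ballEᶜ)
    Metric.isClosed_closedBall Metric.isOpen_ball.isClosed_compl
    (closedBall_union_compl_ball _ _) ?_ ?_
  · refine lipschitzOnWith_of_eqOn ?_ fun z hz => D.mapN_of_mem_closedE hz
    refine (convex_closedBall _ _).lipschitzOnWith_of_nnnorm_hasDerivWithin_le
      (f' := flowDeriv D.a (Real.exp D.μ))
      (fun z hz => (hasDerivAt_flow D.a_pos (Real.one_le_exp D.μ_pos.le)
        (D.re_pos hz)).hasDerivWithinAt) fun z hz => ?_
    exact norm_flowDeriv_le_one D.a_pos (Real.one_le_exp D.μ_pos.le) (D.re_pos hz).le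
  · refine lipschitzOnWith_of_eqOn ((lipschitzOnWith_refl (c := D.cI) D.rI_pos).mono ?_)
      fun z hz => D.mapN_of_notMem hz
    exact fun z hz => D.notMem_ballI (D.notMem_closedI hz)

/-- The part of the right half-plane which contains all image points. -/
def imageRegion : Set ℂ := {z : ℂ | 0 < z.re} ∩ Metric.closedBall 0 (D.radius + 1)

lemma convex_imageRegion : Convex ℝ D.imageRegion :=
  (convex_halfSpace_re_gt 0).inter (convex_closedBall _ _)

lemma mem_imageRegion {z : ℂ} (hz : z ∈ D.closedE) : z ∈ D.imageRegion :=
  ⟨D.re_pos hz, by rw [mem_closedBall_zero_iff]; linarith [D.norm_le_radius hz]⟩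

lemma mapN_mem (z : ℂ) : D.mapN z ∈ D.imageRegion := by
  by_cases h : z ∈ D.ballE
  · have h' := D.ballE_subset h
    rw [D.mapN_of_mem h]
    refine ⟨flow_re_pos D.a_pos (Real.one_le_exp D.μ_pos.le) (D.re_pos h'), ?_⟩
    rw [mem_closedBall_zero_iff]
    have := norm_flow_le D.a_pos (Real.one_le_exp D.μ_pos.le) (D.re_pos h').le
    linarith [D.norm_le_radius h', D.a_le_one]
  · rw [D.mapN_of_notMem h]
    exact D.mem_imageRegion (D.closedI_subset_closedE (D.reflI_mem (D.notMem_ballI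
      (D.notMem_closedI h))))

lemma foldI_mem (z : ℂ) : fold D.cI D.rI z ∈ D.imageRegion :=
  D.mem_imageRegion (D.closedI_subset_closedE (fold_mem_closedBall D.rI_pos z))

lemma foldE_mem (z : ℂ) : fold D.cE D.rE z ∈ D.imageRegion :=
  D.mem_imageRegion (fold_mem_closedBall D.rE_pos z)

/-- The image series of the configuration. -/
def series (F : ℂ → ℂ) (τ : ℝ) : ℂ → ℂ := imageSum F D.a D.μ τ

/-- The derivative of the image series. -/
def seriesDeriv (F : ℂ → ℂ) (τ : ℝ) : ℂ → ℂ := imageSumDeriv F D.a D.μ τ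

section series
variable {F : ℂ → ℂ} {τ : ℝ}

lemma hasDerivAt_series (hF : Differentiable ℂ F) (hτ : |τ| < 1) {z : ℂ} (hz : 0 < z.re) :
    HasDerivAt (D.series F τ) (D.seriesDeriv F τ z) z :=
  hasDerivAt_imageSum hF D.a_pos D.a_le_one D.μ_pos hτ hz

lemma exists_lipschitz_series (hF : Differentiable ℂ F) (hτ : |τ| < 1) :
    ∃ K : NNReal, LipschitzOnWith K (D.series F τ) D.imageRegion := by
  obtain ⟨A, hA⟩ := exists_derivBounds hF (D.radius + 1 + 1)
  refine ⟨Real.toNNReal (A / (1 - |τ|)),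
    D.convex_imageRegion.lipschitzOnWith_of_nnnorm_hasDerivWithin_le
      (f' := D.seriesDeriv F τ)
      (fun z hz => (D.hasDerivAt_series hF hτ hz.1).hasDerivWithinAt) fun z hz => ?_⟩
  refine NNReal.le_toNNReal_of_coe_le ?_
  exact norm_imageSumDeriv_le hA D.a_pos D.a_le_one D.μ_pos hτ (le_of_lt hz.1)
    (by simpa using hz.2)

lemma exists_lipschitz_series_comp (hF : Differentiable ℂ F) (hτ : |τ| < 1) {m : ℂ → ℂ}
    (hm : LipschitzWith 1 m) (hmem : ∀ z, m z ∈ D.imageRegion) :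
    ∃ K : NNReal, LipschitzWith K fun z => (D.series F τ (m z)).re := by
  obtain ⟨K, hK⟩ := D.exists_lipschitz_series hF hτ
  refine ⟨K, LipschitzWith.of_dist_le_mul fun z w => ?_⟩
  have h1 := hK.dist_le_mul _ (hmem z) _ (hmem w)
  have h2 := hm.dist_le_mul z w
  rw [NNReal.coe_one, one_mul] at h2
  calc dist (D.series F τ (m z)).re (D.series F τ (m w)).re
      ≤ dist (D.series F τ (m z)) (D.series F τ (m w)) := by
        rw [dist_eq_norm, dist_eq_norm, Real.norm_eq_abs, ← Complex.sub_re]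
        exact Complex.abs_re_le_norm _
    _ ≤ K * dist (m z) (m w) := h1
    _ ≤ K * dist z w := by gcongr

end series

/-- The transmission solution for the incident field `Re F`, up to an additive constant. -/
def solution (F : ℂ → ℂ) (τi τe : ℝ) (z : ℂ) : ℝ :=
  (F z).re + τe * (D.series F (τi * τe) (fold D.cE D.rE z)).re
    + τi * τe * (D.series F (τi * τe) (D.mapN z)).re
    - τi * (1 + τe) * (D.series F (τi * τe) (fold D.cI D.rI z)).re

section solution
variable {F : ℂ → ℂ} {τi τe : ℝ}

lemma boundedlyLipschitz_re (hF : Differentiable ℂ F) :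
    BoundedlyLipschitz fun z => (F z).re := by
  intro R
  obtain ⟨A, hA⟩ := exists_derivBounds hF R
  have := (convex_closedBall (0 : ℂ) R).lipschitzOnWith_of_nnnorm_hasDerivWithin_le
    (C := Real.toNNReal A) (fun z _ => (hF z).hasDerivAt.hasDerivWithinAt)
    (fun z hz => NNReal.le_toNNReal_of_coe_le (hA.deriv_le z (by simpa using hz)))
  refine ⟨Real.toNNReal A, LipschitzOnWith.of_dist_le_mul fun z hz w hw => ?_⟩
  refine le_trans ?_ (this.dist_le_mul z hz w hw)
  rw [dist_eq_norm, dist_eq_norm, Real.norm_eq_abs, ← Complex.sub_re]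
  exact Complex.abs_re_le_norm _

lemma boundedlyLipschitz_solution (hF : Differentiable ℂ F) (hτ : |τi * τe| < 1) :
    BoundedlyLipschitz (D.solution F τi τe) := by
  intro R
  obtain ⟨K₀, h₀⟩ := boundedlyLipschitz_re hF R
  obtain ⟨K₁, h₁⟩ := D.exists_lipschitz_series_comp hF hτ (lipschitzWith_fold D.rE_pos) D.foldE_mem
  obtain ⟨K₂, h₂⟩ := D.exists_lipschitz_series_comp hF hτ D.lipschitzWith_mapN D.mapN_mem
  obtain ⟨K₃, h₃⟩ := D.exists_lipschitz_series_comp hF hτ (lipschitzWith_fold D.rI_pos) D.foldI_mem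
  refine ⟨K₀ + Real.toNNReal |τe| * K₁ + Real.toNNReal |τi * τe| * K₂
    + Real.toNNReal |τi * (1 + τe)| * K₃, LipschitzOnWith.of_dist_le_mul fun z hz w hw => ?_⟩
  have g₀ := h₀.dist_le_mul z hz w hw
  have g₁ := h₁.dist_le_mul z w
  have g₂ := h₂.dist_le_mul z w
  have g₃ := h₃.dist_le_mul z w
  rw [Real.dist_eq] at g₀ g₁ g₂ g₃ ⊢
  push_cast
  rw [Real.coe_toNNReal _ (abs_nonneg _), Real.coe_toNNReal _ (abs_nonneg _),
    Real.coe_toNNReal _ (abs_nonneg _)]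
  simp only [solution]
  set d := dist z w
  set x₀ := (F z).re
  set y₀ := (F w).re
  set x₁ := (D.series F (τi * τe) (fold D.cE D.rE z)).re
  set y₁ := (D.series F (τi * τe) (fold D.cE D.rE w)).re
  set x₂ := (D.series F (τi * τe) (D.mapN z)).re
  set y₂ := (D.series F (τi * τe) (D.mapN w)).re
  set x₃ := (D.series F (τi * τe) (fold D.cI D.rI z)).re
  set y₃ := (D.series F (τi * τe) (fold D.cI D.rI w)).re
  have e : x₀ + τe * x₁ + τi * τe * x₂ - τi * (1 + τe) * x₃
      - (y₀ + τe * y₁ + τi * τe * y₂ - τi * (1 + τe) * y₃)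
      = (x₀ - y₀) + τe * (x₁ - y₁) + τi * τe * (x₂ - y₂) - τi * (1 + τe) * (x₃ - y₃) := by ring
  rw [e]
  refine (abs_sub _ _).trans ?_
  refine (add_le_add_left (abs_add_three _ _ _) _).trans ?_
  rw [abs_mul, abs_mul (τi * τe), abs_mul (τi * (1 + τe))]
  have i₁ := mul_le_mul_of_nonneg_left g₁ (abs_nonneg τe)
  have i₂ := mul_le_mul_of_nonneg_left g₂ (abs_nonneg (τi * τe))
  have i₃ := mul_le_mul_of_nonneg_left g₃ (abs_nonneg (τi * (1 + τe)))
  nlinarith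

/-- The functional equation replaces `F + τ T ∘ flow` by `T`, and the remaining coefficients factor.
-/
lemma solution_core (hF : Differentiable ℂ F) (hτ : |τi * τe| < 1) {z : ℂ} (hz : z ∈ D.ballI) :
    D.solution F τi τe z = (1 - τi) * (1 + τe) * (D.series F (τi * τe) z).re := by
  have hE := D.closedI_subset_ballE (D.ballI_subset hz)
  have h := congrArg Complex.re (imageSum_eq hF D.a_pos D.a_le_one D.μ_pos hτ
    (D.re_pos (D.ballE_subset hE)))
  rw [Complex.add_re, Complex.re_ofReal_mul] at h
  rw [solution, fold_of_mem hE, fold_of_mem hz, D.mapN_of_mem hE]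
  simp only [series]
  linear_combination -h

lemma solution_shell (hF : Differentiable ℂ F) (hτ : |τi * τe| < 1) {z : ℂ} (hz : z ∈ D.ballE)
    (hz' : z ∉ D.ballI) :
    D.solution F τi τe z = (1 + τe) * ((D.series F (τi * τe) z).re
      - τi * (D.series F (τi * τe) (D.reflI z)).re) := by
  have h := congrArg Complex.re (imageSum_eq hF D.a_pos D.a_le_one D.μ_pos hτ
    (D.re_pos (D.ballE_subset hz)))
  rw [Complex.add_re, Complex.re_ofReal_mul] at h
  rw [solution, fold_of_mem hz, fold_of_notMem hz', D.mapN_of_mem hz]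
  simp only [series, reflI]
  linear_combination -h

lemma solution_exterior {z : ℂ} (hz : z ∉ D.ballE) :
    D.solution F τi τe z = (F z).re + τe * (D.series F (τi * τe) (D.reflE z)).re
      - τi * (D.series F (τi * τe) (D.reflI z)).re := by
  rw [solution, fold_of_notMem hz, fold_of_notMem (D.notMem_ballI (D.notMem_closedI hz)),
    D.mapN_of_notMem hz]
  simp only [reflI, reflE]
  ring

/-- The gradient of `Re (f ∘ reflI)`, if `f'` is the derivative of `f`. -/
def pullI (f' : ℂ → ℂ) (z : ℂ) : ℂ := f' (D.reflI z) * reflDeriv D.cI D.rI z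

/-- The gradient of `Re (f ∘ reflE)`, if `f'` is the derivative of `f`. -/
def pullE (f' : ℂ → ℂ) (z : ℂ) : ℂ := f' (D.reflE z) * reflDeriv D.cE D.rE z

lemma norm_pullI_le {f' : ℂ → ℂ} {z : ℂ} (hz : z ∉ D.ballI) :
    ‖D.pullI f' z‖ ≤ ‖f' (D.reflI z)‖ := by
  rw [pullI, norm_mul]
  exact mul_le_of_le_one_right (norm_nonneg _) (norm_reflDeriv_le D.rI_pos hz)

lemma norm_pullE_le {f' : ℂ → ℂ} {z : ℂ} (hz : z ∉ D.ballE) :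
    ‖D.pullE f' z‖ ≤ ‖f' (D.reflE z)‖ := by
  rw [pullE, norm_mul]
  exact mul_le_of_le_one_right (norm_nonneg _) (norm_reflDeriv_le D.rE_pos hz)

lemma hasGradientAt_pullI {f f' : ℂ → ℂ} (hf : ∀ z : ℂ, 0 < z.re → HasDerivAt f (f' z) z) {z : ℂ}
    (hz : z ∉ D.ballI) :
    HasGradientAt (fun z => (f (D.reflI z)).re) (D.pullI f' z) z :=
  hasGradientAt_re_refl (conj_sub_ne_zero D.rI_pos hz)
    (hf _ (D.re_pos (D.closedI_subset_closedE (D.reflI_mem hz))))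

lemma hasGradientAt_pullE {f f' : ℂ → ℂ} (hf : ∀ z : ℂ, 0 < z.re → HasDerivAt f (f' z) z) {z : ℂ}
    (hz : z ∉ D.ballE) :
    HasGradientAt (fun z => (f (D.reflE z)).re) (D.pullE f' z) z :=
  hasGradientAt_re_refl (conj_sub_ne_zero D.rE_pos hz) (hf _ (D.re_pos (D.reflE_mem hz)))

lemma hasGradientAt_solution_core (hF : Differentiable ℂ F) (hτ : |τi * τe| < 1) {z : ℂ}
    (hz : z ∈ D.ballI) :
    HasGradientAt (D.solution F τi τe)
      (((1 - τi) * (1 + τe) : ℝ) * (starRingEnd ℂ) (D.seriesDeriv F (τi * τe) z)) z := by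
  have h := hasGradientAt_const_mul ((1 - τi) * (1 + τe)) (hasGradientAt_re
    (D.hasDerivAt_series hF hτ (D.re_pos (D.closedI_subset_closedE (D.ballI_subset hz)))))
  refine h.congr_of_eventuallyEq ?_
  filter_upwards [Metric.isOpen_ball.mem_nhds hz] with y hy
  exact D.solution_core hF hτ hy

lemma hasGradientAt_solution_shell (hF : Differentiable ℂ F) (hτ : |τi * τe| < 1) {z : ℂ}
    (hz : z ∈ D.ballE) (hz' : z ∉ D.closedI) :
    HasGradientAt (D.solution F τi τe)
      ((1 + τe : ℝ) * ((starRingEnd ℂ) (D.seriesDeriv F (τi * τe) z)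
        - τi * D.pullI (D.seriesDeriv F (τi * τe)) z)) z := by
  have h1 := hasGradientAt_re (D.hasDerivAt_series hF hτ (D.re_pos (D.ballE_subset hz)))
  have h2 := hasGradientAt_const_mul τi (D.hasGradientAt_pullI
    (fun z hz => D.hasDerivAt_series hF hτ hz) (D.notMem_ballI hz'))
  refine (hasGradientAt_const_mul (1 + τe) (hasGradientAt_sub h1 h2)).congr_of_eventuallyEq ?_
  filter_upwards [Metric.isOpen_ball.mem_nhds hz,
    Metric.isClosed_closedBall.isOpen_compl.mem_nhds hz'] with y hy hy'
  exact D.solution_shell hF hτ hy (D.notMem_ballI hy')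

lemma hasGradientAt_solution_exterior (hF : Differentiable ℂ F) (hτ : |τi * τe| < 1) {z : ℂ}
    (hz : z ∉ D.closedE) :
    HasGradientAt (D.solution F τi τe)
      ((starRingEnd ℂ) (deriv F z) + τe * D.pullE (D.seriesDeriv F (τi * τe)) z
        - τi * D.pullI (D.seriesDeriv F (τi * τe)) z) z := by
  have h0 := hasGradientAt_re (hF z).hasDerivAt
  have h1 := hasGradientAt_const_mul τe (D.hasGradientAt_pullE
    (fun z hz => D.hasDerivAt_series hF hτ hz) (D.notMem_ballE hz))
  have h2 := hasGradientAt_const_mul τi (D.hasGradientAt_pullI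
    (fun z hz => D.hasDerivAt_series hF hτ hz)
    (D.notMem_ballI (D.notMem_closedI (D.notMem_ballE hz))))
  refine (hasGradientAt_sub (hasGradientAt_add h0 h1) h2).congr_of_eventuallyEq ?_
  filter_upwards [Metric.isClosed_closedBall.isOpen_compl.mem_nhds hz] with y hy
  exact D.solution_exterior (D.notMem_ballE hy)

/-- The limit of `solution - Re F` at infinity. -/
def limitAtInfinity (F : ℂ → ℂ) (τi τe : ℝ) : ℝ :=
  τe * (D.series F (τi * τe) D.cE).re - τi * (D.series F (τi * τe) D.cI).re

/-- The reflection sends infinity to the center at the rate `r² / ‖z - c‖`. For `‖z‖ ≥ 2|c| + 2r`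
this is at most `2r² / ‖z‖`. -/
lemma exists_refl_decay {f : ℂ → ℂ} {c r : ℝ} {K : NNReal} {S : Set ℂ}
    (hf : LipschitzOnWith K f S) (hr : 0 < r) (hS : Metric.closedBall (c : ℂ) r ⊆ S) :
    (fun z => (f (refl c r z)).re - (f c).re) =O[Bornology.cobounded ℂ] fun z => ‖z‖⁻¹ := by
  refine Asymptotics.IsBigO.of_bound (K * (2 * r ^ 2)) ?_
  have hev : ∀ᶠ z : ℂ in Bornology.cobounded ℂ, 2 * |c| + 2 * r ≤ ‖z‖ := by
    rw [← comap_norm_atTop]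
    exact Filter.tendsto_comap.eventually (Filter.eventually_ge_atTop _)
  filter_upwards [hev] with z hz
  have h1 : ‖z‖ / 2 + r ≤ ‖z - c‖ := by
    have h := norm_sub_norm_le z c
    rw [Complex.norm_real, Real.norm_eq_abs] at h
    linarith
  have h0 := norm_nonneg z
  have hz0 : z ∉ Metric.ball (c : ℂ) r := by
    rw [Metric.mem_ball, dist_eq_norm, not_lt]; linarith
  have hz1 : 0 < ‖z‖ := by have := abs_nonneg c; linarith
  have h2 := hf.dist_le_mul _ (hS (refl_mem_closedBall hr hz0)) _
    (hS (Metric.mem_closedBall_self hr.le))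
  rw [dist_eq_norm, dist_eq_norm, norm_refl_sub] at h2
  rw [← Complex.sub_re, Real.norm_eq_abs, norm_inv, norm_norm]
  refine (Complex.abs_re_le_norm _).trans (h2.trans ?_)
  rw [mul_assoc]
  gcongr
  rw [← div_eq_mul_inv, div_le_div_iff₀ (by linarith) hz1]
  nlinarith [sq_nonneg r]

lemma solution_decay (hF : Differentiable ℂ F) (hτ : |τi * τe| < 1) :
    (fun z => D.solution F τi τe z - D.limitAtInfinity F τi τe - (F z).re)
      =O[Bornology.cobounded ℂ] fun z => ‖z‖⁻¹ := by
  obtain ⟨K, hK⟩ := D.exists_lipschitz_series hF hτ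
  have hE := (exists_refl_decay hK D.rE_pos fun z hz => D.mem_imageRegion hz).const_mul_left τe
  have hI := (exists_refl_decay hK D.rI_pos
    fun z hz => D.mem_imageRegion (D.closedI_subset_closedE hz)).const_mul_left τi
  refine (hE.sub hI).congr' ?_ Filter.EventuallyEq.rfl
  have hev : ∀ᶠ z : ℂ in Bornology.cobounded ℂ, z ∉ D.closedE :=
    Metric.isBounded_closedBall
  filter_upwards [hev] with z hz
  rw [D.solution_exterior (D.notMem_ballE hz), limitAtInfinity]
  simp only [reflE, reflI]
  ring

end solution

section rotate
variable {F : ℂ → ℂ} {τ : ℝ}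

lemma seriesDeriv_const_mul (hF : Differentiable ℂ F) (b : ℂ) (z : ℂ) :
    D.seriesDeriv (fun z => b * F z) τ z = b * D.seriesDeriv F τ z := by
  rw [seriesDeriv, seriesDeriv, imageSumDeriv, imageSumDeriv, ← tsum_mul_left]
  refine tsum_congr fun n => ?_
  rw [imageTerm, imageTerm, deriv_const_mul _ (hF _)]
  ring

end rotate

open Classical in
/-- A piecewise constant function. -/
def piecewise (kI kE k : ℝ) (z : ℂ) : ℝ :=
  if z ∈ D.ballI then kI else if z ∈ D.ballE then kE else k

lemma ae_off_circles : ∀ᵐ z : ℂ, ‖z - D.cI‖ ≠ D.rI ∧ ‖z - D.cE‖ ≠ D.rE := by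
  have h1 : ∀ (c : ℂ) {r : ℝ}, ∀ᵐ z : ℂ, ‖z - c‖ ≠ r := fun c r => by
    have : volume (Metric.sphere c r) = 0 := Measure.addHaar_sphere _ _ _
    rw [ae_iff]
    convert! this using 2
    ext z
    simp
  filter_upwards [h1 D.cI, h1 D.cE] with z h2 h3 using ⟨h2, h3⟩

lemma trichotomy {z : ℂ} (hI : ‖z - D.cI‖ ≠ D.rI) (hE : ‖z - D.cE‖ ≠ D.rE) :
    z ∈ D.ballI ∨ (z ∈ D.ballE ∧ z ∉ D.closedI) ∨ z ∉ D.closedE := by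
  simp only [ballI, ballE, closedI, closedE, Metric.mem_ball, Metric.mem_closedBall, dist_eq_norm,
    not_le]
  rcases lt_or_gt_of_ne hI with h | h
  · exact Or.inl h
  · rcases lt_or_gt_of_ne hE with h' | h'
    · exact Or.inr (Or.inl ⟨h', h⟩)
    · exact Or.inr (Or.inr h')

/-- The harmonic conjugate of the solution is, up to the factor `σ`, the solution with the opposite
contrasts for the conjugate incident field. -/
lemma gradient_conjugate {F : ℂ → ℂ} (hF : Differentiable ℂ F) {kI kE : ℝ} (hkI : 0 < kI)
    (hkE : 0 < kE) (hτ : |tauI kI kE * tauE kE| < 1) :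
    ∀ᵐ z, gradient (D.solution (fun z => -Complex.I * F z) (-tauI kI kE) (-tauE kE)) z
      = Complex.I * (D.piecewise kI kE 1 z * gradient (D.solution F (tauI kI kE) (tauE kE)) z) := by
  set τi := tauI kI kE with hτi
  set τe := tauE kE with hτe
  -- The definitions of the contrasts in the form of flux relations. Changing the sign of both
  -- contrasts multiplies the coefficients of the solution by `kI` in the core and by `kE` in the
  -- shell, and keeps `τ`.
  have e1 : kE * (1 + τe) = 1 - τe := by
    rw [hτe, tauE]; field_simp; ring
  have e2 : kI * (1 - τi) = kE * (1 + τi) := by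
    rw [hτi, tauI]; field_simp; ring
  have hF' : Differentiable ℂ fun z => -Complex.I * F z := hF.const_mul _
  have hττ : -τi * -τe = τi * τe := by ring
  have hτ' : |(-τi) * (-τe)| < 1 := by rwa [hττ]
  filter_upwards [D.ae_off_circles] with z ⟨hzI, hzE⟩
  rcases D.trichotomy hzI hzE with h | ⟨h, h'⟩ | h
  · rw [(D.hasGradientAt_solution_core hF' hτ' h).gradient,
      (D.hasGradientAt_solution_core hF hτ h).gradient, piecewise, if_pos h, hττ,
      D.seriesDeriv_const_mul hF, map_mul, map_neg, Complex.conj_I]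
    have e3 : ((1 - -τi) * (1 + -τe)) = kI * ((1 - τi) * (1 + τe)) := by
      linear_combination -(1 + τe) * e2 - (1 + τi) * e1
    rw [e3]
    push_cast
    ring
  · rw [(D.hasGradientAt_solution_shell hF' hτ' h h').gradient,
      (D.hasGradientAt_solution_shell hF hτ h h').gradient, piecewise,
      if_neg (D.notMem_ballI h'), if_pos h, hττ, pullI, pullI,
      D.seriesDeriv_const_mul hF, D.seriesDeriv_const_mul hF, map_mul, map_neg, Complex.conj_I]
    have e3 : (1 + -τe) = kE * (1 + τe) := by linarith
    rw [e3]
    push_cast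
    ring
  · have h1 := D.notMem_ballE h
    rw [(D.hasGradientAt_solution_exterior hF' hτ' h).gradient,
      (D.hasGradientAt_solution_exterior hF hτ h).gradient, piecewise,
      if_neg (D.notMem_ballI (D.notMem_closedI h1)), if_neg h1, hττ, pullI, pullI, pullE, pullE,
      D.seriesDeriv_const_mul hF, D.seriesDeriv_const_mul hF, deriv_const_mul _ (hF _), map_mul,
      map_neg, Complex.conj_I]
    push_cast
    ring

end NestedCircles

/-! ## The geometry for small distances -/

/-- Here `c = √(r² + a²)`, so the logarithm is `arsinh (a / r)`, and the claim is `x - x² ≤ arsinh x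
≤ x` for `x = a / r`. -/
lemma log_bounds {r a c : ℝ} (hr : 0 < r) (ha : 0 < a) (hc : 0 < c) (h : c ^ 2 = r ^ 2 + a ^ 2) :
    a / r - (a / r) ^ 2 ≤ Real.log ((c + a) / r) ∧ Real.log ((c + a) / r) ≤ a / r := by
  have hx : 0 < a / r := by positivity
  constructor
  · have h1 : 1 + a / r ≤ (c + a) / r := by
      rw [le_div_iff₀ hr, add_mul, div_mul_cancel₀ _ hr.ne']
      nlinarith
    have h2 := Real.one_sub_inv_le_log_of_pos (x := 1 + a / r) (by positivity)
    have h3 := Real.log_le_log (by positivity) h1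
    have h4 : a / r - (a / r) ^ 2 ≤ 1 - (1 + a / r)⁻¹ := by
      have : 1 - (1 + a / r)⁻¹ - (a / r - (a / r) ^ 2) = (a / r) ^ 3 * (1 + a / r)⁻¹ := by
        field_simp; ring
      have h5 : 0 ≤ (a / r) ^ 3 * (1 + a / r)⁻¹ := by positivity
      linarith
    linarith
  · rw [Real.log_le_iff_le_exp (by positivity)]
    have h1 := Real.quadratic_le_exp_of_nonneg hx.le
    refine le_trans ?_ h1
    rw [div_le_iff₀ hr]
    have h2 : (1 + a / r + (a / r) ^ 2 / 2) * r = r + a + a ^ 2 / (2 * r) := by field_simp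
    rw [h2]
    have h3 : c ≤ r + a ^ 2 / (2 * r) := by
      refine abs_le_of_sq_le_sq' ?_ (by positivity) |>.2
      rw [h]
      have : (r + a ^ 2 / (2 * r)) ^ 2 = r ^ 2 + a ^ 2 + (a ^ 2 / (2 * r)) ^ 2 := by
        field_simp; ring
      rw [this]
      nlinarith [sq_nonneg (a ^ 2 / (2 * r))]
    linarith

section geometry
variable {rI rE ε : ℝ}

lemma alpha_pos (hrI : 0 < rI) (hε : 0 < ε) (hε' : ε < rE - rI) :
    0 < alpha rI rE ε := by
  have h1 : 0 < 2 * rE - ε := by linarith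
  have h2 : 0 < 2 * rE - 2 * rI - ε := by linarith
  have h3 : 0 < rE - rI - ε := by linarith
  rw [alpha]
  exact div_pos (Real.sqrt_pos.2 (by positivity)) (by linarith)

lemma alpha_sq (hrI : 0 < rI) (hε : 0 < ε) (hε' : ε < rE - rI) :
    alpha rI rE ε ^ 2
      = ε * (2 * rI + ε) * (2 * rE - ε) * (2 * rE - 2 * rI - ε) / (2 * (rE - rI - ε)) ^ 2 := by
  have h1 : 0 < 2 * rE - ε := by linarith
  have h2 : 0 < 2 * rE - 2 * rI - ε := by linarith
  rw [alpha, div_pow, Real.sq_sqrt (by positivity)]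

lemma cI_pos (hrI : 0 < rI) (hε : 0 < ε) (hε' : ε < rE - rI) :
    0 < cI rI rE ε := by
  have h3 : 0 < rE - rI - ε := by linarith
  rw [cI]
  refine div_pos ?_ (by linarith)
  nlinarith

lemma cI_sq (hrI : 0 < rI) (hε : 0 < ε) (hε' : ε < rE - rI) :
    cI rI rE ε ^ 2 = rI ^ 2 + alpha rI rE ε ^ 2 := by
  have h3 : rE - rI - ε ≠ 0 := by linarith
  rw [alpha_sq hrI hε hε', cI]
  field_simp
  ring

lemma cE_sq (hrI : 0 < rI) (hε : 0 < ε) (hε' : ε < rE - rI) :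
    cE rI rE ε ^ 2 = rE ^ 2 + alpha rI rE ε ^ 2 := by
  have h3 : rE - rI - ε ≠ 0 := by linarith
  rw [alpha_sq hrI hε hε', cE, cI]
  field_simp
  ring

lemma rStar_sq (hrI : 0 < rI) (hrE : rI < rE) : rStar rI rE ^ 2 = 2 * rI * rE / (rE - rI) := by
  have h1 : 0 < rE := hrI.trans hrE
  have h2 : 0 < rE - rI := sub_pos.2 hrE
  rw [rStar, Real.sq_sqrt (by positivity)]

lemma rStar_pos (hrI : 0 < rI) (hrE : rI < rE) : 0 < rStar rI rE := by
  have h1 : 0 < rE := hrI.trans hrE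
  have h2 : 0 < rE - rI := sub_pos.2 hrE
  rw [rStar]
  exact Real.sqrt_pos.2 (by positivity)

/-- With `δ = rE - rI` there is an exact expansion `α² = ε (r_*² + ε Q / (2(δ - ε))²)`. For `ε ≤ δ /
2` the numerator `Q` is nonnegative and bounded, and the denominator is at least `δ²`. -/
lemma alpha_sq_bounds (hrI : 0 < rI) (hrE : rI < rE) (hε : 0 < ε) (hε' : ε ≤ (rE - rI) / 2) :
    ε * rStar rI rE ^ 2 ≤ alpha rI rE ε ^ 2 ∧ alpha rI rE ε ^ 2 ≤ ε * (rStar rI rE ^ 2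
      + ε * ((12 * rI * rE + 4 * (rE - rI) ^ 2) / (rE - rI) ^ 2)) := by
  have h1 : 0 < rE := hrI.trans hrE
  have hδ : 0 < rE - rI := sub_pos.2 hrE
  rw [alpha_sq hrI hε (by linarith), rStar_sq hrI hrE]
  set δ := rE - rI with hδdef
  have hrEδ : rE = rI + δ := by rw [hδdef]; ring
  have hd : 0 < δ - ε := by linarith
  have hp : 0 < rI * rE := by positivity
  set Q := 12 * rI * rE + (2 * δ - ε) ^ 2 - 8 * rI * rE * (ε / δ) with hQ
  have hεδ : ε / δ ≤ 1 / 2 := by rw [div_le_iff₀ hδ]; linarith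
  have hεδ0 : 0 ≤ ε / δ := by positivity
  have hQ0 : 0 ≤ Q := by
    have := mul_le_mul_of_nonneg_left hεδ hp.le
    nlinarith [sq_nonneg (2 * δ - ε)]
  have hQ1 : Q ≤ 12 * rI * rE + 4 * δ ^ 2 := by
    have := mul_nonneg hp.le hεδ0
    nlinarith
  have e : ε * (2 * rI + ε) * (2 * rE - ε) * (2 * rE - 2 * rI - ε) / (2 * (δ - ε)) ^ 2
      = ε * (2 * rI * rE / δ + ε * (Q / (2 * (δ - ε)) ^ 2)) := by
    rw [hQ, hrEδ]
    field_simp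
    ring
  rw [e]
  constructor
  · have : 0 ≤ ε * (Q / (2 * (δ - ε)) ^ 2) := by positivity
    gcongr
    linarith
  · gcongr
    linarith

lemma exp_xi {c a r : ℝ} (hr : 0 < r) (hc : 0 < c + a) :
    Real.log |c + a| - Real.log r = Real.log ((c + a) / r) := by
  rw [abs_of_pos hc, Real.log_div hc.ne' hr.ne']

lemma cE_pos (hrI : 0 < rI) (hε : 0 < ε) (hε' : ε < rE - rI) :
    0 < cE rI rE ε := by
  have := cI_pos hrI hε hε'
  rw [cE]; linarith

lemma exp_two_xiI (hrI : 0 < rI) (hε : 0 < ε) (hε' : ε < rE - rI) :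
    Real.exp (2 * xiI rI rE ε) * (cI rI rE ε - alpha rI rE ε) = cI rI rE ε + alpha rI rE ε := by
  have ha := alpha_pos hrI hε hε'
  have hc := cI_pos hrI hε hε'
  have hs := cI_sq hrI hε hε'
  rw [xiI, exp_xi hrI (by positivity), ← Nat.cast_two, Real.exp_nat_mul,
    Real.exp_log (by positivity)]
  field_simp
  linear_combination hs

lemma exp_two_xiE (hrI : 0 < rI) (hrE : rI < rE) (hε : 0 < ε) (hε' : ε < rE - rI) :
    Real.exp (2 * xiE rI rE ε) * (cE rI rE ε - alpha rI rE ε) = cE rI rE ε + alpha rI rE ε := by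
  have ha := alpha_pos hrI hε hε'
  have hc := cE_pos hrI hε hε'
  have hs := cE_sq hrI hε hε'
  have hr : 0 < rE := hrI.trans hrE
  rw [xiE, exp_xi hr (by positivity), ← Nat.cast_two, Real.exp_nat_mul,
    Real.exp_log (by positivity)]
  field_simp
  linear_combination hs

/-- `D` is the configuration of the theorem, and the parameters satisfy the asymptotic relations
for small `ε` with constant `K`. -/
structure IsModel (K rI rE ε : ℝ) (D : NestedCircles) : Prop where
  a_eq : D.a = alpha rI rE ε
  rI_eq : D.rI = rI
  rE_eq : D.rE = rE
  cI_eq : D.cI = cI rI rE ε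
  cE_eq : D.cE = cE rI rE ε
  near : NearlyTouching K (rStar rI rE ^ 2) D.a D.μ
  beta_ratio : |rStar rI rE * D.μ / (4 * Real.sqrt ε) - 1| ≤ K * D.a
  scale_ratio : |rStar rI rE * D.a / Real.sqrt ε - rStar rI rE ^ 2| ≤ K * D.a
  radius_le : D.radius ≤ 2 * rE + 1
  expI : Real.exp (2 * xiI rI rE ε) * (D.cI - D.a) = D.cI + D.a
  expE : Real.exp (2 * xiE rI rE ε) * (D.cE - D.a) = D.cE + D.a

set_option maxHeartbeats 1000000 in
-- Two expansions give all the relations: `ξᵢ - ξₑ = a (1 / rI - 1 / rE) + O(a²)`, where `1 / rI - 1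
-- / rE = 2 / r_*²`, so that `μ ≈ 4a / r_*²`; and `a ≈ r_* √ε`.
lemma exists_isModel (hrI : 0 < rI) (hrE : rI < rE) :
    ∃ ε₀ K : ℝ, 0 < ε₀ ∧ ε₀ ≤ rE - rI ∧ 0 ≤ K ∧
      ∀ ε, 0 < ε → ε < ε₀ → ∃ D, IsModel K rI rE ε D := by
  have hrE0 : 0 < rE := hrI.trans hrE
  have hδ : 0 < rE - rI := sub_pos.2 hrE
  have hs := rStar_pos hrI hrE
  have hρ := rStar_sq hrI hrE
  set s := rStar rI rE with hsdef
  set ρ := s ^ 2 with hρdef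
  have hρ0 : 0 < ρ := by positivity
  set C := (12 * rI * rE + 4 * (rE - rI) ^ 2) / (rE - rI) ^ 2 with hC
  have hC0 : 0 ≤ C := by positivity
  set K₁ := ρ / 2 * ((1 / rI) ^ 2 + (1 / rE) ^ 2) with hK₁
  have hK₁0 : 0 ≤ K₁ := by positivity
  set K₂ := C / ρ ^ 2 with hK₂
  have hK₂0 : 0 ≤ K₂ := by positivity
  -- One constant for all relations: `K₁` bounds the ratio of `μ` to `4a / ρ`, `K₁ (1 + K₂) + K₂`
  -- the error in `β`, `ρ K₂` the error in the scale, and `6 / ρ`, `ρ / 2` make `a` and `μ`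
  -- comparable.
  set K := K₁ * (1 + K₂) + K₂ + ρ * K₂ + 6 / ρ + ρ / 2 with hK
  have hK0 : 0 < K := by positivity
  have hK₁K : K₁ ≤ K := by
    have h1 : 0 ≤ K₁ * K₂ := by positivity
    have h2 : 0 ≤ ρ * K₂ := by positivity
    have h3 : 0 ≤ 6 / ρ := by positivity
    rw [hK]; linarith [h1, h2, h3, hρ0, hK₂0]
  -- The bound `a ≤ t` gives `a ≤ 1` and `K a ≤ 1 / 2`. It follows from `a² ≤ ε M ≤ t²`, which fixes
  -- the threshold for `ε`.
  set t := min 1 (1 / (2 * K)) with ht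
  have ht0 : 0 < t := lt_min one_pos (by positivity)
  set M := ρ + (rE - rI) * C with hM
  have hM0 : 0 < M := by positivity
  refine ⟨min ((rE - rI) / 2) (t ^ 2 / M), K, lt_min (by positivity) (by positivity),
    (min_le_left _ _).trans (by linarith), hK0.le, fun ε hε hε₀ => ?_⟩
  have hε1 : ε ≤ (rE - rI) / 2 := (hε₀.trans_le (min_le_left _ _)).le
  have hε2 : ε * M ≤ t ^ 2 := by
    have := (hε₀.trans_le (min_le_right _ _)).le
    rwa [le_div_iff₀ hM0] at this
  have hε' : ε < rE - rI := by linarith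
  have ha := alpha_pos hrI hε hε'
  obtain ⟨hlow, hupp⟩ := alpha_sq_bounds hrI hrE hε hε1
  have hcI := cI_pos hrI hε hε'
  have hcE := cE_pos hrI hε hε'
  have hI := cI_sq hrI hε hε'
  have hE := cE_sq hrI hε hε'
  have eI := exp_two_xiI hrI hε hε'
  have eE := exp_two_xiE hrI hrE hε hε'
  have hcc : cE rI rE ε = cI rI rE ε + (rE - rI - ε) := by rw [cE]; ring
  have hxiI : xiI rI rE ε = Real.log ((cI rI rE ε + alpha rI rE ε) / rI) :=
    exp_xi hrI (by positivity)
  have hxiE : xiE rI rE ε = Real.log ((cE rI rE ε + alpha rI rE ε) / rE) :=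
    exp_xi hrE0 (by positivity)
  have bI := log_bounds hrI ha hcI hI
  have bE := log_bounds hrE0 ha hcE hE
  rw [← hxiI] at bI
  rw [← hxiE] at bE
  set a := alpha rI rE ε
  set ξI := xiI rI rE ε
  set ξE := xiE rI rE ε
  set p := cI rI rE ε
  set q := cE rI rE ε
  have hat : a ≤ t := by
    refine abs_le_of_sq_le_sq' ?_ ht0.le |>.2
    refine hupp.trans (le_trans ?_ hε2)
    rw [hM]
    gcongr
  have ha1 : a ≤ 1 := hat.trans (min_le_left _ _)
  have hKa : K * a ≤ 1 / 2 := by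
    have : a ≤ 1 / (2 * K) := hat.trans (min_le_right _ _)
    rw [le_div_iff₀ (by positivity)] at this
    linarith
  have hpa : a < p := (pow_lt_pow_iff_left₀ ha.le hcI.le two_ne_zero).1
    (by rw [hI]; linarith [pow_pos hrI 2])
  have hqa : a < q := (pow_lt_pow_iff_left₀ ha.le hcE.le two_ne_zero).1
    (by rw [hE]; linarith [pow_pos hrE0 2])
  have hexp : Real.exp (2 * (ξI - ξE)) * ((p - a) * (q + a)) = (p + a) * (q - a) := by
    have : Real.exp (2 * (ξI - ξE)) * Real.exp (2 * ξE) = Real.exp (2 * ξI) := by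
      rw [← Real.exp_add]; ring_nf
    rw [← eE, ← eI, ← this]; ring
  have hμ0 : 0 < 2 * (ξI - ξE) := by
    rw [← Real.one_lt_exp_iff]
    have h1 : 0 < (p - a) * (q + a) := mul_pos (by linarith) (by linarith)
    have h2 : (p - a) * (q + a) < (p + a) * (q - a) := by
      have h3 : 0 < a * (q - p) := mul_pos ha (by linarith)
      linarith [h3]
    rw [← hexp] at h2
    by_contra h
    exact (mul_le_of_le_one_left h1.le (not_lt.1 h)).not_gt h2
  set μ := 2 * (ξI - ξE) with hμ
  have hratio : |μ * ρ / (4 * a) - 1| ≤ K₁ * a := by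
    -- The linear parts of `ξI` and `ξE` contribute exactly `1`; only the quadratic errors of
    -- `log_bounds` remain.
    have e1 : μ * ρ / (4 * a) - 1 = ρ / (2 * a) * ((ξI - a / rI) - (ξE - a / rE)) := by
      have : ρ / (2 * a) * (a / rI - a / rE) = 1 := by
        rw [hρ]; field_simp
      rw [hμ]
      linear_combination this + (by field_simp; ring : 2 * (ξI - ξE) * ρ / (4 * a)
        = ρ / (2 * a) * (ξI - ξE))
    have e2 : |(ξI - a / rI) - (ξE - a / rE)| ≤ (a / rI) ^ 2 + (a / rE) ^ 2 := by
      have p1 := sq_nonneg (a / rI)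
      have p2 := sq_nonneg (a / rE)
      rw [abs_le]; constructor <;> linarith [bI.1, bI.2, bE.1, bE.2]
    rw [e1, abs_mul, abs_of_pos (by positivity)]
    calc ρ / (2 * a) * |(ξI - a / rI) - (ξE - a / rE)|
        ≤ ρ / (2 * a) * ((a / rI) ^ 2 + (a / rE) ^ 2) := by gcongr
      _ = K₁ * a := by rw [hK₁]; field_simp
  have hsε : 0 < Real.sqrt ε := Real.sqrt_pos.2 hε
  have hsq : Real.sqrt ε ^ 2 = ε := Real.sq_sqrt hε.le
  have hR2 : |a / (s * Real.sqrt ε) - 1| ≤ K₂ * a := by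
    set x := a / (s * Real.sqrt ε) with hx
    have hx0 : 0 < x := by positivity
    have hx2 : x ^ 2 = a ^ 2 / (ρ * ε) := by rw [hx, div_pow, mul_pow, hsq]
    have hx1 : 1 ≤ x ^ 2 := by rw [hx2, le_div_iff₀ (by positivity)]; linarith
    have hx3 : x ^ 2 ≤ 1 + K₂ * a := by
      rw [hx2, div_le_iff₀ (by positivity)]
      have h1 : ε * ρ ≤ a := hlow.trans (by rw [sq]; exact mul_le_of_le_one_left ha.le ha1)
      have h2 : ε * C ≤ ρ * K₂ * a := by
        have : ρ * K₂ = C / ρ := by rw [hK₂]; field_simp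
        rw [this, div_mul_eq_mul_div, le_div_iff₀ hρ0]
        have h3 := mul_le_mul_of_nonneg_left h1 hC0
        linarith [h3]
      have h4 := mul_le_mul_of_nonneg_left h2 hε.le
      linarith [h4, hupp]
    have hx4 : 1 ≤ x := (pow_le_pow_iff_left₀ zero_le_one hx0.le two_ne_zero).1
      (by rw [one_pow]; exact hx1)
    rw [abs_of_nonneg (by linarith)]
    have hx5 := mul_le_mul_of_nonneg_left hx4 hx0.le
    linarith [hx5, hx3, sq x]
  have hK₂a : K₂ * a ≤ K₂ := mul_le_of_le_one_right hK₂0 ha1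
  have hK₁a : K₁ * a ≤ K * a := mul_le_mul_of_nonneg_right hK₁K ha.le
  refine ⟨⟨a, μ, p, rI, q, rE, ha, ha1, hμ0, hrI, hrE0, hcI, by linarith, hI, hE,
    by linarith, hexp⟩, rfl, rfl, rfl, rfl, rfl, ⟨ha, ha1, hKa, hμ0, ?_, ?_,
      hratio.trans (by gcongr)⟩, ?_, ?_, ?_, eI, eE⟩
  · have h1 := (abs_le.1 hratio).2
    have h2 : μ * ρ / (4 * a) ≤ 3 / 2 := by linarith
    rw [div_le_iff₀ (by positivity)] at h2
    have h3 : μ ≤ 6 / ρ * a := by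
      rw [div_mul_eq_mul_div, le_div_iff₀ hρ0]; linarith
    refine h3.trans ?_
    have : 6 / ρ ≤ K := by
      have : 0 ≤ K₁ * (1 + K₂) := by positivity
      have : 0 ≤ ρ * K₂ := by positivity
      rw [hK]; linarith
    gcongr
  · have h1 := (abs_le.1 hratio).1
    have h2 : 1 / 2 ≤ μ * ρ / (4 * a) := by linarith
    rw [le_div_iff₀ (by positivity)] at h2
    have h3 : a ≤ ρ / 2 * μ := by linarith
    refine h3.trans ?_
    have : ρ / 2 ≤ K := by
      have : 0 ≤ K₁ * (1 + K₂) := by positivity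
      have : 0 ≤ ρ * K₂ := by positivity
      have : 0 ≤ 6 / ρ := by positivity
      rw [hK]; linarith
    gcongr
  -- The quotient is the product of `μρ / (4a)` and `a / (s √ε)`, both close to `1`.
  · have e1 : s * μ / (4 * Real.sqrt ε) - 1 = (μ * ρ / (4 * a) - 1) * (a / (s * Real.sqrt ε))
        + (a / (s * Real.sqrt ε) - 1) := by
      rw [hρdef]; field_simp; ring
    rw [e1]
    refine (abs_add_le _ _).trans ?_
    rw [abs_mul]
    have h1 : |a / (s * Real.sqrt ε)| ≤ 1 + K₂ := by
      have := abs_add_le (a / (s * Real.sqrt ε) - 1) 1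
      rw [sub_add_cancel, abs_one] at this
      linarith
    have h2 : |μ * ρ / (4 * a) - 1| * |a / (s * Real.sqrt ε)| ≤ K₁ * a * (1 + K₂) := by gcongr
    have h3 : 0 ≤ ρ * K₂ * a := by positivity
    have h4 : 0 ≤ 6 / ρ * a := by positivity
    have h5 : 0 ≤ ρ / 2 * a := by positivity
    rw [hK]
    linarith
  · have e1 : s * a / Real.sqrt ε - ρ = ρ * (a / (s * Real.sqrt ε) - 1) := by
      rw [hρdef]; field_simp
    rw [e1, abs_mul, abs_of_pos hρ0]
    have h2 : ρ * |a / (s * Real.sqrt ε) - 1| ≤ ρ * (K₂ * a) := by gcongr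
    have h3 : 0 ≤ K₁ * (1 + K₂) * a := by positivity
    have h4 : 0 ≤ 6 / ρ * a := by positivity
    have h5 : 0 ≤ ρ / 2 * a := by positivity
    have h6 : 0 ≤ K₂ * a := by positivity
    rw [hK]
    linarith
  · change q + rE ≤ 2 * rE + 1
    have h1 : q ≤ rE + 1 := (pow_le_pow_iff_left₀ hcE.le (by linarith) two_ne_zero).1 (by
      rw [hE]
      have h2 : a ^ 2 ≤ 1 := pow_le_one₀ ha.le ha1
      linarith)
    linarith

end geometry

/-! ## Identification of the weak solution -/

section identify
variable {K rI rE ε kI kE : ℝ} {D : NestedCircles}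

lemma IsModel.coreDisk_eq (h : IsModel K rI rE ε D) : coreDisk rI rE ε = D.ballI := by
  rw [coreDisk, NestedCircles.ballI, h.cI_eq, h.rI_eq]

lemma IsModel.outerDisk_eq (h : IsModel K rI rE ε D) : outerDisk rI rE ε = D.ballE := by
  rw [outerDisk, NestedCircles.ballE, h.cE_eq, h.rE_eq]

lemma IsModel.conductivity_eq (h : IsModel K rI rE ε D) :
    conductivity rI rE ε kI kE = D.piecewise kI kE 1 := by
  ext z
  rw [conductivity, NestedCircles.piecewise, h.coreDisk_eq, h.outerDisk_eq]

lemma abs_contrast_lt {x y : ℝ} (hx : 0 < x) (hy : 0 < y) : |(x - y) / (x + y)| < 1 := by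
  rw [abs_div, abs_of_pos (by positivity : 0 < x + y), div_lt_one (by positivity), abs_lt]
  constructor <;> linarith

lemma abs_tauI_lt (hkI : 0 < kI) (hkE : 0 < kE) : |tauI kI kE| < 1 := abs_contrast_lt hkI hkE

lemma abs_tauE_lt (hkE : 0 < kE) : |tauE kE| < 1 := abs_contrast_lt one_pos hkE

lemma abs_mul_lt_one {x y : ℝ} (hx : |x| < 1) (hy : |y| < 1) : |x * y| < 1 := by
  rw [abs_mul]
  nlinarith [abs_nonneg x, abs_nonneg y]

lemma measurable_piecewise (D : NestedCircles) (kI kE k : ℝ) :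
    Measurable (D.piecewise kI kE k) := by
  unfold NestedCircles.piecewise
  exact Measurable.ite Metric.isOpen_ball.measurableSet measurable_const
    (Measurable.ite Metric.isOpen_ball.measurableSet measurable_const measurable_const)

/-- The difference of `u` and the shifted candidate is a continuous weak solution. Its `O(‖z‖⁻¹)`
decay is arranged by subtracting `limitAtInfinity`, so it vanishes. -/
lemma IsModel.solution_unique (h : IsModel K rI rE ε D) (hkI : 0 < kI) (hkE : 0 < kE)
    {F : ℂ → ℂ} (hF : Differentiable ℂ F) {u : ℂ → ℝ}
    (hu : IsSolution rI rE ε kI kE (fun z => (F z).re) u) (z : ℂ) :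
    u z = D.solution F (tauI kI kE) (tauE kE) z
      - D.limitAtInfinity F (tauI kI kE) (tauE kE) := by
  obtain ⟨huc, ⟨g, hgL, hgw, hgeq⟩, hudec⟩ := hu
  rw [h.conductivity_eq] at hgeq
  set τi := tauI kI kE with hτi
  set τe := tauE kE with hτe
  have hτ : |τi * τe| < 1 := abs_mul_lt_one (abs_tauI_lt hkI hkE) (abs_tauE_lt hkE)
  have hτ' : |(-τi) * (-τe)| < 1 := by rwa [neg_mul_neg]
  set U := D.solution F τi τe with hU
  have hUL := D.boundedlyLipschitz_solution hF hτ
  have hWL := D.boundedlyLipschitz_solution (hF.const_mul (-Complex.I)) hτ'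
  have hUw := hUL.hasWeakGradient
  set ℓ := D.limitAtInfinity F τi τe with hℓ
  set σ := D.piecewise kI kE 1 with hσ
  have hσm := measurable_piecewise D kI kE 1
  set c := min kI (min kE 1)
  set M := max kI (max kE 1)
  have hc : 0 < c := lt_min hkI (lt_min hkE one_pos)
  have hσc : ∀ x, c ≤ σ x := fun x => by
    rw [hσ, NestedCircles.piecewise]
    split_ifs
    · exact min_le_left _ _
    · exact (min_le_right _ _).trans (min_le_left _ _)
    · exact (min_le_right _ _).trans (min_le_right _ _)
  have hσM : ∀ x, |σ x| ≤ M := fun x => by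
    rw [abs_of_pos (hc.trans_le (hσc x)), hσ, NestedCircles.piecewise]
    split_ifs
    · exact le_max_left _ _
    · exact (le_max_left _ _).trans (le_max_right _ _)
    · exact (le_max_right _ _).trans (le_max_right _ _)
  have hint1 : ∀ (w : ℂ → ℝ), Continuous w → ∀ φ : ℂ → ℝ, ContDiff ℝ ∞ φ → HasCompactSupport φ →
      Integrable fun z => w z • gradient φ z := fun w hw φ hφ hφc =>
    (hw.smul (continuous_gradient hφ)).integrable_of_hasCompactSupport
      (hasCompactSupport_gradient hφc).smul_left
  have hint2 : ∀ k : ℂ → ℂ, (∀ S : Set ℂ, IsCompact S → MemLp k 2 (volume.restrict S)) →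
      ∀ φ : ℂ → ℝ, Continuous φ → HasCompactSupport φ →
      Integrable fun z => φ z • k z := fun k hk φ hφ hφc => by
    have hs : Function.support (fun z => φ z • k z) ⊆ tsupport φ := by
      intro x hx
      refine subset_tsupport _ (Function.mem_support.2 fun h => hx ?_)
      simp [h]
    rw [← integrableOn_iff_integrable_of_support_subset hs]
    have hfin : IsFiniteMeasure (volume.restrict (tsupport φ)) := ⟨by
      rw [Measure.restrict_apply_univ]; exact hφc.isCompact.measure_lt_top⟩
    obtain ⟨C, hC⟩ := hφc.exists_bound_of_continuous hφ
    exact ((hk _ hφc.isCompact).integrable (by norm_num)).bdd_smul C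
      hφ.aestronglyMeasurable (Filter.Eventually.of_forall hC)
  have hint3 : ∀ k : ℂ → ℂ, (∀ S : Set ℂ, IsCompact S → MemLp k 2 (volume.restrict S)) →
      ∀ φ : ℂ → ℝ, ContDiff ℝ ∞ φ → HasCompactSupport φ →
      Integrable fun z => σ z * inner ℝ (k z) (gradient φ z) := fun k hk φ hφ hφc => by
    have hs : Function.support (fun z => σ z * inner ℝ (k z) (gradient φ z))
        ⊆ tsupport (gradient φ) := by
      intro x hx
      refine subset_tsupport _ (Function.mem_support.2 fun h => hx ?_)
      simp only [h]
      simp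
    rw [← integrableOn_iff_integrable_of_support_subset hs]
    have hgc := hasCompactSupport_gradient hφc
    have hfin : IsFiniteMeasure (volume.restrict (tsupport (gradient φ))) := ⟨by
      rw [Measure.restrict_apply_univ]; exact hgc.isCompact.measure_lt_top⟩
    obtain ⟨C, hC⟩ := hgc.exists_bound_of_continuous (continuous_gradient hφ)
    have hk1 := (hk _ hgc.isCompact).integrable (by norm_num)
    refine (hk1.norm.const_mul (M * C)).mono' (hσm.aestronglyMeasurable.mul
      (hk1.aestronglyMeasurable.inner (continuous_gradient hφ).aestronglyMeasurable))
      (Filter.Eventually.of_forall fun x => ?_)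
    rw [norm_mul, Real.norm_eq_abs (σ x)]
    have h1 := (norm_inner_le_norm (𝕜 := ℝ) (k x) (gradient φ x)).trans
      (mul_le_mul_of_nonneg_left (hC x) (norm_nonneg _))
    have hM : 0 ≤ M := (abs_nonneg _).trans (hσM x)
    calc |σ x| * _ ≤ M * (‖k x‖ * C) := mul_le_mul (hσM x) h1 (norm_nonneg _) hM
      _ = _ := by ring
  have hGL : ∀ S : Set ℂ, IsCompact S → MemLp (gradient U) 2 (volume.restrict S) :=
    fun S hS => hUL.memLp_gradient hS
  have hv0 := eq_zero_of_weak_solution (v := fun z => u z - (U z - ℓ))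
    (g := fun z => g z - gradient U z) (σ := σ) (M := M) (c := c) hσm.aestronglyMeasurable hσM hc
    hσc (huc.sub (hUL.continuous.sub continuous_const))
    (fun S hS => (hgL S hS).sub (hGL S hS)) ?_ ?_ ?_
  · have := congrFun hv0 z
    simp only [Pi.zero_apply] at this
    linarith
  · intro φ hφ hφc
    -- This is the weak gradient of the constant `1`; it shows that subtracting the limit does not
    -- affect the weak gradient.
    have e0 : ∫ z, gradient φ z = 0 := by
      have hone : BoundedlyLipschitz fun _ : ℂ => (1 : ℝ) := fun R =>
        ⟨0, (LipschitzWith.const 1).lipschitzOnWith⟩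
      have := hone.hasWeakGradient φ hφ hφc
      simpa [gradient] using this
    have e1 : ∀ z, (u z - (U z - ℓ)) • gradient φ z
        = u z • gradient φ z - U z • gradient φ z + ℓ • gradient φ z := fun z => by
      rw [sub_smul, sub_smul]; abel
    have i0 : Integrable (gradient φ) := (continuous_gradient hφ).integrable_of_hasCompactSupport
      (hasCompactSupport_gradient hφc)
    have i1 : Integrable fun z => u z • gradient φ z - U z • gradient φ z :=
      (hint1 u huc φ hφ hφc).sub (hint1 U hUL.continuous φ hφ hφc)
    have i2 : Integrable fun z => ℓ • gradient φ z := i0.smul ℓ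
    simp_rw [e1, smul_sub]
    rw [integral_add i1 i2,
      integral_sub (hint1 u huc φ hφ hφc) (hint1 U hUL.continuous φ hφ hφc), hgw φ hφ hφc,
      hUw φ hφ hφc, integral_smul, e0,
      integral_sub (hint2 g hgL φ hφ.continuous hφc) (hint2 _ hGL φ hφ.continuous hφc)]
    simp only [smul_zero]
    abel
  · intro φ hφ hφc
    have e1 := integral_inner_gradient_eq_zero_of_conjugate (U := U) (σ := σ) hWL
      (D.gradient_conjugate hF hkI hkE hτ) hφ hφc
    simp_rw [inner_sub_left, mul_sub]
    rw [integral_sub (hint3 g hgL φ hφ hφc) (hint3 _ hGL φ hφ hφc), hgeq φ hφ hφc, e1, sub_zero]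
  · have := hudec.sub (D.solution_decay hF hτ)
    refine this.congr_left fun z => ?_
    ring

end identify

/-! ## Gradient bounds -/

section elementary
variable {x y X A N η : ℝ}

/-- If the contrasts have the same sign, one factor of `(1 - x)(1 + y)` is at most `1 - xy` and the
other at most `2`. Otherwise the alternating bound `N` is available. -/
lemma core_coefficient_bound (hx : |x| < 1) (hy : |y| < 1) (hX : 0 ≤ X)
    (hA : X * (1 - |x * y|) ≤ A) (hA0 : 0 ≤ A) (hN0 : 0 ≤ N) (hN : x * y ≤ 0 → X ≤ N) :
    (1 - x) * (1 + y) * X ≤ 2 * A + 4 * N := by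
  obtain ⟨hx1, hx2⟩ := abs_lt.1 hx
  obtain ⟨hy1, hy2⟩ := abs_lt.1 hy
  have hc : (1 - x) * (1 + y) ≤ 2 * 2 :=
    mul_le_mul (by linarith) (by linarith) (by linarith) (by norm_num)
  rcases le_or_gt (x * y) 0 with h | h
  · calc (1 - x) * (1 + y) * X ≤ 2 * 2 * N := mul_le_mul hc (hN h) hX (by norm_num)
      _ ≤ 2 * A + 4 * N := by linarith
  · rw [abs_of_pos h] at hA
    have hc : (1 - x) * (1 + y) ≤ 2 * (1 - x * y) := by
      rcases pos_and_pos_or_neg_and_neg_of_mul_pos h with ⟨h1, h2⟩ | ⟨h1, h2⟩ <;> nlinarith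
    have := mul_le_mul_of_nonneg_right hc hX
    linarith

/-- `|x| (1 - y²) ≤ 2 |x| (1 - |y|) ≤ 2 (1 - |xy|)`, whatever the signs. -/
lemma exterior_coefficient_bound (hx : |x| < 1) (hy : |y| < 1) (hX : 0 ≤ X)
    (hA : X * (1 - |x * y|) ≤ A) : |x * (1 - y ^ 2)| * X ≤ 2 * A := by
  have h0 := abs_nonneg x
  have h1 := abs_nonneg y
  have h2 : |x * (1 - y ^ 2)| ≤ 2 * (1 - |x * y|) := by
    have h3 : 0 ≤ 1 - |y| ^ 2 := by nlinarith
    rw [abs_mul, abs_mul, ← sq_abs y, abs_of_nonneg h3]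
    nlinarith [mul_nonneg h0 h1, mul_nonneg h0 (sq_nonneg |y|)]
  have := mul_le_mul_of_nonneg_right h2 hX
  linarith

/-- For opposite signs `N` applies. For two negative contrasts `1 + y ≤ 1 - xy`. For two positive
ones `1 - xy ≥ η`; this is the only case in which the distance from `1` is used. -/
lemma shell_coefficient_bound (hx : |x| < 1) (hy : |y| < 1) (hX : 0 ≤ X) (hη : 0 < η)
    (hA : X * (1 - |x * y|) ≤ A) (hA0 : 0 ≤ A) (hN0 : 0 ≤ N) (hN : x * y ≤ 0 → X ≤ N)
    (h : x ≤ 1 - η ∨ y ≤ 1 - η) : (1 + y) * X ≤ A + 2 * (A / η) + 2 * N := by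
  obtain ⟨hx1, hx2⟩ := abs_lt.1 hx
  obtain ⟨hy1, hy2⟩ := abs_lt.1 hy
  have hAη : 0 ≤ A / η := by positivity
  rcases le_or_gt (x * y) 0 with h0 | h0
  · calc (1 + y) * X ≤ 2 * N := mul_le_mul (by linarith) (hN h0) hX (by norm_num)
      _ ≤ _ := by linarith
  · rw [abs_of_pos h0] at hA
    rcases pos_and_pos_or_neg_and_neg_of_mul_pos h0 with ⟨h1, h2⟩ | ⟨h1, h2⟩
    · have h3 : η ≤ 1 - x * y := by rcases h with h | h <;> nlinarith
      have h4 : X ≤ A / η := by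
        rw [le_div_iff₀ hη]
        exact (mul_le_mul_of_nonneg_left h3 hX).trans hA
      calc (1 + y) * X ≤ 2 * (A / η) := mul_le_mul (by linarith) h4 hX (by norm_num)
        _ ≤ _ := by linarith
    · have h3 : (1 + y) * X ≤ (1 - x * y) * X := mul_le_mul_of_nonneg_right (by nlinarith) hX
      linarith

end elementary

lemma hasGradientAt_sub_const {f : ℂ → ℝ} {g z : ℂ} (hf : HasGradientAt f g z) (c : ℝ) :
    HasGradientAt (fun z => f z - c) g z := by
  rw [hasGradientAt_iff_hasFDerivAt] at hf ⊢
  exact hf.sub_const c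

lemma GradBoundedOn.mono {f : ℂ → ℝ} {S T : Set ℂ} {B C : ℝ} (h : GradBoundedOn f S B)
    (hT : T ⊆ S) (hC : B ≤ C) : GradBoundedOn f T C :=
  fun z hz => ⟨(h z (hT hz)).1, (h z (hT hz)).2.trans hC⟩

lemma GradBoundedOn.union {f : ℂ → ℝ} {S T : Set ℂ} {C : ℝ} (h : GradBoundedOn f S C)
    (h' : GradBoundedOn f T C) : GradBoundedOn f (S ∪ T) C :=
  fun z hz => hz.elim (h z) (h' z)

lemma GradBoundedOn.sub_const {f : ℂ → ℝ} {S : Set ℂ} {C : ℝ} (h : GradBoundedOn f S C) (c : ℝ) :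
    GradBoundedOn (fun z => f z - c) S C := fun z hz => by
  have hg := hasGradientAt_sub_const (h z hz).1.hasGradientAt c
  exact ⟨hg.differentiableAt, by rw [hg.gradient]; exact (h z hz).2⟩

lemma norm_ofReal_mul (x : ℝ) (w : ℂ) : ‖(x : ℂ) * w‖ = |x| * ‖w‖ := by
  rw [norm_mul, Complex.norm_real, Real.norm_eq_abs]

lemma norm_coefficient_mul_le {c B : ℝ} {w : ℂ} (hc : |c| ≤ 2) (hw : ‖w‖ ≤ B) :
    ‖(c : ℂ) * w‖ ≤ 2 * B := by
  rw [norm_ofReal_mul]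
  exact mul_le_mul hc hw (norm_nonneg _) zero_le_two

namespace NestedCircles
variable (D : NestedCircles)

section bounds
variable {F : ℂ → ℂ} {τi τe K ρ R A : ℝ}

/-- The functional equation of the series pulled back by the outer reflection, where `flow ∘ reflE =
reflI`. It expresses both singular terms of the exterior through one, exposing the small factor `1 -
τₑ²`. -/
lemma pullE_seriesDeriv {τ : ℝ} (hF : Differentiable ℂ F) (hτ : |τ| < 1) {z : ℂ}
    (hz : z ∉ D.closedE) :
    D.pullE (D.seriesDeriv F τ) z = D.pullE (deriv F) z + τ * D.pullI (D.seriesDeriv F τ) z := by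
  have hT : ∀ z : ℂ, 0 < z.re → HasDerivAt (D.series F τ) (D.seriesDeriv F τ z) z :=
    fun z hz => D.hasDerivAt_series hF hτ hz
  have hzE := D.notMem_ballE hz
  have h1 := D.hasGradientAt_pullE hT hzE
  have h2 := hasGradientAt_add
    (D.hasGradientAt_pullE (fun z _ => (hF z).hasDerivAt) hzE)
    (hasGradientAt_const_mul τ (D.hasGradientAt_pullI hT (D.notMem_ballI (D.notMem_closedI hzE))))
  refine h1.unique (h2.congr_of_eventuallyEq ?_)
  filter_upwards [Metric.isClosed_closedBall.isOpen_compl.mem_nhds hz] with y hy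
  have hy' := D.notMem_ballE hy
  have h := congrArg Complex.re (imageSum_eq hF D.a_pos D.a_le_one D.μ_pos hτ
    (D.re_pos (D.reflE_mem hy')))
  rwa [D.flow_reflE hy', Complex.add_re, Complex.re_ofReal_mul] at h

/-- A bound for the image series when its terms alternate in sign. -/
def alternatingBound (K R A : ℝ) : ℝ := A + A * K * (98 + 32 * R) * (1 + R + 2 * K)

lemma norm_seriesDeriv_mul_le {τ : ℝ} (hB : DerivBounds F (R + 1) A) (hR : D.radius ≤ R)
    (hτ : |τ| < 1) {z : ℂ} (hz : z ∈ D.closedE) : ‖D.seriesDeriv F τ z‖ * (1 - |τ|) ≤ A := by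
  rw [← le_div_iff₀ (by linarith)]
  exact norm_imageSumDeriv_le hB D.a_pos D.a_le_one D.μ_pos hτ (D.re_pos hz).le
    ((D.norm_le_radius hz).trans hR)

lemma norm_seriesDeriv_le_alternatingBound {τ : ℝ} (hF : Differentiable ℂ F)
    (hB : DerivBounds F (R + 1) A) (hn : NearlyTouching K ρ D.a D.μ) (hR : D.radius ≤ R)
    (hτ : -1 < τ) (hτ0 : τ ≤ 0) {z : ℂ} (hz : z ∈ D.closedE) :
    ‖D.seriesDeriv F τ z‖ ≤ alternatingBound K R A :=
  norm_imageSumDeriv_le_of_nonpos hF hB hn.a_pos hn.a_le_one hn.μ_pos hn.μ_le hn.a_le hτ hτ0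
    (D.re_pos hz).le ((D.norm_le_radius hz).trans hR)

lemma radius_nonneg : 0 ≤ D.radius :=
  add_nonneg (D.cI_pos.trans D.cI_lt).le D.rE_pos.le

lemma alternatingBound_nonneg (hn : NearlyTouching K ρ D.a D.μ) (hR : 0 ≤ R) (hA : 0 ≤ A) :
    0 ≤ alternatingBound K R A := by
  have := hn.K_nonneg
  unfold alternatingBound
  positivity

lemma norm_deriv_le (hB : DerivBounds F (R + 1) A) (hR : D.radius ≤ R) {z : ℂ}
    (hz : z ∈ D.closedE) : ‖deriv F z‖ ≤ A :=
  hB.deriv_le z (by linarith [D.norm_le_radius hz])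

lemma norm_pullI_le_of_bound {f' : ℂ → ℂ} {B : ℝ} (hf : ∀ z ∈ D.closedE, ‖f' z‖ ≤ B) {z : ℂ}
    (hz : z ∉ D.ballI) : ‖D.pullI f' z‖ ≤ B :=
  (D.norm_pullI_le hz).trans (hf _ (D.closedI_subset_closedE (D.reflI_mem hz)))

lemma norm_pullE_le_of_bound {f' : ℂ → ℂ} {B : ℝ} (hf : ∀ z ∈ D.closedE, ‖f' z‖ ≤ B) {z : ℂ}
    (hz : z ∉ D.ballE) : ‖D.pullE f' z‖ ≤ B :=
  (D.norm_pullE_le hz).trans (hf _ (D.reflE_mem hz))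

lemma gradBoundedOn_core (hF : Differentiable ℂ F) (hB : DerivBounds F (R + 1) A)
    (hn : NearlyTouching K ρ D.a D.μ) (hR : D.radius ≤ R) (hi : |τi| < 1) (he : |τe| < 1) :
    GradBoundedOn (fun z => D.solution F τi τe z - (F z).re) D.ballI
      (3 * A + 4 * alternatingBound K R A) := fun z hz => by
  have hR0 := D.radius_nonneg.trans hR
  have hA := hB.nonneg (by linarith)
  have hτ := abs_mul_lt_one hi he
  have hzE := D.closedI_subset_closedE (D.ballI_subset hz)
  have h := hasGradientAt_sub (D.hasGradientAt_solution_core hF hτ hz)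
    (hasGradientAt_re (hF z).hasDerivAt)
  refine ⟨h.differentiableAt, ?_⟩
  rw [h.gradient]
  refine (norm_sub_le _ _).trans ?_
  rw [norm_ofReal_mul, RCLike.norm_conj, RCLike.norm_conj, abs_of_nonneg
    (mul_nonneg (by linarith [(abs_lt.1 hi).2]) (by linarith [(abs_lt.1 he).1]))]
  have h1 := core_coefficient_bound hi he (norm_nonneg (D.seriesDeriv F (τi * τe) z))
    (D.norm_seriesDeriv_mul_le hB hR hτ hzE) hA (D.alternatingBound_nonneg hn hR0 hA)
    fun h0 => D.norm_seriesDeriv_le_alternatingBound hF hB hn hR (abs_lt.1 hτ).1 h0 hzE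
  linarith [D.norm_deriv_le hB hR hzE]

lemma gradBoundedOn_exterior (hF : Differentiable ℂ F) (hB : DerivBounds F (R + 1) A)
    (hR : D.radius ≤ R) (hi : |τi| < 1) (he : |τe| < 1) :
    GradBoundedOn (fun z => D.solution F τi τe z - (F z).re) D.closedEᶜ (3 * A) := fun z hz => by
  have hτ := abs_mul_lt_one hi he
  have hzE := D.notMem_ballE hz
  have hzI := D.notMem_ballI (D.notMem_closedI hzE)
  have h := hasGradientAt_sub (D.hasGradientAt_solution_exterior hF hτ hz)
    (hasGradientAt_re (hF z).hasDerivAt)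
  refine ⟨h.differentiableAt, ?_⟩
  rw [h.gradient, D.pullE_seriesDeriv hF hτ hz]
  have e : (starRingEnd ℂ) (deriv F z) + τe * (D.pullE (deriv F) z
        + ((τi * τe : ℝ) : ℂ) * D.pullI (D.seriesDeriv F (τi * τe)) z)
      - τi * D.pullI (D.seriesDeriv F (τi * τe)) z - (starRingEnd ℂ) (deriv F z)
      = τe * D.pullE (deriv F) z
        - ((τi * (1 - τe ^ 2) : ℝ) : ℂ) * D.pullI (D.seriesDeriv F (τi * τe)) z := by
    push_cast; ring
  rw [e]
  refine (norm_sub_le _ _).trans ?_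
  rw [norm_ofReal_mul, norm_ofReal_mul]
  have h1 : |τe| * ‖D.pullE (deriv F) z‖ ≤ 1 * A :=
    mul_le_mul he.le (D.norm_pullE_le_of_bound (fun z hz => D.norm_deriv_le hB hR hz) hzE)
      (norm_nonneg _) zero_le_one
  have h2 := exterior_coefficient_bound hi he (norm_nonneg _) (D.norm_seriesDeriv_mul_le hB hR hτ
    (D.closedI_subset_closedE (D.reflI_mem hzI)))
  have h3 := mul_le_mul_of_nonneg_left (D.norm_pullI_le (f' := D.seriesDeriv F (τi * τe)) hzI)
    (abs_nonneg (τi * (1 - τe ^ 2)))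
  linarith

lemma gradBoundedOn_shell {η : ℝ} (hF : Differentiable ℂ F) (hB : DerivBounds F (R + 1) A)
    (hn : NearlyTouching K ρ D.a D.μ) (hR : D.radius ≤ R) (hi : |τi| < 1) (he : |τe| < 1)
    (hη : 0 < η) (h : τi ≤ 1 - η ∨ τe ≤ 1 - η) :
    GradBoundedOn (fun z => D.solution F τi τe z - (F z).re) (D.ballE \ D.closedI)
      (3 * A + 4 * (A / η) + 4 * alternatingBound K R A) := fun z hz => by
  have hR0 := D.radius_nonneg.trans hR
  have hA := hB.nonneg (by linarith)
  have hN := D.alternatingBound_nonneg hn hR0 hA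
  have hτ := abs_mul_lt_one hi he
  have hzI := D.notMem_ballI hz.2
  have hg := hasGradientAt_sub (D.hasGradientAt_solution_shell hF hτ hz.1 hz.2)
    (hasGradientAt_re (hF z).hasDerivAt)
  refine ⟨hg.differentiableAt, ?_⟩
  rw [hg.gradient]
  have he0 : 0 ≤ 1 + τe := by linarith [(abs_lt.1 he).1]
  have key : ∀ y ∈ D.closedE, (1 + τe) * ‖D.seriesDeriv F (τi * τe) y‖
      ≤ A + 2 * (A / η) + 2 * alternatingBound K R A := fun y hy =>
    shell_coefficient_bound hi he (norm_nonneg _) hη (D.norm_seriesDeriv_mul_le hB hR hτ hy) hA hN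
      (fun h0 => D.norm_seriesDeriv_le_alternatingBound hF hB hn hR (abs_lt.1 hτ).1 h0 hy) h
  refine (norm_sub_le _ _).trans ?_
  rw [norm_ofReal_mul, abs_of_nonneg he0, RCLike.norm_conj]
  have h1 := key z (D.ballE_subset hz.1)
  have h2 := key _ (D.closedI_subset_closedE (D.reflI_mem hzI))
  have h3 : ‖(starRingEnd ℂ) (D.seriesDeriv F (τi * τe) z)
      - τi * D.pullI (D.seriesDeriv F (τi * τe)) z‖ ≤ ‖D.seriesDeriv F (τi * τe) z‖
        + ‖D.seriesDeriv F (τi * τe) (D.reflI z)‖ := by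
    refine (norm_sub_le _ _).trans ?_
    rw [norm_ofReal_mul, RCLike.norm_conj]
    gcongr
    calc |τi| * ‖D.pullI (D.seriesDeriv F (τi * τe)) z‖
        ≤ 1 * ‖D.seriesDeriv F (τi * τe) (D.reflI z)‖ :=
          mul_le_mul hi.le (D.norm_pullI_le hzI) (norm_nonneg _) zero_le_one
      _ = _ := one_mul _
  have h4 := mul_le_mul_of_nonneg_left h3 he0
  have h5 := D.norm_deriv_le hB hR (D.ballE_subset hz.1)
  linarith

end bounds

/-! ## Comparison with the Lerch function -/

section comparison
variable {F : ℂ → ℂ} {τi τe K ρ R A b : ℝ}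

/-- Derivative of `deriv F 0 * (ρ / 2) * lerchMap D.a b`. -/
def mainDeriv (F : ℂ → ℂ) (ρ b : ℝ) (z : ℂ) : ℂ := deriv F 0 * (ρ / 2 * lerchMapDeriv D.a b z)

/-- The real part of `deriv F 0` times `ρ` times the singular function. -/
def mainPart (F : ℂ → ℂ) (ρ b τi τe : ℝ) (z : ℂ) : ℝ :=
  (τi * τe + τe) * (deriv F 0 * (ρ / 2 * lerchMap D.a b (fold D.cE D.rE z))).re
    - (τi * τe + τi) * (deriv F 0 * (ρ / 2 * lerchMap D.a b (fold D.cI D.rI z))).re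

lemma hasDerivAt_main (hb : 0 ≤ b) (z : ℂ) (hz : 0 < z.re) :
    HasDerivAt (fun z => deriv F 0 * (ρ / 2 * lerchMap D.a b z)) (D.mainDeriv F ρ b z) z :=
  ((hasDerivAt_lerchMap D.a_pos hb hz).const_mul _).const_mul _

lemma continuous_mainPart (hb : 0 ≤ b) : Continuous (D.mainPart F ρ b τi τe) := by
  have key : ∀ {m : ℂ → ℂ}, LipschitzWith 1 m → (∀ z, m z ∈ D.imageRegion) →
      Continuous fun z => (deriv F 0 * (ρ / 2 * lerchMap D.a b (m z))).re := fun hm hmem =>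
    Complex.continuous_re.comp (continuous_iff_continuousAt.2 fun z =>
      ((D.hasDerivAt_main hb _ (hmem z).1).continuousAt.comp hm.continuous.continuousAt))
  exact (continuous_const.mul (key (lipschitzWith_fold D.rE_pos) D.foldE_mem)).sub
    (continuous_const.mul (key (lipschitzWith_fold D.rI_pos) D.foldI_mem))

lemma hasGradientAt_mainPart_core (hb : 0 ≤ b) {z : ℂ} (hz : z ∈ D.ballI) :
    HasGradientAt (D.mainPart F ρ b τi τe)
      ((τi * τe + τe : ℝ) * (starRingEnd ℂ) (D.mainDeriv F ρ b z)
        - (τi * τe + τi : ℝ) * (starRingEnd ℂ) (D.mainDeriv F ρ b z)) z := by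
  have h := hasGradientAt_re (D.hasDerivAt_main (F := F) (ρ := ρ) hb z
    (D.re_pos (D.closedI_subset_closedE (D.ballI_subset hz))))
  refine (hasGradientAt_sub (hasGradientAt_const_mul _ h)
    (hasGradientAt_const_mul _ h)).congr_of_eventuallyEq ?_
  filter_upwards [Metric.isOpen_ball.mem_nhds hz] with y hy
  rw [mainPart, fold_of_mem hy, fold_of_mem (D.closedI_subset_ballE (D.ballI_subset hy))]

lemma hasGradientAt_mainPart_shell (hb : 0 ≤ b) {z : ℂ} (hz : z ∈ D.ballE) (hz' : z ∉ D.closedI) :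
    HasGradientAt (D.mainPart F ρ b τi τe)
      ((τi * τe + τe : ℝ) * (starRingEnd ℂ) (D.mainDeriv F ρ b z)
        - (τi * τe + τi : ℝ) * D.pullI (D.mainDeriv F ρ b) z) z := by
  have h := hasGradientAt_re (D.hasDerivAt_main (F := F) (ρ := ρ) hb z
    (D.re_pos (D.ballE_subset hz)))
  refine (hasGradientAt_sub (hasGradientAt_const_mul _ h) (hasGradientAt_const_mul _
    (D.hasGradientAt_pullI (D.hasDerivAt_main hb) (D.notMem_ballI hz')))).congr_of_eventuallyEq ?_
  filter_upwards [Metric.isOpen_ball.mem_nhds hz,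
    Metric.isClosed_closedBall.isOpen_compl.mem_nhds hz'] with y hy hy'
  rw [mainPart, fold_of_notMem (D.notMem_ballI hy'), fold_of_mem hy, reflI]

lemma hasGradientAt_mainPart_exterior (hb : 0 ≤ b) {z : ℂ} (hz : z ∉ D.closedE) :
    HasGradientAt (D.mainPart F ρ b τi τe)
      ((τi * τe + τe : ℝ) * D.pullE (D.mainDeriv F ρ b) z
        - (τi * τe + τi : ℝ) * D.pullI (D.mainDeriv F ρ b) z) z := by
  refine (hasGradientAt_sub (hasGradientAt_const_mul _
    (D.hasGradientAt_pullE (D.hasDerivAt_main hb) (D.notMem_ballE hz)))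
    (hasGradientAt_const_mul _ (D.hasGradientAt_pullI (D.hasDerivAt_main hb)
      (D.notMem_ballI (D.notMem_closedI (D.notMem_ballE hz)))))).congr_of_eventuallyEq ?_
  filter_upwards [Metric.isClosed_closedBall.isOpen_compl.mem_nhds hz] with y hy
  have hy' := D.notMem_ballE hy
  rw [mainPart, fold_of_notMem (D.notMem_ballI (D.notMem_closedI hy')), fold_of_notMem hy', reflI,
    reflE]

/-- A bound for the error made by replacing the derivative of the image series by `mainDeriv`. -/
def mainError (K R A : ℝ) : ℝ :=
  A * 64 * (1 + R + 2 * K) + A * (1 + 1 * K * (98 + 32 * R) * (1 + R + 2 * K) + 8 * K ^ 2)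

/-- `b` is close to the quotient `-log τ / μ`. -/
def ExponentBound (K b τ : ℝ) : Prop :=
  0 ≤ b ∧ |b - -Real.log τ / D.μ| ≤ K * D.a * (-Real.log τ / D.μ)

/-- The hypotheses under which the image series is compared with the Lerch function. -/
structure Comparable (F : ℂ → ℂ) (K ρ R A b τi τe : ℝ) : Prop where
  bounds : DerivBounds F (R + 1) A
  near : NearlyTouching K ρ D.a D.μ
  radius_le : D.radius ≤ R
  tauI_lt : |τi| < 1
  tauE_lt : |τe| < 1
  tau_pos : 0 < τi * τe
  exponent : D.ExponentBound K b (τi * τe)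

variable {D}

lemma Comparable.tau_lt (h : D.Comparable F K ρ R A b τi τe) : τi * τe < 1 :=
  lt_of_abs_lt (abs_mul_lt_one h.tauI_lt h.tauE_lt)

lemma Comparable.norm_seriesDeriv_sub_mainDeriv_le (H : D.Comparable F K ρ R A b τi τe) {z : ℂ} (hz : z ∈ D.closedE) :
    ‖D.seriesDeriv F (τi * τe) z - D.mainDeriv F ρ b z‖ ≤ mainError K R A :=
  norm_imageSumDeriv_sub_lerchMapDeriv_le H.bounds H.near H.tau_pos H.tau_lt H.exponent.1
    H.exponent.2 (D.re_pos hz).le ((D.norm_le_radius hz).trans H.radius_le)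

lemma Comparable.norm_pullI_sub_le (H : D.Comparable F K ρ R A b τi τe) {z : ℂ} (hz : z ∉ D.ballI) :
    ‖D.pullI (D.seriesDeriv F (τi * τe)) z - D.pullI (D.mainDeriv F ρ b) z‖
      ≤ mainError K R A := by
  have h := D.norm_pullI_le_of_bound
    (f' := fun z => D.seriesDeriv F (τi * τe) z - D.mainDeriv F ρ b z)
    (fun z hz => H.norm_seriesDeriv_sub_mainDeriv_le hz) hz
  rwa [pullI, sub_mul] at h

lemma Comparable.norm_pullE_sub_le (H : D.Comparable F K ρ R A b τi τe) {z : ℂ} (hz : z ∉ D.ballE) :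
    ‖D.pullE (D.seriesDeriv F (τi * τe)) z - D.pullE (D.mainDeriv F ρ b) z‖
      ≤ mainError K R A := by
  have h := D.norm_pullE_le_of_bound
    (f' := fun z => D.seriesDeriv F (τi * τe) z - D.mainDeriv F ρ b z)
    (fun z hz => H.norm_seriesDeriv_sub_mainDeriv_le hz) hz
  rwa [pullE, sub_mul] at h

lemma Comparable.norm_one_sub_mul_seriesDeriv_le (H : D.Comparable F K ρ R A b τi τe) {z : ℂ} (hz : z ∈ D.closedE) :
    ‖((1 - τi * τe : ℝ) : ℂ) * D.seriesDeriv F (τi * τe) z‖ ≤ A := by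
  have h := abs_mul_lt_one H.tauI_lt H.tauE_lt
  have h1 := D.norm_seriesDeriv_mul_le H.bounds H.radius_le h hz
  rw [abs_of_pos H.tau_pos] at h h1
  rwa [norm_ofReal_mul, abs_of_pos (by linarith), mul_comm]

/-- In each region the gradient is rearranged into three bounded kinds of terms: derivatives of `F`,
terms `(1 - τ) T'`, and coefficients times `T' - mainDeriv`. In the shell, for instance, `1 + τₑ =
(1 - τ) + (τ + τₑ)` and `τᵢ (1 + τₑ) = τ + τᵢ`. -/
lemma Comparable.gradBoundedOn_sub_mainPart (H : D.Comparable F K ρ R A b τi τe) (hF : Differentiable ℂ F) :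
    GradBoundedOn (fun z => D.solution F τi τe z - (F z).re - D.mainPart F ρ b τi τe z)
      (D.ballI ∪ D.ballE \ D.closedI ∪ D.closedEᶜ) (2 * A + 4 * mainError K R A) := fun z hz => by
  have ⟨hB, _, hR, hi, he, _, hb⟩ := H
  have hτ1 := abs_mul_lt_one hi he
  have hm : |τi * τe + τe| ≤ 2 := (abs_add_le _ _).trans (by linarith)
  have hp : |τi * τe + τi| ≤ 2 := (abs_add_le _ _).trans (by linarith)
  have hA := hB.nonneg (by linarith [D.radius_nonneg])
  have hErr : 0 ≤ mainError K R A := (norm_nonneg _).trans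
    (H.norm_seriesDeriv_sub_mainDeriv_le
      (Metric.mem_closedBall_self D.rE_pos.le))
  rcases hz with (hz | ⟨hz, hz'⟩) | hz
  · have hzE := D.closedI_subset_closedE (D.ballI_subset hz)
    have h := hasGradientAt_sub (hasGradientAt_sub (D.hasGradientAt_solution_core hF hτ1 hz)
      (hasGradientAt_re (hF z).hasDerivAt))
      (D.hasGradientAt_mainPart_core (F := F) (ρ := ρ) (τi := τi) (τe := τe) hb.1 hz)
    refine ⟨h.differentiableAt, ?_⟩
    rw [h.gradient]
    set T := D.seriesDeriv F (τi * τe) z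
    set X := D.mainDeriv F ρ b z
    have e : (((1 - τi) * (1 + τe) : ℝ) : ℂ) * (starRingEnd ℂ) T - (starRingEnd ℂ) (deriv F z)
        - (((τi * τe + τe : ℝ) : ℂ) * (starRingEnd ℂ) X
          - ((τi * τe + τi : ℝ) : ℂ) * (starRingEnd ℂ) X)
        = (starRingEnd ℂ) (((1 - τi * τe : ℝ) : ℂ) * T + ((τe - τi : ℝ) : ℂ) * (T - X)
          - deriv F z) := by
      simp only [map_sub, map_add, map_mul, Complex.conj_ofReal]
      push_cast
      ring
    rw [e, RCLike.norm_conj]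
    refine (norm_sub_le _ _).trans ?_
    have h1 := norm_add_le (((1 - τi * τe : ℝ) : ℂ) * T) (((τe - τi : ℝ) : ℂ) * (T - X))
    have h2 := H.norm_one_sub_mul_seriesDeriv_le hzE
    have h3 := norm_coefficient_mul_le (c := τe - τi)
      ((abs_sub _ _).trans (by linarith))
      (H.norm_seriesDeriv_sub_mainDeriv_le hzE)
    have h4 := D.norm_deriv_le hB hR hzE
    linarith
  · have hzE := D.ballE_subset hz
    have hzI := D.notMem_ballI hz'
    have h := hasGradientAt_sub (hasGradientAt_sub (D.hasGradientAt_solution_shell hF hτ1 hz hz')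
      (hasGradientAt_re (hF z).hasDerivAt))
      (D.hasGradientAt_mainPart_shell (F := F) (ρ := ρ) (τi := τi) (τe := τe) hb.1 hz hz')
    refine ⟨h.differentiableAt, ?_⟩
    rw [h.gradient]
    set T := D.seriesDeriv F (τi * τe) z
    set X := D.mainDeriv F ρ b z
    set T' := D.pullI (D.seriesDeriv F (τi * τe)) z
    set X' := D.pullI (D.mainDeriv F ρ b) z
    have e : ((1 + τe : ℝ) : ℂ) * ((starRingEnd ℂ) T - τi * T') - (starRingEnd ℂ) (deriv F z)
        - (((τi * τe + τe : ℝ) : ℂ) * (starRingEnd ℂ) X - ((τi * τe + τi : ℝ) : ℂ) * X')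
        = (starRingEnd ℂ) (((1 - τi * τe : ℝ) : ℂ) * T + ((τi * τe + τe : ℝ) : ℂ) * (T - X)
          - deriv F z) - ((τi * τe + τi : ℝ) : ℂ) * (T' - X') := by
      simp only [map_sub, map_add, map_mul, Complex.conj_ofReal]
      push_cast
      ring
    rw [e]
    refine (norm_sub_le _ _).trans ?_
    rw [RCLike.norm_conj]
    have h0 := norm_sub_le (((1 - τi * τe : ℝ) : ℂ) * T + ((τi * τe + τe : ℝ) : ℂ) * (T - X))
      (deriv F z)
    have h1 := norm_add_le (((1 - τi * τe : ℝ) : ℂ) * T) (((τi * τe + τe : ℝ) : ℂ) * (T - X))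
    have h2 := H.norm_one_sub_mul_seriesDeriv_le hzE
    have h3 := norm_coefficient_mul_le hm
      (H.norm_seriesDeriv_sub_mainDeriv_le hzE)
    have h4 := D.norm_deriv_le hB hR hzE
    have h5 := norm_coefficient_mul_le hp (H.norm_pullI_sub_le hzI)
    linarith
  · have hzE := D.notMem_ballE hz
    have hzI := D.notMem_ballI (D.notMem_closedI hzE)
    have h := hasGradientAt_sub (hasGradientAt_sub (D.hasGradientAt_solution_exterior hF hτ1 hz)
      (hasGradientAt_re (hF z).hasDerivAt))
      (D.hasGradientAt_mainPart_exterior (F := F) (ρ := ρ) (τi := τi) (τe := τe) hb.1 hz)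
    refine ⟨h.differentiableAt, ?_⟩
    rw [h.gradient]
    have e0 := D.pullE_seriesDeriv hF hτ1 hz
    have h1 : ‖((1 - τi * τe : ℝ) : ℂ) * D.pullI (D.seriesDeriv F (τi * τe)) z‖ ≤ A := by
      have := D.norm_pullI_le_of_bound
        (f' := fun z => ((1 - τi * τe : ℝ) : ℂ) * D.seriesDeriv F (τi * τe) z)
        (fun z hz => H.norm_one_sub_mul_seriesDeriv_le hz) hzI
      rwa [pullI, mul_assoc] at this
    have h2 := D.norm_pullE_le_of_bound (fun z hz => D.norm_deriv_le hB hR hz) hzE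
    have h3 := norm_coefficient_mul_le hm (H.norm_pullE_sub_le hzE)
    have h4 := norm_coefficient_mul_le hp (H.norm_pullI_sub_le hzI)
    set T := D.pullE (D.seriesDeriv F (τi * τe)) z
    set X := D.pullE (D.mainDeriv F ρ b) z
    set T' := D.pullI (D.seriesDeriv F (τi * τe)) z
    set X' := D.pullI (D.mainDeriv F ρ b) z
    set G := D.pullE (deriv F) z
    -- Replacing the coefficients `τe`, `τi` by those of the main part leaves `τ (T' - T)`, and `T =
    -- G + τ T'` turns it into `τ ((1 - τ) T' - G)`.
    have e : (starRingEnd ℂ) (deriv F z) + τe * T - τi * T' - (starRingEnd ℂ) (deriv F z)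
        - (((τi * τe + τe : ℝ) : ℂ) * X - ((τi * τe + τi : ℝ) : ℂ) * X')
        = ((τi * τe + τe : ℝ) : ℂ) * (T - X) - ((τi * τe + τi : ℝ) : ℂ) * (T' - X')
          + ((τi * τe : ℝ) : ℂ) * (((1 - τi * τe : ℝ) : ℂ) * T' - G) := by
      push_cast at e0 ⊢
      linear_combination (-(τi * τe : ℂ)) * e0
    rw [e]
    refine (norm_add_le _ _).trans ?_
    have h5 := norm_sub_le (((τi * τe + τe : ℝ) : ℂ) * (T - X))
      (((τi * τe + τi : ℝ) : ℂ) * (T' - X'))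
    have h6 := norm_sub_le (((1 - τi * τe : ℝ) : ℂ) * T') G
    have h7 : ‖((τi * τe : ℝ) : ℂ) * (((1 - τi * τe : ℝ) : ℂ) * T' - G)‖
        ≤ 1 * ‖((1 - τi * τe : ℝ) : ℂ) * T' - G‖ := by
      rw [norm_ofReal_mul]; gcongr
    linarith

end comparison
end NestedCircles

/-! ## Bipolar coordinates -/

section bipolar
variable {a c r : ℝ} {z : ℂ}

lemma sub_refl (hr : (r : ℂ) ^ 2 = (c : ℂ) ^ 2 - (a : ℂ) ^ 2) (hz : (starRingEnd ℂ) z - c ≠ 0) :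
    (a : ℂ) - refl c r z
      = (a - c) * ((starRingEnd ℂ) z + a) / ((starRingEnd ℂ) z - c) := by
  rw [refl, hr]; field_simp; ring

lemma add_refl (hr : (r : ℂ) ^ 2 = (c : ℂ) ^ 2 - (a : ℂ) ^ 2) (hz : (starRingEnd ℂ) z - c ≠ 0) :
    (a : ℂ) + refl c r z
      = (a + c) * ((starRingEnd ℂ) z - a) / ((starRingEnd ℂ) z - c) := by
  rw [refl, hr]; field_simp; ring

/-- The reflection reverses `ξ` and keeps `θ`, so it carries the generator `a² - z²` of the flow to
its negative. -/
lemma reflDeriv_mul (hr : (r : ℂ) ^ 2 = (c : ℂ) ^ 2 - (a : ℂ) ^ 2)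
    (hz : (starRingEnd ℂ) z - c ≠ 0) :
    reflDeriv c r z * (starRingEnd ℂ) ((a : ℂ) ^ 2 - z ^ 2) = -((a : ℂ) ^ 2 - refl c r z ^ 2) := by
  have e : (a : ℂ) ^ 2 - refl c r z ^ 2 = (a - refl c r z) * (a + refl c r z) := by ring
  rw [e, sub_refl hr hz, add_refl hr hz, reflDeriv, hr]
  simp only [map_sub, map_pow, Complex.conj_ofReal]
  field_simp
  ring

/-- A flow carries its own generator to itself. -/
lemma flowDeriv_mul {s : ℝ} (ha : 0 < a) (hs : 1 ≤ s) (hz : 0 ≤ z.re) :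
    flowDeriv a s z * ((a : ℂ) ^ 2 - z ^ 2) = (a : ℂ) ^ 2 - flow a s z ^ 2 := by
  have hD := flowDen_ne_zero ha hs hz
  rw [flowDeriv, flow, div_pow, eq_sub_iff_add_eq, div_mul_eq_mul_div, ← add_div,
    div_eq_iff (pow_ne_zero 2 hD), flowDen]
  ring

/-- The arguments of `L` on the far side of a circle are the values of `w⁻¹` at the reflected point.
This is why the singular function is a combination of `lerchMap` composed with folds. -/
lemma conj_bipolarExp_mul {ξ : ℝ} (hr : (r : ℂ) ^ 2 = (c : ℂ) ^ 2 - (a : ℂ) ^ 2)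
    (hca : 0 < c + a) (hξ : Real.exp (2 * ξ) * (c - a) = c + a)
    (hz : (starRingEnd ℂ) z - c ≠ 0) :
    (starRingEnd ℂ) (bipolarExp a z) * (Real.exp (-2 * ξ) : ℂ)
      = (a - refl c r z) / (a + refl c r z) := by
  have he : (Real.exp (-2 * ξ) : ℂ) = (c - a) / (c + a) := by
    rw [← Complex.ofReal_sub, ← Complex.ofReal_add, ← Complex.ofReal_div]
    congr 1
    rw [eq_div_iff hca.ne', ← hξ, ← mul_assoc, ← Real.exp_add]
    simp
  rw [sub_refl hr hz, add_refl hr hz, div_div_div_cancel_right₀ hz, he, bipolarExp, map_div₀,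
    map_add, map_sub, Complex.conj_ofReal, div_mul_div_comm, ← neg_div_neg_eq]
  congr 1 <;> ring

/-- The derivative `∂x/∂ξ` at the point `z`. -/
def bipolarVelocity (a : ℝ) (z : ℂ) : ℂ := ((a : ℂ) ^ 2 - z ^ 2) / (2 * a)

lemma exp_bipolar (hw : bipolarExp a z ≠ 0) :
    Complex.exp (bipolarXi a z + bipolarTheta a z * Complex.I) = bipolarExp a z := by
  rw [bipolarXi, bipolarTheta]
  exact Complex.exp_log hw

lemma bipolarExp_ne_zero (h1 : (a : ℂ) + z ≠ 0) (h2 : (a : ℂ) - z ≠ 0) : bipolarExp a z ≠ 0 :=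
  div_ne_zero h1 h2

lemma bipolarExp_add_one (h2 : (a : ℂ) - z ≠ 0) : bipolarExp a z + 1 = 2 * a / (a - z) := by
  rw [bipolarExp]; field_simp; ring

lemma deriv_bipolarPoint (ha : 0 < a) (h1 : (a : ℂ) + z ≠ 0) (h2 : (a : ℂ) - z ≠ 0) :
    deriv (fun s : ℝ => bipolarPoint a s (bipolarTheta a z)) (bipolarXi a z)
      = bipolarVelocity a z := by
  have ha' : (a : ℂ) ≠ 0 := by exact_mod_cast ha.ne'
  have hw := bipolarExp_ne_zero h1 h2
  have hw1 : bipolarExp a z + 1 ≠ 0 := by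
    rw [bipolarExp_add_one h2]; exact div_ne_zero (mul_ne_zero two_ne_zero ha') h2
  have hE : HasDerivAt (fun s : ℝ => Complex.exp (s + bipolarTheta a z * Complex.I))
      (bipolarExp a z) (bipolarXi a z) := by
    have h : HasDerivAt (fun s : ℝ => ((s : ℂ) + bipolarTheta a z * Complex.I)) 1
        (bipolarXi a z) := (Complex.ofRealCLM.hasDerivAt (x := bipolarXi a z)).add_const _
    have := h.cexp
    rwa [mul_one, exp_bipolar hw] at this
  have h := ((hE.sub_const 1).const_mul (a : ℂ)).div (hE.add_const 1)
    (by rwa [exp_bipolar hw])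
  rw [exp_bipolar hw] at h
  refine h.deriv.trans ?_
  rw [bipolarVelocity, bipolarExp_add_one h2, bipolarExp]
  field_simp
  ring

/-- The scale factor of bipolar coordinates: both sides equal `|w + 1|² / (2 |w|)`. -/
lemma cosh_add_cos (h1 : (a : ℂ) + z ≠ 0) (h2 : (a : ℂ) - z ≠ 0) (ha : 0 < a) :
    Real.cosh (bipolarXi a z) + Real.cos (bipolarTheta a z) = a / ‖bipolarVelocity a z‖ := by
  have hw := bipolarExp_ne_zero h1 h2
  have hn : 0 < ‖bipolarExp a z‖ := norm_pos_iff.2 hw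
  have hcos : Real.cos (bipolarTheta a z) = (bipolarExp a z).re / ‖bipolarExp a z‖ :=
    Complex.cos_arg hw
  have hcosh : Real.cosh (bipolarXi a z)
      = (‖bipolarExp a z‖ + ‖bipolarExp a z‖⁻¹) / 2 := by
    rw [bipolarXi, Real.cosh_log hn]
  have hsq : ‖bipolarExp a z + 1‖ ^ 2 = ‖bipolarExp a z‖ ^ 2 + 2 * (bipolarExp a z).re + 1 := by
    rw [← Complex.normSq_eq_norm_sq, ← Complex.normSq_eq_norm_sq, Complex.normSq_apply,
      Complex.normSq_apply]
    simp
    ring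
  have hv : ‖bipolarVelocity a z‖ = 2 * a * ‖bipolarExp a z‖ / ‖bipolarExp a z + 1‖ ^ 2 := by
    rw [bipolarExp_add_one h2, bipolarExp, bipolarVelocity]
    have e : (a : ℂ) ^ 2 - z ^ 2 = (a + z) * (a - z) := by ring
    have h3 := norm_pos_iff.2 h2
    rw [e]
    simp only [norm_div, norm_mul, Complex.norm_ofNat, Complex.norm_real,
      Real.norm_of_nonneg ha.le]
    field_simp
  have hp : 0 < ‖bipolarExp a z + 1‖ := by
    rw [bipolarExp_add_one h2]
    exact norm_pos_iff.2 (div_ne_zero (mul_ne_zero two_ne_zero (by exact_mod_cast ha.ne')) h2)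
  rw [hv, hcos, hcosh]
  have e : a / (2 * a * ‖bipolarExp a z‖ / ‖bipolarExp a z + 1‖ ^ 2)
      = ‖bipolarExp a z + 1‖ ^ 2 / (2 * ‖bipolarExp a z‖) := by field_simp
  rw [e, hsq]
  field_simp
  ring

lemma exp_neg_bipolar (hw : bipolarExp a z ≠ 0) :
    Complex.exp (-bipolarXi a z - bipolarTheta a z * Complex.I) = (a - z) / (a + z) := by
  have : -(bipolarXi a z : ℂ) - bipolarTheta a z * Complex.I
      = -(bipolarXi a z + bipolarTheta a z * Complex.I) := by ring
  rw [this, Complex.exp_neg, exp_bipolar hw, bipolarExp, inv_div]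

lemma mul_norm_lerchMapDeriv_le {b : ℝ} (ha : 0 < a) (hb : 0 ≤ b) (hz : 0 ≤ z.re) :
    a * ‖lerchMapDeriv a b z‖ ≤ 2 := by
  have h := norm_integral_weight_flowDeriv_le ha hb hz
  rw [lerchMapDeriv, integral_div, norm_div, norm_mul, Complex.norm_ofNat, Complex.norm_real,
    Real.norm_of_nonneg ha.le]
  calc _ ≤ a * (4 / (2 * a)) := by gcongr
    _ = 2 := by field_simp; norm_num

/-- A multiple of `∂x/∂ξ` with the components `Re` and `Im` of the Lerch function, in terms of the
derivative of `lerchMap`. -/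
lemma blowup_eq {b : ℝ} (ha : 0 < a) (hz : 0 < z.re) (h2 : (a : ℂ) - z ≠ 0) (g : ℂ) (k : ℝ) :
    ((g.re * k * (Real.cosh (bipolarXi a z) + Real.cos (bipolarTheta a z))
          * (lerchP (Complex.exp (-bipolarXi a z - bipolarTheta a z * Complex.I)) b).re
        + g.im * k * (Real.cosh (bipolarXi a z) + Real.cos (bipolarTheta a z))
          * (lerchP (Complex.exp (-bipolarXi a z - bipolarTheta a z * Complex.I)) b).im)
      • eXi a z : ℂ)
      = (k * a / 2 : ℝ) * ((starRingEnd ℂ) ((starRingEnd ℂ) g * lerchMapDeriv a b z)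
        + (starRingEnd ℂ) g * lerchMapDeriv a b z
          * (bipolarVelocity a z / (starRingEnd ℂ) (bipolarVelocity a z))) := by
  have h1 := add_ne_zero_of_re ha hz.le
  have ha' : (a : ℂ) ≠ 0 := by exact_mod_cast ha.ne'
  have hw := bipolarExp_ne_zero h1 h2
  have hv : bipolarVelocity a z ≠ 0 := by
    rw [bipolarVelocity]
    refine div_ne_zero ?_ (mul_ne_zero two_ne_zero ha')
    have e : (a : ℂ) ^ 2 - z ^ 2 = (a + z) * (a - z) := by ring
    rw [e]
    exact mul_ne_zero h1 h2
  have hP := lerchP_eq (b := b) ha hz.le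
  rw [← bipolarVelocity] at hP
  rw [eXi, deriv_bipolarPoint ha h1 h2, exp_neg_bipolar hw, cosh_add_cos h1 h2 ha, hP]
  set v := bipolarVelocity a z
  set Λ := lerchMapDeriv a b z
  have hn : (‖v‖ : ℂ) ≠ 0 := by exact_mod_cast norm_ne_zero_iff.2 hv
  have hv' : (starRingEnd ℂ) v ≠ 0 := (map_ne_zero _).2 hv
  have hnn : (‖v‖ : ℂ) ^ 2 = v * (starRingEnd ℂ) v := by
    rw [Complex.mul_conj, Complex.normSq_eq_norm_sq]; push_cast; rfl
  -- With `X = ḡ Λ` the left side is `k a` times the component of the conjugate of `X` along `v /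
  -- ‖v‖`; since `‖v‖² = v v̄`, this vector is `k a (X̄ + X v / v̄) / 2`.
  have e1 : g.re * k * (a / ‖v‖) * (v * Λ).re + g.im * k * (a / ‖v‖) * (v * Λ).im
      = k * (a / ‖v‖) * ((starRingEnd ℂ) g * (v * Λ)).re := by
    simp only [Complex.mul_re, Complex.conj_re, Complex.conj_im]; ring
  have e2 : (((starRingEnd ℂ) g * (v * Λ)).re : ℂ)
      = ((starRingEnd ℂ) g * (v * Λ)
        + (starRingEnd ℂ) ((starRingEnd ℂ) g * (v * Λ))) / 2 := by
    rw [Complex.add_conj]; push_cast; ring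
  simp only [Complex.real_smul]
  rw [e1]
  push_cast
  rw [e2]
  simp only [map_mul, Complex.conj_conj]
  rw [mul_add, mul_div_assoc']
  field_simp
  rw [hnn]
  field_simp
  ring

end bipolar

/-! ### The gradient of the main part in the shell -/

namespace NestedCircles
variable {D : NestedCircles}

lemma ofReal_sq_rI (D : NestedCircles) : (D.rI : ℂ) ^ 2 = (D.cI : ℂ) ^ 2 - (D.a : ℂ) ^ 2 := by
  have := D.sq_cI; rw [eq_sub_iff_add_eq]; exact_mod_cast this.symm

lemma ofReal_sq_rE (D : NestedCircles) : (D.rE : ℂ) ^ 2 = (D.cE : ℂ) ^ 2 - (D.a : ℂ) ^ 2 := by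
  have := D.sq_cE; rw [eq_sub_iff_add_eq]; exact_mod_cast this.symm

lemma a_lt_cI (D : NestedCircles) : D.a < D.cI :=
  (pow_lt_pow_iff_left₀ D.a_pos.le D.cI_pos.le two_ne_zero).1
    (by rw [D.sq_cI]; linarith [pow_pos D.rI_pos 2])

lemma a_mem_ballI (D : NestedCircles) : (D.a : ℂ) ∈ D.ballI := by
  have h1 := D.a_lt_cI
  have h2 := D.a_pos
  rw [ballI, Metric.mem_ball, dist_eq_norm, ← Complex.ofReal_sub, Complex.norm_real, norm_sub_rev,
    Real.norm_of_nonneg (by linarith)]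
  refine (pow_lt_pow_iff_left₀ (by linarith) D.rI_pos.le two_ne_zero).1 ?_
  nlinarith [D.sq_cI]

/-- In the shell, the reflection in the inner circle is the flow at a time before that of the
combined reflection. -/
lemma exists_reflI_eq_flow {z : ℂ} (hz : z ∈ D.ballE) (hz' : z ∉ D.closedI) :
    ∃ t, 0 ≤ t ∧ t ≤ 1 ∧ D.reflI z = flow D.a (Real.exp (D.μ * t)) z := by
  have hre := D.re_pos (D.ballE_subset hz)
  have ha := D.a_pos
  have hac := D.a_lt_cI
  have hacE : D.a < D.cE := hac.trans D.cI_lt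
  have h1 : 0 < Complex.normSq (D.a + z) := Complex.normSq_pos.2 (add_ne_zero_of_re ha hre.le)
  have n1 : Complex.normSq (D.a + z) = D.a ^ 2 + 2 * D.a * z.re + Complex.normSq z := by
    simp only [Complex.normSq_apply, Complex.add_re, Complex.add_im, Complex.ofReal_re,
      Complex.ofReal_im]
    ring
  have n2 : Complex.normSq (D.a - z) = D.a ^ 2 - 2 * D.a * z.re + Complex.normSq z := by
    simp only [Complex.normSq_apply, Complex.sub_re, Complex.sub_im, Complex.ofReal_re,
      Complex.ofReal_im]
    ring
  have nc : ∀ c : ℝ, ‖z - c‖ ^ 2 = Complex.normSq z - 2 * c * z.re + c ^ 2 := fun c => by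
    rw [← Complex.normSq_eq_norm_sq, Complex.normSq_apply, Complex.normSq_apply]
    simp
    ring
  have hI : D.rI ^ 2 ≤ ‖z - D.cI‖ ^ 2 := by
    refine pow_le_pow_left₀ D.rI_pos.le ?_ 2
    rw [closedI, Metric.mem_closedBall, dist_eq_norm, not_le] at hz'
    exact hz'.le
  have hE : ‖z - D.cE‖ ^ 2 ≤ D.rE ^ 2 := by
    refine pow_le_pow_left₀ (norm_nonneg _) ?_ 2
    rw [ballE, Metric.mem_ball, dist_eq_norm] at hz
    exact hz.le
  rw [nc] at hI hE
  have sI := D.sq_cI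
  have sE := D.sq_cE
  -- This is `e^{2(ξᵢ - ξ)}`: since `e^{2ξᵢ} / w̄ = (e^{2ξᵢ} / |w|²) w`, the reflection moves each
  -- point along its own flow line. Lying outside the core gives `s ≥ 1`, lying in the outer disk
  -- gives `s ≤ e^μ`.
  set s := (D.cI + D.a) * Complex.normSq (D.a - z)
    / ((D.cI - D.a) * Complex.normSq (D.a + z)) with hs
  have hden : 0 < (D.cI - D.a) * Complex.normSq (D.a + z) := mul_pos (by linarith) h1
  have hs1 : 1 ≤ s := by
    rw [hs, le_div_iff₀ hden, n1, n2, one_mul]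
    have : 0 ≤ D.a * (Complex.normSq z - 2 * D.cI * z.re + D.a ^ 2) :=
      mul_nonneg ha.le (by linarith)
    linarith
  have hs2 : s ≤ Real.exp D.μ := by
    have e : Real.exp D.μ = (D.cI + D.a) * (D.cE - D.a) / ((D.cI - D.a) * (D.cE + D.a)) := by
      have := mul_pos (sub_pos.2 hac) (by linarith : 0 < D.cE + D.a)
      rw [eq_div_iff this.ne', D.exp_μ]
    rw [e, hs, div_le_div_iff₀ hden (mul_pos (by linarith) (by linarith)), n1, n2]
    have h3 : 0 ≤ D.a * (2 * D.cE * z.re - Complex.normSq z - D.a ^ 2) :=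
      mul_nonneg ha.le (by linarith)
    have h4 : (D.a ^ 2 - 2 * D.a * z.re + Complex.normSq z) * (D.cE + D.a)
        ≤ (D.cE - D.a) * (D.a ^ 2 + 2 * D.a * z.re + Complex.normSq z) := by linarith
    have h5 := mul_le_mul_of_nonneg_left h4
      (mul_pos (by linarith : 0 < D.cI + D.a) (sub_pos.2 hac)).le
    linarith
  have hs0 : 0 < s := by linarith
  refine ⟨Real.log s / D.μ, div_nonneg (Real.log_nonneg hs1) D.μ_pos.le, ?_, ?_⟩
  · rw [div_le_one D.μ_pos, Real.log_le_iff_le_exp hs0]; exact hs2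
  · rw [mul_div_cancel₀ _ D.μ_pos.ne', Real.exp_log hs0]
    have hD := flowDen_ne_zero ha hs1 hre.le
    have hc := conj_sub_ne_zero D.rI_pos (D.notMem_ballI hz')
    have key : (s : ℂ) * ((D.cI - D.a) * ((D.a + z) * (D.a + (starRingEnd ℂ) z)))
        = (D.cI + D.a) * ((D.a - z) * (D.a - (starRingEnd ℂ) z)) := by
      have e : s * ((D.cI - D.a) * Complex.normSq (D.a + z))
          = (D.cI + D.a) * Complex.normSq (D.a - z) := by
        rw [hs, div_mul_cancel₀ _ hden.ne']
      have := congrArg (fun x : ℝ => (x : ℂ)) e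
      simp only [Complex.ofReal_mul, ← Complex.mul_conj, map_add, map_sub,
        Complex.conj_ofReal, Complex.ofReal_add, Complex.ofReal_sub] at this
      exact this
    rw [flow, eq_div_iff hD, reflI, refl, D.ofReal_sq_rI, flowDen]
    field_simp
    linear_combination key

section shell
variable {F : ℂ → ℂ} {τi τe K ρ R A b : ℝ}

/-- The error made by replacing the gradient of `mainPart` in the shell by a multiple of
`∂x/∂ξ`. -/
def shellError (K R A : ℝ) : ℝ :=
  6 * A * (1 + 1 * K * (98 + 32 * R) * (1 + R + 2 * K) + 8 * K ^ 2)
    + A * (2 + 1 * K * (98 + 32 * R) * (1 + R + 2 * K) + 8 * K ^ 2) + 4 * K * A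

/-- The reflected term is the transported one, up to the rotation `-v / v̄`, so after the bounded
shift along the flow the gradient is a combination of `X̄` and `X v / v̄`. Their equal-weight sum is
a multiple of `∂x/∂ξ`. The defect of the weights is `(τₑ - τᵢ) / 2`, and replacing `ρ` by `S` costs
at most `K a` times a quantity of size `1 / a`. -/
lemma Comparable.norm_gradient_mainPart_sub_le (H : D.Comparable F K ρ R A b τi τe) (hi0 : 0 < τi)
    (he0 : 0 < τe) {S : ℝ} (hS : |S - ρ| ≤ K * D.a) {z : ℂ} (hz : z ∈ D.ballE)
    (hz' : z ∉ D.closedI) :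
    ‖((τi * τe + τe : ℝ) * (starRingEnd ℂ) (D.mainDeriv F ρ b z)
        - (τi * τe + τi : ℝ) * D.pullI (D.mainDeriv F ρ b) z)
      - (S * (τi + τe + 2 * (τi * τe)) / 2 / 2 : ℝ)
        * ((starRingEnd ℂ) (deriv F 0 * lerchMapDeriv D.a b z)
          + deriv F 0 * lerchMapDeriv D.a b z
          * (bipolarVelocity D.a z / (starRingEnd ℂ) (bipolarVelocity D.a z)))‖
      ≤ shellError K R A := by
  have hzE := D.ballE_subset hz
  have hzI := D.notMem_ballI hz'
  have hre := D.re_pos hzE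
  have hzR := (D.norm_le_radius hzE).trans H.radius_le
  have ha := D.a_pos
  have ha' : (D.a : ℂ) ≠ 0 := by exact_mod_cast ha.ne'
  have h1 := add_ne_zero_of_re ha hre.le
  have h2 : (D.a : ℂ) - z ≠ 0 := fun h => hzI (by
    rw [← sub_eq_zero.1 h]; exact D.a_mem_ballI)
  have hsq : (D.a : ℂ) ^ 2 - z ^ 2 ≠ 0 := by
    have e : (D.a : ℂ) ^ 2 - z ^ 2 = (D.a + z) * (D.a - z) := by ring
    rw [e]
    exact mul_ne_zero h1 h2
  have hv : bipolarVelocity D.a z ≠ 0 := div_ne_zero hsq (mul_ne_zero two_ne_zero ha')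
  obtain ⟨t, ht0, ht1, ht⟩ := D.exists_reflI_eq_flow hz hz'
  have hs := one_le_exp_mul D.μ_pos ht0
  have hzt : ‖flow D.a (Real.exp (D.μ * t)) z‖ ≤ R := by
    rw [← ht]
    exact (D.norm_le_radius (D.closedI_subset_closedE (D.reflI_mem hzI))).trans H.radius_le
  have hshift := norm_lerchMapDeriv_sub_shift_le H.near H.tau_pos H.tau_lt H.exponent.1
    H.exponent.2 hre hzR ht0 ht1 hzt
  have hone := norm_one_sub_mul_lerchMapDeriv_le H.near H.tau_pos H.tau_lt H.exponent.1
    H.exponent.2 hre.le hzR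
  have hΛ := mul_norm_lerchMapDeriv_le ha H.exponent.1 hre.le
  have hA : ‖deriv F 0‖ ≤ A :=
    H.bounds.deriv_le 0 (by simp; linarith [D.radius_nonneg, H.radius_le])
  have hA0 := (norm_nonneg _).trans hA
  have hK := H.near.K_nonneg
  -- At this point reflection and flow have the same image but carry the generator to opposite
  -- vectors, which determines the antiholomorphic derivative.
  have hκ : reflDeriv D.cI D.rI z = -(flowDeriv D.a (Real.exp (D.μ * t)) z
      * (bipolarVelocity D.a z / (starRingEnd ℂ) (bipolarVelocity D.a z))) := by
    have e1 := reflDeriv_mul D.ofReal_sq_rI (conj_sub_ne_zero D.rI_pos hzI)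
    have e2 := flowDeriv_mul (z := z) ha hs hre.le
    change D.reflI z = _ at ht
    rw [← reflI, ht, ← e2] at e1
    have hc : (starRingEnd ℂ) ((D.a : ℂ) ^ 2 - z ^ 2) ≠ 0 := (map_ne_zero _).2 hsq
    rw [bipolarVelocity, map_div₀, map_mul, Complex.conj_ofReal, Complex.conj_ofNat,
      div_div_div_cancel_right₀ (mul_ne_zero two_ne_zero ha'), mul_div_assoc', ← neg_div,
      eq_div_iff hc, e1]
  have hκn : ‖bipolarVelocity D.a z / (starRingEnd ℂ) (bipolarVelocity D.a z)‖ = 1 := by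
    rw [norm_div, RCLike.norm_conj, div_self (norm_ne_zero_iff.2 hv)]
  rw [pullI, ht, hκ, mainDeriv, mainDeriv]
  set κ := bipolarVelocity D.a z / (starRingEnd ℂ) (bipolarVelocity D.a z)
  set d := flowDeriv D.a (Real.exp (D.μ * t)) z
  set Λ := lerchMapDeriv D.a b z
  set Λ' := lerchMapDeriv D.a b (flow D.a (Real.exp (D.μ * t)) z)
  set g := deriv F 0
  have e : ((τi * τe + τe : ℝ) : ℂ) * (starRingEnd ℂ) (g * (ρ / 2 * Λ))
        - ((τi * τe + τi : ℝ) : ℂ) * (g * (ρ / 2 * Λ') * -(d * κ))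
        - ((S * (τi + τe + 2 * (τi * τe)) / 2 / 2 : ℝ) : ℂ)
          * ((starRingEnd ℂ) (g * Λ) + g * Λ * κ)
      = ((τi * τe + τi : ℝ) : ℂ) * (g * (ρ / 2 * Λ' * d - ρ / 2 * Λ) * κ)
        + (((τe - τi) / 2 : ℝ) : ℂ) * ((starRingEnd ℂ) (g * (ρ / 2 * Λ)) - g * (ρ / 2 * Λ) * κ)
        - (((S - ρ) * ((τi + τe + 2 * (τi * τe)) / 4) : ℝ) : ℂ)
          * ((starRingEnd ℂ) (g * Λ) + g * Λ * κ) := by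
    simp only [map_mul, map_div₀, Complex.conj_ofReal, Complex.conj_ofNat]
    push_cast
    ring
  obtain ⟨_, hi1⟩ := abs_lt.1 H.tauI_lt
  obtain ⟨_, he1⟩ := abs_lt.1 H.tauE_lt
  have hτ := H.tau_pos
  have hτ1 := H.tau_lt
  rw [e]
  refine (norm_sub_le _ _).trans ((add_le_add_left (norm_add_le _ _) _).trans ?_)
  rw [shellError]
  refine add_le_add (add_le_add ?_ ?_) ?_
  · rw [norm_ofReal_mul, norm_mul, norm_mul, hκn, mul_one, abs_of_pos (by positivity)]
    have hc : τi * τe + τi ≤ 2 := by linarith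
    calc _ ≤ 2 * (A * (3 * (1 + 1 * K * (98 + 32 * R) * (1 + R + 2 * K) + 8 * K ^ 2))) := by
          gcongr
      _ = _ := by ring
  · rw [norm_ofReal_mul]
    have h3 : ‖(starRingEnd ℂ) (g * (ρ / 2 * Λ)) - g * (ρ / 2 * Λ) * κ‖
        ≤ 2 * (A * ‖(ρ / 2 * Λ : ℂ)‖) := by
      refine (norm_sub_le _ _).trans ?_
      rw [RCLike.norm_conj, norm_mul (g * _), hκn, mul_one, norm_mul]
      have := mul_le_mul_of_nonneg_right hA (norm_nonneg (ρ / 2 * Λ : ℂ))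
      linarith
    -- This is `(1 ∓ τi)(1 ± τe) ≥ 0`; the factor `1 - τ` is then absorbed by
    -- `norm_one_sub_mul_lerchMapDeriv_le`.
    have h4 : |(τe - τi) / 2| ≤ (1 - τi * τe) / 2 := by
      rw [abs_le]; constructor <;> nlinarith
    have h5 : 0 ≤ (1 - τi * τe) / 2 := by linarith
    calc _ ≤ (1 - τi * τe) / 2 * (2 * (A * ‖(ρ / 2 * Λ : ℂ)‖)) := by gcongr
      _ = A * ((1 - τi * τe) * ‖(ρ / 2 * Λ : ℂ)‖) := by ring
      _ ≤ _ := by gcongr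
  · rw [norm_ofReal_mul, abs_mul, abs_of_pos (by positivity : 0 < (τi + τe + 2 * (τi * τe)) / 4)]
    have h3 : ‖(starRingEnd ℂ) (g * Λ) + g * Λ * κ‖ ≤ 2 * (A * ‖Λ‖) := by
      refine (norm_add_le _ _).trans ?_
      rw [RCLike.norm_conj, norm_mul (g * _), hκn, mul_one, norm_mul]
      have := mul_le_mul_of_nonneg_right hA (norm_nonneg Λ)
      linarith
    have hc : (τi + τe + 2 * (τi * τe)) / 4 ≤ 1 := by linarith
    calc _ ≤ K * D.a * 1 * (2 * (A * ‖Λ‖)) := by gcongr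
      _ = 2 * (K * A) * (D.a * ‖Λ‖) := by ring
      _ ≤ 2 * (K * A) * 2 := by gcongr
      _ = _ := by ring

end shell
end NestedCircles

/-! ## The singular function and the regions of the plane -/

section model
variable {K rI rE ε kI kE : ℝ} {D : NestedCircles}

lemma IsModel.singularFun_eq (h : IsModel K rI rE ε D) (z : ℂ) :
    singularFun rI rE ε kI kE z = 1 / 2
      * (-((tau kI kE + tauI kI kE : ℝ) : ℂ)
          * lerchMap D.a (beta rI rE ε kI kE) (fold D.cI D.rI z)
        + ((tau kI kE + tauE kE : ℝ) : ℂ)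
          * lerchMap D.a (beta rI rE ε kI kE) (fold D.cE D.rE z)) := by
  have ha := D.a_pos
  have key : ∀ {y : ℂ}, (bipolarExp D.a y)⁻¹ = (D.a - y) / (D.a + y) := by
    intro y; rw [bipolarExp, inv_div]
  rw [singularFun]
  simp only [← h.a_eq]
  by_cases hI' : z ∈ coreDisk rI rE ε
  · have hI : z ∈ D.ballI := h.coreDisk_eq ▸ hI'
    have hE := D.closedI_subset_ballE (D.ballI_subset hI)
    rw [if_pos hI', fold_of_mem hI, fold_of_mem hE, lerchMap, key]
  · have hI : z ∉ D.ballI := h.coreDisk_eq ▸ hI'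
    rw [if_neg hI', fold_of_notMem hI]
    have eI := conj_bipolarExp_mul D.ofReal_sq_rI (add_pos D.cI_pos ha) h.expI
      (conj_sub_ne_zero D.rI_pos hI)
    by_cases hE' : z ∈ outerDisk rI rE ε
    · have hE : z ∈ D.ballE := h.outerDisk_eq ▸ hE'
      rw [if_pos hE', fold_of_mem hE, lerchMap, lerchMap, key, eI]
    · have hE : z ∉ D.ballE := h.outerDisk_eq ▸ hE'
      have eE := conj_bipolarExp_mul D.ofReal_sq_rE
        (add_pos (D.cI_pos.trans D.cI_lt) ha) h.expE (conj_sub_ne_zero D.rE_pos hE)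
      rw [if_neg hE', fold_of_notMem hE, lerchMap, lerchMap, eI, eE]

/-- Since `∇H(0)` is the conjugate of `F'(0)`, the combination of `Re q` and `Im q` is the real part
of `F'(0) q`. -/
lemma IsModel.mainPart_eq (h : IsModel K rI rE ε D) (F : ℂ → ℂ) (z : ℂ) :
    ((starRingEnd ℂ) (deriv F 0)).re * rStar rI rE ^ 2 * (singularFun rI rE ε kI kE z).re
        + ((starRingEnd ℂ) (deriv F 0)).im * rStar rI rE ^ 2 * (singularFun rI rE ε kI kE z).im
      = D.mainPart F (rStar rI rE ^ 2) (beta rI rE ε kI kE) (tauI kI kE) (tauE kE) z := by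
  have e : ∀ (q : ℂ) (s : ℝ), ((starRingEnd ℂ) (deriv F 0)).re * s * q.re
      + ((starRingEnd ℂ) (deriv F 0)).im * s * q.im = (deriv F 0 * (s * q)).re := fun q s => by
    simp only [Complex.mul_re, Complex.conj_re, Complex.conj_im, Complex.ofReal_re,
      Complex.ofReal_im, Complex.mul_im]
    ring
  rw [e, h.singularFun_eq, NestedCircles.mainPart, tau]
  set x := lerchMap D.a (beta rI rE ε kI kE) (fold D.cI D.rI z)
  set y := lerchMap D.a (beta rI rE ε kI kE) (fold D.cE D.rE z)
  set τi := tauI kI kE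
  set τe := tauE kE
  set s := rStar rI rE ^ 2
  have e' : ∀ (t : ℝ) (q : ℂ), t * q.re = ((t : ℂ) * q).re := fun t q =>
    (Complex.re_ofReal_mul t q).symm
  rw [e', e', ← Complex.sub_re]
  congr 1
  push_cast
  ring

/-- The quotient of `β` by `-log τ / μ` is `r_* μ / (4 √ε)`, independent of the conductivities; so
the error is relative and uniform in `τ`. -/
lemma IsModel.exponentBound (h : IsModel K rI rE ε D) (hτ : 0 < tau kI kE) (hτ1 : tau kI kE < 1) :
    D.ExponentBound K (beta rI rE ε kI kE) (tauI kI kE * tauE kE) := by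
  have hl : 0 < -Real.log (tau kI kE) := neg_pos.2 (Real.log_neg hτ hτ1)
  have hμ := D.μ_pos
  constructor
  · rw [beta, rStar]
    positivity
  · change |_ - -Real.log (tau kI kE) / D.μ| ≤ K * D.a * (-Real.log (tau kI kE) / D.μ)
    have e : beta rI rE ε kI kE - -Real.log (tau kI kE) / D.μ
        = (rStar rI rE * D.μ / (4 * Real.sqrt ε) - 1) * (-Real.log (tau kI kE) / D.μ) := by
      rw [sub_mul, one_mul, div_mul_div_comm, mul_right_comm, mul_div_mul_right _ _ hμ.ne', beta]
    rw [e, abs_mul, abs_of_pos (div_pos hl hμ)]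
    exact mul_le_mul_of_nonneg_right h.beta_ratio (div_pos hl hμ).le

lemma IsModel.offCircles_subset (h : IsModel K rI rE ε D) :
    offCircles rI rE ε ⊆ D.ballI ∪ D.ballE \ D.closedI ∪ D.closedEᶜ := fun z hz => by
  rw [offCircles, h.coreDisk_eq, h.outerDisk_eq, NestedCircles.ballI, NestedCircles.ballE,
    frontier_ball _ D.rI_pos.ne', frontier_ball _ D.rE_pos.ne'] at hz
  simp only [Set.mem_compl_iff, Set.mem_union, mem_sphere_iff_norm, not_or] at hz
  rcases D.trichotomy hz.1 hz.2 with h | h | h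
  · exact Or.inl (Or.inl h)
  · exact Or.inl (Or.inr h)
  · exact Or.inr h

lemma IsModel.compl_closure_subset (h : IsModel K rI rE ε D) :
    (closure (outerDisk rI rE ε \ coreDisk rI rE ε))ᶜ ⊆ D.ballI ∪ D.closedEᶜ := fun z hz => by
  rw [h.coreDisk_eq, h.outerDisk_eq] at hz
  by_contra hn
  simp only [Set.mem_union, Set.mem_compl_iff, not_or, not_not] at hn
  obtain ⟨hI, hE⟩ := hn
  refine hz ?_
  by_cases hE' : z ∈ D.ballE
  · exact subset_closure ⟨hE', hI⟩
  -- On the outer circle the shell is approached from inside the outer disk, because the closed core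
  -- stays away from that circle.
  · have h1 : z ∈ closure D.ballE := by
      rw [NestedCircles.ballE, closure_ball _ D.rE_pos.ne']; exact hE
    have h2 := (Metric.isClosed_closedBall (x := (D.cI : ℂ)) (ε := D.rI)).isOpen_compl.inter_closure
      ⟨D.notMem_closedI hE', h1⟩
    refine closure_mono ?_ h2
    exact fun y hy => ⟨hy.2, D.notMem_ballI hy.1⟩

lemma IsModel.shell_subset (h : IsModel K rI rE ε D) :
    outerDisk rI rE ε \ closure (coreDisk rI rE ε) = D.ballE \ D.closedI := by
  rw [h.coreDisk_eq, h.outerDisk_eq, NestedCircles.ballI, closure_ball _ D.rI_pos.ne',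
    NestedCircles.closedI]

lemma IsModel.comparable (h : IsModel K rI rE ε D) (hkI : 0 < kI) (hkE : 0 < kE)
    (hτ : 0 < tau kI kE) {F : ℂ → ℂ} {A : ℝ} (hB : DerivBounds F (2 * rE + 1 + 1) A) :
    D.Comparable F K (rStar rI rE ^ 2) (2 * rE + 1) A (beta rI rE ε kI kE) (tauI kI kE)
      (tauE kE) :=
  ⟨hB, h.near, h.radius_le, abs_tauI_lt hkI hkE, abs_tauE_lt hkE, hτ, h.exponentBound hτ
    (lt_of_abs_lt (abs_mul_lt_one (abs_tauI_lt hkI hkE) (abs_tauE_lt hkE)))⟩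

lemma IsModel.blowupTerm_eq (h : IsModel K rI rE ε D) {H : ℂ → ℝ} {z : ℂ} (hz : 0 < z.re)
    (hz' : (D.a : ℂ) - z ≠ 0) :
    blowupTerm rI rE ε kI kE H z
      = ((rStar rI rE * D.a / Real.sqrt ε * (tauI kI kE + tauE kE
          + 2 * (tauI kI kE * tauE kE)) / 2 / 2 : ℝ) : ℂ)
        * ((starRingEnd ℂ) ((starRingEnd ℂ) (gradient H 0)
            * lerchMapDeriv D.a (beta rI rE ε kI kE) z)
          + (starRingEnd ℂ) (gradient H 0) * lerchMapDeriv D.a (beta rI rE ε kI kE) z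
          * (bipolarVelocity D.a z / (starRingEnd ℂ) (bipolarVelocity D.a z))) := by
  rw [blowupTerm]
  simp only [← h.a_eq]
  rw [blowup_eq D.a_pos hz hz', tau]
  congr 2
  ring

end model

lemma tau_near_one_iff {η : ℝ} (hη : 0 < η) : ∃ δ : ℝ, 0 < δ ∧ ∀ kI kE : ℝ, 0 < kI → 0 < kE →
    ((kE < δ ∧ kE < δ * kI → 1 - η < tauI kI kE ∧ 1 - η < tauE kE) ∧
      (1 - δ < tauI kI kE ∧ 1 - δ < tauE kE → kE < η ∧ kE < η * kI)) := by
  -- The relation `1 - δ < τₑ` reads `(2 - δ) kE < δ`, and `δ ≤ 1` turns it into `kE < δ`; similarly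
  -- for `τᵢ`. In the converse direction `2 kE < η kI` suffices.
  refine ⟨min (η / 2) 1, lt_min (by positivity) one_pos, fun kI kE hkI hkE => ?_⟩
  set δ := min (η / 2) 1
  have hδ : δ ≤ η / 2 := min_le_left _ _
  have hδ1 : δ ≤ 1 := min_le_right _ _
  constructor
  · rintro ⟨h1, h2⟩
    rw [tauI, tauE, lt_div_iff₀ (by positivity), lt_div_iff₀ (by positivity)]
    have h3 : δ * kI ≤ η / 2 * kI := mul_le_mul_of_nonneg_right hδ hkI.le
    have h4 : 0 < η * kE := mul_pos hη hkE
    constructor <;> linarith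
  · rintro ⟨h1, h2⟩
    rw [tauI, lt_div_iff₀ (by positivity)] at h1
    rw [tauE, lt_div_iff₀ (by positivity)] at h2
    have h3 : δ * kE ≤ 1 * kE := mul_le_mul_of_nonneg_right hδ1 hkE.le
    have h4 : δ * kI ≤ η / 2 * kI := mul_le_mul_of_nonneg_right hδ hkI.le
    have h5 : 0 < η * kI := mul_pos hη hkI
    constructor <;> linarith

end CoreShell
end

/-- There is a threshold `ε₀`, depending only on the radii, such that for every entire harmonic `H`
the following hold for the solution `u`, for all `0 < ε < ε₀` and all conductivities; the constants
`C` depend only on the radii and on `H` (and on `η` where it occurs).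
* The remainder `r` in the decomposition of `u` has `‖∇r‖_{L^∞(ℝ²)} ≤ C` (`r` is continuous, and
  differentiable with gradient at most `C` off the two circles), if `0 < τ`.
* `∇(u - H)` is bounded by `C` off the closed shell, for all conductivities.
* Blow-up occurs only when `τᵢ` and `τₑ` are both close to `1`.
* `τᵢ` and `τₑ` are close to `1` if and only if `k_e ≪ 1` and `k_e ≪ k_i`.
* If `τᵢ, τₑ > 0`, then in the shell `∇(u - H)` is the blow-up term up to an error at most `C`. -/
theorem theorem4p4 (rI rE : ℝ) (hrI : 0 < rI) (hrE : rI < rE) :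
    ∃ ε₀ : ℝ, 0 < ε₀ ∧ ε₀ ≤ rE - rI ∧
      ∀ H : ℂ → ℝ, InnerProductSpace.HarmonicOnNhd H Set.univ →
        (∃ C : ℝ, ∀ (ε kI kE : ℝ) (u : ℂ → ℝ), 0 < ε → ε < ε₀ → 0 < kI → 0 < kE →
          IsSolution rI rE ε kI kE H u → 0 < tau kI kE →
            Continuous (remainder rI rE ε kI kE H u) ∧
            GradBoundedOn (remainder rI rE ε kI kE H u) (offCircles rI rE ε) C) ∧
        (∃ C : ℝ, ∀ (ε kI kE : ℝ) (u : ℂ → ℝ), 0 < ε → ε < ε₀ → 0 < kI → 0 < kE →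
          IsSolution rI rE ε kI kE H u →
            GradBoundedOn (fun z => u z - H z)
              (closure (outerDisk rI rE ε \ coreDisk rI rE ε))ᶜ C) ∧
        (∀ η : ℝ, 0 < η →
          ∃ C : ℝ, ∀ (ε kI kE : ℝ) (u : ℂ → ℝ), 0 < ε → ε < ε₀ → 0 < kI → 0 < kE →
            IsSolution rI rE ε kI kE H u → (tauI kI kE ≤ 1 - η ∨ tauE kE ≤ 1 - η) →
              GradBoundedOn (fun z => u z - H z) (offCircles rI rE ε) C) ∧
        (∀ η : ℝ, 0 < η → ∃ δ : ℝ, 0 < δ ∧ ∀ kI kE : ℝ, 0 < kI → 0 < kE →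
          ((kE < δ ∧ kE < δ * kI → 1 - η < tauI kI kE ∧ 1 - η < tauE kE) ∧
            (1 - δ < tauI kI kE ∧ 1 - δ < tauE kE → kE < η ∧ kE < η * kI))) ∧
        (∃ C : ℝ, ∀ (ε kI kE : ℝ) (u : ℂ → ℝ), 0 < ε → ε < ε₀ → 0 < kI → 0 < kE →
          IsSolution rI rE ε kI kE H u → 0 < tauI kI kE → 0 < tauE kE →
            ∀ z ∈ outerDisk rI rE ε \ closure (coreDisk rI rE ε),
              DifferentiableAt ℝ (fun y => u y - H y) z ∧
              ‖gradient (fun y => u y - H y) z - blowupTerm rI rE ε kI kE H z‖ ≤ C) := by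
  obtain ⟨ε₀, K, hε₀, hε₀', -, hmodel⟩ := exists_isModel hrI hrE
  refine ⟨ε₀, hε₀, hε₀', fun H hH => ?_⟩
  -- Every entire harmonic function is the real part of an entire function; all constants below
  -- depend on `H` through bounds for this `F` on a fixed disk.
  obtain ⟨F, hFa, rfl⟩ := hH.exists_analyticOnNhd_univ_re_eq
  have hF : Differentiable ℂ F := fun z => (hFa z (Set.mem_univ z)).differentiableAt
  have hgrad : gradient (fun z => (F z).re) 0 = (starRingEnd ℂ) (deriv F 0) :=
    (hasGradientAt_re (hF 0).hasDerivAt).gradient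
  obtain ⟨A, hB⟩ := exists_derivBounds hF (2 * rE + 1 + 1)
  have hA : 0 ≤ A := hB.nonneg (by linarith)
  have hsub : ∀ {ε kI kE : ℝ} {u : ℂ → ℝ} {D : NestedCircles}, IsModel K rI rE ε D → 0 < kI →
      0 < kE → IsSolution rI rE ε kI kE (fun z => (F z).re) u →
      (fun z => u z - (F z).re) = fun z => D.solution F (tauI kI kE) (tauE kE) z - (F z).re
        - D.limitAtInfinity F (tauI kI kE) (tauE kE) := fun h hkI hkE hu => by
    ext z
    rw [h.solution_unique hkI hkE hF hu z]
    ring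
  refine ⟨?_, ?_, fun η hη => ?_, fun η hη => tau_near_one_iff hη, ?_⟩
  · refine ⟨2 * A + 4 * NestedCircles.mainError K (2 * rE + 1) A,
      fun ε kI kE u hε hεε hkI hkE hu hτ => ?_⟩
    obtain ⟨D, h⟩ := hmodel ε hε hεε
    have hC := h.comparable hkI hkE hτ hB
    have e : remainder rI rE ε kI kE (fun z => (F z).re) u
        = fun z => D.solution F (tauI kI kE) (tauE kE) z - (F z).re
          - D.mainPart F (rStar rI rE ^ 2) (beta rI rE ε kI kE) (tauI kI kE) (tauE kE) z
          - D.limitAtInfinity F (tauI kI kE) (tauE kE) := by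
      ext z
      have h1 := h.mainPart_eq (kI := kI) (kE := kE) F z
      rw [remainder, h.solution_unique hkI hkE hF hu z, hgrad]
      linarith
    rw [e]
    constructor
    · exact (((D.boundedlyLipschitz_solution hF (abs_mul_lt_one (abs_tauI_lt hkI hkE)
        (abs_tauE_lt hkE))).continuous.sub (Complex.continuous_re.comp hF.continuous)).sub
          (D.continuous_mainPart hC.exponent.1)).sub continuous_const
    · exact ((hC.gradBoundedOn_sub_mainPart hF).mono h.offCircles_subset le_rfl).sub_const _
  · refine ⟨3 * A + 4 * NestedCircles.alternatingBound K (2 * rE + 1) A,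
      fun ε kI kE u hε hεε hkI hkE hu => ?_⟩
    obtain ⟨D, h⟩ := hmodel ε hε hεε
    have hN := D.alternatingBound_nonneg h.near (by linarith : 0 ≤ 2 * rE + 1) hA
    rw [hsub h hkI hkE hu]
    refine GradBoundedOn.sub_const (GradBoundedOn.mono (GradBoundedOn.union
      (D.gradBoundedOn_core hF hB h.near h.radius_le (abs_tauI_lt hkI hkE) (abs_tauE_lt hkE))
      ((D.gradBoundedOn_exterior hF hB h.radius_le (abs_tauI_lt hkI hkE) (abs_tauE_lt hkE)).mono
        subset_rfl (by linarith))) h.compl_closure_subset le_rfl) _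
  · refine ⟨3 * A + 4 * (A / η) + 4 * NestedCircles.alternatingBound K (2 * rE + 1) A,
      fun ε kI kE u hε hεε hkI hkE hu hτ => ?_⟩
    obtain ⟨D, h⟩ := hmodel ε hε hεε
    have hN := D.alternatingBound_nonneg h.near (by linarith : 0 ≤ 2 * rE + 1) hA
    have hAη : 0 ≤ A / η := by positivity
    have hi := abs_tauI_lt hkI hkE
    have he := abs_tauE_lt hkE
    rw [hsub h hkI hkE hu]
    refine GradBoundedOn.sub_const (GradBoundedOn.mono (GradBoundedOn.union (GradBoundedOn.union
      ((D.gradBoundedOn_core hF hB h.near h.radius_le hi he).mono subset_rfl (by linarith))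
      (D.gradBoundedOn_shell hF hB h.near h.radius_le hi he hη hτ))
      ((D.gradBoundedOn_exterior hF hB h.radius_le hi he).mono subset_rfl (by linarith)))
      h.offCircles_subset le_rfl) _
  · refine ⟨2 * A + 4 * NestedCircles.mainError K (2 * rE + 1) A
      + NestedCircles.shellError K (2 * rE + 1) A,
      fun ε kI kE u hε hεε hkI hkE hu hi0 he0 z hz => ?_⟩
    obtain ⟨D, h⟩ := hmodel ε hε hεε
    have hC := h.comparable hkI hkE (mul_pos hi0 he0) hB
    rw [h.shell_subset] at hz
    have hre := D.re_pos (D.ballE_subset hz.1)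
    have hza : (D.a : ℂ) - z ≠ 0 := fun h0 => D.notMem_ballI hz.2 (by
      rw [← sub_eq_zero.1 h0]; exact D.a_mem_ballI)
    have hS := hasGradientAt_sub (D.hasGradientAt_solution_shell hF
      (abs_mul_lt_one hC.tauI_lt hC.tauE_lt) hz.1 hz.2) (hasGradientAt_re (hF z).hasDerivAt)
    have hM := D.hasGradientAt_mainPart_shell (F := F) (ρ := rStar rI rE ^ 2)
      (τi := tauI kI kE) (τe := tauE kE) hC.exponent.1 hz.1 hz.2
    have h1 := ((hC.gradBoundedOn_sub_mainPart hF) z (Or.inl (Or.inr hz))).2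
    have h2 := hC.norm_gradient_mainPart_sub_le hi0 he0 h.scale_ratio hz.1 hz.2
    rw [(hasGradientAt_sub hS hM).gradient] at h1
    have hS' := hasGradientAt_sub_const hS (D.limitAtInfinity F (tauI kI kE) (tauE kE))
    rw [← hsub h hkI hkE hu] at hS'
    refine ⟨hS'.differentiableAt, ?_⟩
    rw [hS'.gradient, h.blowupTerm_eq hre hza, hgrad, Complex.conj_conj]
    -- The gradient is close to that of the main part by (a), and the latter is close to the blow-up
    -- term.
    exact (norm_sub_le_norm_sub_add_norm_sub _ _ _).trans (add_le_add h1 h2)
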